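/- Let $k\ge 0$ and let $\Omega\subset\mathbb{R}^{2k+1}$ be a compact domain with piecewise smooth boundary, that is, $\Omega$ is compact, is the closure of its interior, and $\partial\Omega$ is a smooth hypersurface bounding $\Omega$ locally on one side, outside a set of $2k$-dimensional Hausdorff measure zero. Let $\alpha$ be a closed Dirichlet $(k+1)$-form on $\Omega$, that is, a smooth $(k+1)$-form on $\Omega$ with $d\alpha=0$ and such that $\alpha_x(V_1,\dots,V_{k+1})=0$ whenever $x$ is a smooth point of $\partial\Omega$ and $V_1,\dots,V_{k+1}$ are tangent to $\partial\Omega$ at $x$. For a $(k+1)$-form $\beta$ on $\Omega'\subset\mathbb{R}^{2k+1}$ the helicity is $$\mathrm{Hel}(\beta)=\int_{C_2(\Omega')}\beta_x\wedge\beta_y\wedge g^*\mathrm{dVol}_{S^{2k}},$$ where $C_2(\Omega')=\{(x,y)\in\Omega'\times\Omega' : x\ne y\}$ is the configuration space of two points (its compactification $C_2[\Omega']$ adds only a boundary, which does not contribute to the integral), oriented by $\mathrm{dVol}_x\wedge \mathrm{dVol}_y$; $\beta_x,\beta_y$ are the pullbacks of $\beta$ under $(x,y)\mapsto x$ and $(x,y)\mapsto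 y$; $g(x,y)=(y-x)/\|y-x\|$ is the Gauss map; and $\mathrm{dVol}_{S^{2k}}$ is the rotation-invariant volume form on $S^{2k}$ of total integral $1$. Let $f\colon\Omega\times[0,1]\to\mathbb{R}^{2k+1}$ be a smooth map such that each $f_t=f(\cdot,t)$ is a diffeomorphism of $\Omega$ onto its image $\Omega_t=f_t(\Omega)$, with $f_0=\mathrm{id}$, and let $\alpha_1=(f_1^{-1})^*\alpha$ on $\Omega_1$. Then the integrals defining the helicity of $\alpha$ on $\Omega$ and the helicity of $\alpha_1$ on $\Omega_1$ converge absolutely, and $$\mathrm{Hel}(\alpha_1)=\mathrm{Hel}(\alpha).$$ The maps $f_t$ are not assumed to preserve volume. -/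

import Mathlib

open Set MeasureTheory
open scoped ContDiff

noncomputable section

namespace Helicity

/-- Euclidean space of dimension `2k+1`. -/
abbrev Eucl (k : ℕ) : Type := EuclideanSpace ℝ (Fin (2 * k + 1))

/-- `p`-forms on `ℝ^{2k+1}`; only their values on the domain at hand are ever used. -/
abbrev Form (k p : ℕ) : Type := Eucl k → (Eucl k) [⋀^Fin p]→L[ℝ] ℝ

/-! ### Domains with piecewise smooth boundary -/

/-- `ρ` is a smooth defining function of `Ω` on the open set `U`, a neighbourhood of the boundary
point `x`: there `Ω` is the sublevel set `{ρ ≤ 0}`, `ρ x = 0` and `dρ_x ≠ 0`. -/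
structure IsDefiningFunctionAt {k : ℕ} (Ω : Set (Eucl k)) (x : Eucl k) (U : Set (Eucl k))
    (ρ : Eucl k → ℝ) : Prop where
  isOpen : IsOpen U
  mem : x ∈ U
  smooth : ContDiffOn ℝ ∞ ρ U
  eq_zero : ρ x = 0
  regular : fderiv ℝ ρ x ≠ 0
  inter_eq : Ω ∩ U = {y ∈ U | ρ y ≤ 0}

/-- Near `x`, the set `Ω` is a domain with smooth boundary through `x`. -/
def IsSmoothBoundaryPoint {k : ℕ} (Ω : Set (Eucl k)) (x : Eucl k) : Prop :=
  ∃ (U : Set (Eucl k)) (ρ : Eucl k → ℝ), IsDefiningFunctionAt Ω x U ρ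

/-- Compact domains of `ℝ^{2k+1}` with piecewise smooth boundary: compact sets that are the closure
of their interior, and whose boundary is a smooth hypersurface outside a set (of edges, corners,
...) of `2k`-dimensional Hausdorff measure zero. Domains with smooth boundary are those for which
the exceptional set is empty. -/
structure IsCompactDomain {k : ℕ} (Ω : Set (Eucl k)) : Prop where
  isCompact : IsCompact Ω
  closure_interior : closure (interior Ω) = Ω
  piecewise_smooth :
    Measure.hausdorffMeasure (2 * k : ℝ) {x ∈ frontier Ω | ¬ IsSmoothBoundaryPoint Ω x} = 0

/-! ### Closed Dirichlet forms -/

/-- `α` is a smooth closed `p`-form on `Ω` that vanishes on tuples of vectors tangent to the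
boundary of `Ω`. The tangent space of the boundary at `x` is the kernel of `dρ_x`, for a
defining function `ρ` at `x`. -/
structure IsClosedDirichlet {k p : ℕ} (Ω : Set (Eucl k)) (α : Form k p) : Prop where
  smooth : ContDiffOn ℝ ∞ α Ω
  closed : ∀ x ∈ interior Ω, extDeriv α x = 0
  dirichlet : ∀ x ∈ frontier Ω, ∀ (U : Set (Eucl k)) (ρ : Eucl k → ℝ),
    IsDefiningFunctionAt Ω x U ρ →
      ∀ V : Fin p → Eucl k, (∀ i, fderiv ℝ ρ x (V i) = 0) → α x V = 0

/-! ### Diffeomorphisms and pullbacks -/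

/-- `f` restricts to a diffeomorphism of `Ω` onto its image `f '' Ω`. -/
structure IsDiffeoOn {k : ℕ} (f : Eucl k → Eucl k) (Ω : Set (Eucl k)) : Prop where
  smooth : ContDiffOn ℝ ∞ f Ω
  injOn : InjOn f Ω
  smooth_inv : ContDiffOn ℝ ∞ (Function.invFunOn f Ω) (f '' Ω)

/-- The pullback `g^* α` of a form under a map `g` defined on the set `s`. -/
def pullbackOn {k p : ℕ} (g : Eucl k → Eucl k) (s : Set (Eucl k)) (α : Form k p) : Form k p :=
  fun q => (α (g q)).compContinuousLinearMap (fderivWithin ℝ g s q)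

/-- The form `(f⁻¹)^* α` on `f '' Ω`, where `f⁻¹` is the inverse of `f : Ω → f '' Ω`. -/
def pushforward {k p : ℕ} (f : Eucl k → Eucl k) (Ω : Set (Eucl k)) (α : Form k p) : Form k p :=
  pullbackOn (Function.invFunOn f Ω) (f '' Ω) α

/-! ### The helicity -/

/-- The wedge product `a ∧ b = ∑_σ sign σ • (a ⊗ b) ∘ σ`, the sum over `(m, n)`-shuffles. -/
def wedge {V : Type*} [AddCommGroup V] [Module ℝ V] {m n : ℕ}
    (a : V [⋀^Fin m]→ₗ[ℝ] ℝ) (b : V [⋀^Fin n]→ₗ[ℝ] ℝ) : V [⋀^Fin (m + n)]→ₗ[ℝ] ℝ :=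
  ((LinearMap.mul' ℝ ℝ).compAlternatingMap (a.domCoprod b)).domDomCongr finSumFinEquiv

/-- The configuration space `C_2(Ω)` of ordered pairs of distinct points of `Ω`. -/
def configSpace {k : ℕ} (Ω : Set (Eucl k)) : Set (Eucl k × Eucl k) :=
  {z | z.1 ∈ Ω ∧ z.2 ∈ Ω ∧ z.1 ≠ z.2}

/-- The Gauss map `(x, y) ↦ (y - x) / ‖y - x‖`. -/
def gaussMap {k : ℕ} (z : Eucl k × Eucl k) : Eucl k :=
  ‖z.2 - z.1‖⁻¹ • (z.2 - z.1)

/-- The surface area of the unit sphere `S^{2k}`. -/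
def sphereArea (k : ℕ) : ℝ :=
  (volume : Measure (Eucl k)).toSphere.real univ

/-- The volume form of `S^{2k}` at `u`, normalized to total integral one:
`(v_1, ..., v_{2k}) ↦ det (u, v_1, ..., v_{2k}) / area (S^{2k})` on vectors tangent at `u`. -/
def sphereForm {k : ℕ} (u : Eucl k) : (Eucl k) [⋀^Fin (2 * k)]→ₗ[ℝ] ℝ :=
  (sphereArea k)⁻¹ •
    (EuclideanSpace.basisFun (Fin (2 * k + 1)) ℝ).toBasis.det.curryLeft u

/-- The pullback of the unit volume form of `S^{2k}` under the Gauss map. -/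
def gaussForm {k : ℕ} (z : Eucl k × Eucl k) : (Eucl k × Eucl k) [⋀^Fin (2 * k)]→ₗ[ℝ] ℝ :=
  (sphereForm (gaussMap z)).compLinearMap (fderiv ℝ gaussMap z).toLinearMap

/-- The `(4k+2)`-form `α_x ∧ α_y ∧ g^* dVol` on the configuration space. -/
def helicityForm {k : ℕ} (α : Form k (k + 1)) (z : Eucl k × Eucl k) :
    (Eucl k × Eucl k) [⋀^Fin ((k + 1) + (k + 1) + 2 * k)]→ₗ[ℝ] ℝ :=
  wedge
    (wedge
      ((α z.1).toAlternatingMap.compLinearMap (LinearMap.fst ℝ (Eucl k) (Eucl k)))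
      ((α z.2).toAlternatingMap.compLinearMap (LinearMap.snd ℝ (Eucl k) (Eucl k))))
    (gaussForm z)

/-- The positively oriented orthonormal frame `∂/∂x_1, ..., ∂/∂x_n, ∂/∂y_1, ..., ∂/∂y_n` of
`ℝ^n × ℝ^n`, where `n = 2k+1`. -/
def stdFrame (k : ℕ) : Fin ((k + 1) + (k + 1) + 2 * k) → Eucl k × Eucl k :=
  Fin.append
      (fun i : Fin (2 * k + 1) => ((EuclideanSpace.single i (1 : ℝ) : Eucl k), (0 : Eucl k)))
      (fun i : Fin (2 * k + 1) => ((0 : Eucl k), (EuclideanSpace.single i (1 : ℝ) : Eucl k))) ∘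
    Fin.cast (by omega)

/-- The coefficient of the helicity form with respect to `dx_1 ∧ ... ∧ dx_n ∧ dy_1 ∧ ... ∧ dy_n`. -/
def helicityDensity {k : ℕ} (α : Form k (k + 1)) (z : Eucl k × Eucl k) : ℝ :=
  helicityForm α z (stdFrame k)

/-- The helicity of `α` on `Ω`: the integral of `α_x ∧ α_y ∧ g^* dVol` over the configuration space
of pairs of distinct points of `Ω`. The boundary that is added to `C_2(Ω)` in the compactification
`C_2[Ω]` is a null set, and so does not contribute. -/
def helicity {k : ℕ} (Ω : Set (Eucl k)) (α : Form k (k + 1)) : ℝ :=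
  ∫ z in configSpace Ω, helicityDensity α z

end Helicity

end

/-!
The helicity is a quadratic expression in the Hodge dual of `α`. Write `M_I` for the coordinates of
this dual `k`-vector (`starCoord`) and `K z = z / ‖z‖ ^ n`, `n = 2k+1`. The coefficient of
`α_x ∧ α_y ∧ g^* dVol` is a universal constant times
`∑_{I,J} M_I(x) M_J(y) det (K (y - x), e_I, e_J)` (`exists_helicityDensity_eq`). The `k`-vector of a
closed Dirichlet form is divergence free, and tangent to the boundary in each of its slots.

Under a diffeomorphism `F` the `k`-vector is transported by `DF` and divided by the Jacobian, and
the two Jacobians cancel against those of the change of variables. So the helicity of the image of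
`α` is, up to the constant, an integral over the fixed domain, of the density
`∑ M_I(x) M_J(y) det (K (F y - F x), DF e_I, DF e_J)` (`linkDensity`,
`IsDiffeoOn.integrableOn_and_helicity_pushforward`). As `Ω` is only assumed to be compact and
`f_t` to be smooth on `Ω`, the integration is over the interior of `Ω`; its boundary is a null set
(`volume_frontier_eq_zero`). The derivatives of `f_t` are uniformly bounded and the Jacobians are
bounded from below by compactness (`exists_isRegularIsotopy`), so that the integrals converge
absolutely; volumes need not be preserved.

To differentiate in `t`, the kernel is replaced by the smooth kernel
`z / (‖z‖² + ε²) ^ (n / 2)` (`regKernel`). In the derivative of the density with respect to the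
velocity `v`, the terms in which a derivative of `v` stands in the determinant are integrated by
parts, which moves the derivative to the kernel. There are no boundary terms since the field being
differentiated is tangent to the boundary (`integral_sum_starCoord_mul_fderiv_eq_zero`). The
derivation that `DK` induces on determinants is multiplication by its trace, and so only the
divergence of the kernel is left (`integral_linkDeriv`): the derivative of the regularized helicity
is `∬ (div K)(F y - F x) ∑ M_I(x) M_J(y) det (v y - v x, DF e_I, DF e_J)`.

The divergence of the regularized kernel is an approximate multiple of the delta function, of
bounded mass and concentrated on the diagonal, where the increment `v y - v x` vanishes. Hence the
derivative is bounded uniformly in `ε` and `t`, and tends to zero with `ε`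
(`tendsto_lintegral_regDelta_mul`). Integrating over `t` and letting `ε` tend to zero gives the
invariance (`tendsto_linkIntegral_sub`, `linkIntegral_kernel_one_eq`).

The divergence theorem is needed only for fields tangent to the boundary, for which it says that
the integral of the divergence vanishes (`IsTangentField.integral_divergence_eq_zero`). Near a
smooth point of the boundary the field is cut off along a tube of width `δ`: the cutoff has slope
`1 / δ` and the tube has volume `O(δ)`, but the normal component of the field tends to zero. The
singular points of the boundary are covered by finitely many balls with
`∑ r_i ^ (2k)` small; cutting off the field there costs no more than a multiple of this sum, as the
field is bounded.
-/


noncomputable section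

namespace Helicity
variable {k : ℕ}
open Filter Topology

/-! ### Sums over permutations -/

section PermSign

variable {τ β : Type*} [Fintype τ] [DecidableEq τ] [DecidableEq β]

/-- For an enumeration `e` of `β` by `τ`, the sign of `T` as a permutation of `τ` if `T` is
bijective, and zero otherwise. -/
def permSign (e : τ ≃ β) (T : τ → β) : ℝ :=
  Matrix.det (Matrix.of fun i j => if T i = e j then (1 : ℝ) else 0)

theorem permSign_comp_perm (e : τ ≃ β) (T : τ → β) (ρ : Equiv.Perm τ) :
    permSign e (T ∘ ρ) = (Equiv.Perm.sign ρ : ℤ) * permSign e T := by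
  unfold permSign
  rw [← Matrix.det_permute ρ]
  rfl

theorem permSign_perm_trans (e : τ ≃ β) (T : τ → β) (ρ : Equiv.Perm τ) :
    permSign (ρ.trans e) T = (Equiv.Perm.sign ρ : ℤ) * permSign e T := by
  unfold permSign
  rw [← Matrix.det_permute' ρ]
  rfl

theorem injective_of_permSign_ne_zero {e : τ ≃ β} {T : τ → β} (h : permSign e T ≠ 0) :
    Function.Injective T := by
  intro i j hij
  by_contra hne
  exact h (Matrix.det_zero_of_row_eq hne (by ext l; simp [hij]))

/-- Sums over permutations as sums over all tuples: `permSign` vanishes unless the tuple is a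
bijection. -/
theorem sum_sign_mul_eq_sum_permSign [Fintype β] (e : τ ≃ β) (F : (τ → β) → ℝ) :
    ∑ σ : Equiv.Perm τ, ((Equiv.Perm.sign σ : ℤ) : ℝ) * F (e ∘ σ) =
      ∑ T : τ → β, permSign e T * F T := by
  have h : ∀ T : τ → β, permSign e T * F T =
      ∑ σ : Equiv.Perm τ, ((Equiv.Perm.sign σ : ℤ) : ℝ) * (if T = e ∘ σ then F T else 0) := by
    intro T
    unfold permSign
    rw [Matrix.det_apply, Finset.sum_mul, ← Equiv.sum_comp (Equiv.inv (Equiv.Perm τ))]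
    refine Finset.sum_congr rfl fun σ _ => ?_
    have : (∏ i, if T (σ⁻¹ i) = e i then (1 : ℝ) else 0) = if T = e ∘ σ then 1 else 0 := by
      rw [Finset.prod_ite_zero]
      simp only [Finset.mem_univ, forall_true_left, Finset.prod_const_one]
      congr 1
      rw [eq_iff_iff, funext_iff]
      constructor
      · intro h i
        simpa using h (σ i)
      · intro h i
        simpa using h (σ⁻¹ i)
    simp only [Equiv.inv_apply, Equiv.Perm.sign_inv, Matrix.of_apply, Units.smul_def, zsmul_eq_mul]
    rw [this]
    split_ifs <;> simp
  simp_rw [h]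
  rw [Finset.sum_comm]
  simp

end PermSign

/-- The wedge product as a sum over all permutations rather than over shuffles; each shuffle is
counted `m! n!` times. -/
theorem wedge_apply {V : Type*} [AddCommGroup V] [Module ℝ V] {m n : ℕ}
    (a : V [⋀^Fin m]→ₗ[ℝ] ℝ) (b : V [⋀^Fin n]→ₗ[ℝ] ℝ) (v : Fin m ⊕ Fin n → V) :
    ((m.factorial : ℝ) * n.factorial) * wedge a b (v ∘ finSumFinEquiv.symm) =
      ∑ σ : Equiv.Perm (Fin m ⊕ Fin n), ((Equiv.Perm.sign σ : ℤ) : ℝ) *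
        (a (fun i => v (σ (Sum.inl i))) * b (fun i => v (σ (Sum.inr i)))) := by
  have h := congrArg (fun w => LinearMap.mul' ℝ ℝ (w v))
    (MultilinearMap.domCoprod_alternization_eq a b)
  simp only [MultilinearMap.alternatization_apply, AlternatingMap.smul_apply, map_sum,
    Fintype.card_fin] at h
  rw [map_nsmul, nsmul_eq_mul, Nat.cast_mul] at h
  unfold wedge
  rw [AlternatingMap.domDomCongr_apply]
  have hv : (fun i => (v ∘ finSumFinEquiv.symm) (finSumFinEquiv i)) = v := by
    ext i; simp
  rw [show ((v ∘ finSumFinEquiv.symm) ∘ finSumFinEquiv) = v from hv,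
    LinearMap.compAlternatingMap_apply, ← h]
  refine Finset.sum_congr rfl fun σ _ => ?_
  rw [Units.smul_def, map_zsmul, zsmul_eq_mul]
  simp [MultilinearMap.domDomCongr_apply, MultilinearMap.domCoprod_apply]

/-- A triple wedge product, evaluated on an enumeration of a family `f` of vectors indexed by `β`,
as a sum over all ways `T` to fill the arguments of the three forms with members of the family. -/
theorem wedge_wedge_apply {V β : Type*} [AddCommGroup V] [Module ℝ V] [Fintype β] [DecidableEq β]
    {m m' n : ℕ} (a : V [⋀^Fin m]→ₗ[ℝ] ℝ) (b : V [⋀^Fin m']→ₗ[ℝ] ℝ) (c : V [⋀^Fin n]→ₗ[ℝ] ℝ)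
    (f : β → V) (e : (Fin m ⊕ Fin m') ⊕ Fin n ≃ β) :
    ((m.factorial : ℝ) * m'.factorial * n.factorial) * wedge (wedge a b) c
        ((f ∘ e) ∘ (finSumFinEquiv.symm.trans
          (Equiv.sumCongr finSumFinEquiv.symm (Equiv.refl (Fin n))))) =
      ∑ T : (Fin m ⊕ Fin m') ⊕ Fin n → β, permSign e T *
        (a (fun i => f (T (Sum.inl (Sum.inl i)))) * b (fun i => f (T (Sum.inl (Sum.inr i)))) *
          c (fun i => f (T (Sum.inr i)))) := by
  set q : (Fin (m + m') ⊕ Fin n) ≃ (Fin m ⊕ Fin m') ⊕ Fin n :=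
    Equiv.sumCongr finSumFinEquiv.symm (Equiv.refl (Fin n)) with hq
  set v : (Fin m ⊕ Fin m') ⊕ Fin n → V := f ∘ e with hv
  have hfac : (((m + m').factorial : ℕ) : ℝ) ≠ 0 := by positivity
  rw [← sum_sign_mul_eq_sum_permSign e (fun T => a (fun i => f (T (Sum.inl (Sum.inl i)))) *
    b (fun i => f (T (Sum.inl (Sum.inr i)))) * c (fun i => f (T (Sum.inr i))))]
  apply mul_left_cancel₀ hfac
  have h1 := wedge_apply (wedge a b) c (v ∘ q)
  have h2 : (v ∘ (finSumFinEquiv.symm.trans q)) = (v ∘ q) ∘ finSumFinEquiv.symm := rfl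
  rw [h2]
  have h3 : ∀ σ : Equiv.Perm (Fin (m + m') ⊕ Fin n),
      ((m.factorial : ℝ) * m'.factorial) * (((Equiv.Perm.sign σ : ℤ) : ℝ) *
        (wedge a b (fun i => (v ∘ q) (σ (Sum.inl i))) * c (fun i => (v ∘ q) (σ (Sum.inr i))))) =
      ∑ π : Equiv.Perm (Fin m ⊕ Fin m'),
        (fun ρ : Equiv.Perm ((Fin m ⊕ Fin m') ⊕ Fin n) => ((Equiv.Perm.sign ρ : ℤ) : ℝ) *
          (a (fun i => v (ρ (Sum.inl (Sum.inl i)))) * b (fun i => v (ρ (Sum.inl (Sum.inr i)))) *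
            c (fun i => v (ρ (Sum.inr i)))))
          (q.permCongr σ * Equiv.sumCongr π (Equiv.refl _)) := by
    intro σ
    have h4 := wedge_apply a b (fun i => (v ∘ q) (σ (Sum.inl (finSumFinEquiv i))))
    have h5 : ((fun i => (v ∘ q) (σ (Sum.inl (finSumFinEquiv i)))) ∘ finSumFinEquiv.symm) =
        fun i => (v ∘ q) (σ (Sum.inl i)) := by
      ext i; simp
    rw [h5] at h4
    rw [show ((m.factorial : ℝ) * m'.factorial) * (((Equiv.Perm.sign σ : ℤ) : ℝ) *
        (wedge a b (fun i => (v ∘ q) (σ (Sum.inl i))) * c (fun i => (v ∘ q) (σ (Sum.inr i))))) =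
        (((m.factorial : ℝ) * m'.factorial) * wedge a b (fun i => (v ∘ q) (σ (Sum.inl i)))) *
        (((Equiv.Perm.sign σ : ℤ) : ℝ) * c (fun i => (v ∘ q) (σ (Sum.inr i)))) by ring, h4,
      Finset.sum_mul]
    refine Finset.sum_congr rfl fun π _ => ?_
    have hs : Equiv.Perm.sign (q.permCongr σ * Equiv.sumCongr π (Equiv.refl (Fin n))) =
        Equiv.Perm.sign σ * Equiv.Perm.sign π := by
      rw [Equiv.Perm.sign_mul, Equiv.Perm.sign_permCongr]
      congr 1
      simp
    simp only [hs]
    simp [hq, Equiv.permCongr_apply]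
    ring
  calc _ = ((m.factorial : ℝ) * m'.factorial) * ((((m + m').factorial : ℕ) : ℝ) * n.factorial *
        wedge (wedge a b) c ((v ∘ q) ∘ finSumFinEquiv.symm)) := by ring
    _ = _ := by
      rw [h1, Finset.mul_sum]
      simp_rw [h3]
      rw [Finset.sum_comm]
      have h6 : ∀ π : Equiv.Perm (Fin m ⊕ Fin m'), ∀ g : Equiv.Perm ((Fin m ⊕ Fin m') ⊕ Fin n) → ℝ,
          ∑ σ, g (q.permCongr σ * Equiv.sumCongr π (Equiv.refl (Fin n))) = ∑ ρ, g ρ := by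
        intro π g
        exact Equiv.sum_comp (q.permCongr.trans
          (Equiv.mulRight (Equiv.sumCongr π (Equiv.refl (Fin n)) : Equiv.Perm _))) g
      simp_rw [fun π => h6 π (fun ρ => ((Equiv.Perm.sign ρ : ℤ) : ℝ) *
          (a (fun i => v (ρ (Sum.inl (Sum.inl i)))) * b (fun i => v (ρ (Sum.inl (Sum.inr i)))) *
            c (fun i => v (ρ (Sum.inr i)))))]
      rw [Finset.sum_const, nsmul_eq_mul, Finset.card_univ, Fintype.card_perm]
      simp [hv]

/-! ### Star coordinates of a form, and the helicity density -/

section Star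

variable {k : ℕ}

/-- The `i`-th vector of the standard basis. -/
abbrev stdVec (i : Fin (2 * k + 1)) : Eucl k := EuclideanSpace.single i (1 : ℝ)

/-- The Euclidean volume form. -/
def volForm (k : ℕ) : (Eucl k) [⋀^Fin (2 * k + 1)]→ₗ[ℝ] ℝ :=
  (EuclideanSpace.basisFun (Fin (2 * k + 1)) ℝ).toBasis.det

/-- The splitting of `2k+1` slots into `k` and `k+1` slots. -/
def splitStar (k : ℕ) : Fin k ⊕ Fin (k + 1) ≃ Fin (2 * k + 1) :=
  finSumFinEquiv.trans (finCongr (by omega))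

/-- The splitting of `2k` slots into `k` and `k` slots. -/
def splitPair (k : ℕ) : Fin k ⊕ Fin k ≃ Fin (2 * k) :=
  finSumFinEquiv.trans (finCongr (by omega))

/-- The coordinates of the Hodge star of a `(k+1)`-form `a`, a `k`-vector, up to the factor
`(k+1)!`: the sum of `det (e_I, e_A) a(e_A)` over all tuples `A`. -/
def starCoord (a : (Eucl k) [⋀^Fin (k + 1)]→ₗ[ℝ] ℝ) (I : Fin k → Fin (2 * k + 1)) : ℝ :=
  ∑ A : Fin (k + 1) → Fin (2 * k + 1),
    volForm k (fun j => stdVec (Sum.elim I A ((splitStar k).symm j))) * a (fun j => stdVec (A j))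

/-- The tuple `(K, a_1, ..., a_k, b_1, ..., b_k)`. -/
def tripleVec (K : Eucl k) (a b : Fin k → Eucl k) : Fin (2 * k + 1) → Eucl k :=
  Fin.cons K (fun j => Sum.elim a b ((splitPair k).symm j))

/-- The determinant of `(K, a_1, ..., a_k, b_1, ..., b_k)`. -/
def triple (K : Eucl k) (a b : Fin k → Eucl k) : ℝ := volForm k (tripleVec K a b)

theorem volForm_apply (v : Fin (2 * k + 1) → Eucl k) :
    volForm k v = Matrix.det (Matrix.of fun i j => v i j) := by
  unfold volForm
  rw [Module.Basis.det_apply, ← Matrix.det_transpose]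
  congr 1

end Star

/-! ### Frames of the product, and the slots of the helicity form -/

/-- The standard basis of `ℝ^n × ℝ^n`, the second index telling the factor. -/
def pairVec (k : ℕ) (p : Fin (2 * k + 1) × Bool) : Eucl k × Eucl k :=
  if p.2 then (0, stdVec p.1) else (stdVec p.1, 0)

/-- The slots of a product of a `(k+1)`-form, a `(k+1)`-form and a `2k`-form. -/
abbrev Slots (k : ℕ) : Type := (Fin (k + 1) ⊕ Fin (k + 1)) ⊕ Fin (2 * k)

/-- The assignment of slots to factors of `ℝ^n × ℝ^n` for which the first `(k+1)`-form gets
vectors of the first factor, the second one vectors of the second factor, and the `2k`-form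
`k` vectors of each. -/
def slotType (k : ℕ) : Slots k → Bool :=
  Sum.elim (Sum.elim (fun _ => false) (fun _ => true))
    (fun i => Sum.elim (fun _ => false) (fun _ => true) ((splitPair k).symm i))

/-- The slots of each factor, as an enumeration by `k + (k+1)` indices. -/
def slotEquiv (k : ℕ) : Slots k ≃ Fin (2 * k + 1) × Bool where
  toFun := Sum.elim
    (Sum.elim (fun a => (splitStar k (Sum.inr a), false))
      (fun a => (splitStar k (Sum.inr a), true)))
    (fun i => Sum.elim (fun j => (splitStar k (Sum.inl j), false))
      (fun j => (splitStar k (Sum.inl j), true)) ((splitPair k).symm i))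
  invFun p := Sum.elim
    (fun j => Sum.inr (splitPair k (if p.2 then Sum.inr j else Sum.inl j)))
    (fun a => Sum.inl (if p.2 then Sum.inr a else Sum.inl a)) ((splitStar k).symm p.1)
  left_inv := by
    rintro ((a | a) | i)
    · simp
    · simp
    · obtain ⟨j, rfl⟩ := (splitPair k).surjective i
      rcases j with j | j <;> simp
  right_inv := by
    rintro ⟨i, c⟩
    obtain ⟨j, rfl⟩ := (splitStar k).surjective i
    rcases j with j | j <;> cases c <;> simp

theorem slotEquiv_snd (s : Slots k) : (slotEquiv k s).2 = slotType k s := by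
  rcases s with (a | a) | i
  · rfl
  · rfl
  · obtain ⟨j, rfl⟩ := (splitPair k).surjective i
    rcases j with j | j <;> simp [slotEquiv, slotType]

/-- The sign of an assignment that respects the types of the slots is the product of the signs in
the two factors of `ℝ^n × ℝ^n`. -/
theorem permSign_slotEquiv (Z : Slots k → Fin (2 * k + 1)) :
    permSign (slotEquiv k) (fun s => (Z s, slotType k s)) =
      ∏ c : Bool, volForm k (fun i => stdVec (Z ((slotEquiv k).symm (i, c)))) := by
  unfold permSign
  rw [← Matrix.det_submatrix_equiv_self (slotEquiv k).symm]
  have : (Matrix.of fun i j => if (Z i, slotType k i) = slotEquiv k j then (1 : ℝ) else 0).submatrix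
      (slotEquiv k).symm (slotEquiv k).symm = Matrix.blockDiagonal (fun c : Bool =>
        (Matrix.of fun i j => (stdVec (Z ((slotEquiv k).symm (i, c))) : Eucl k) j)) := by
    ext ⟨i, c⟩ ⟨j, d⟩
    have h := slotEquiv_snd ((slotEquiv k).symm (i, c))
    rw [Equiv.apply_symm_apply] at h
    simp only [Matrix.submatrix_apply, Matrix.of_apply, Matrix.blockDiagonal_apply, ← h,
      Equiv.apply_symm_apply, Prod.mk.injEq]
    by_cases hc : c = d <;> simp [hc, eq_comm]
  rw [this, Matrix.det_blockDiagonal]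
  simp_rw [volForm_apply]

/-- `permSign_slotEquiv` for an assignment given by its parts: `A`, `I` are the basis vectors in the
first factor and `B`, `J` those in the second one. -/
theorem permSign_slotEquiv_eq (A B : Fin (k + 1) → Fin (2 * k + 1))
    (I J : Fin k → Fin (2 * k + 1)) :
    permSign (slotEquiv k) (fun s => (Sum.elim (Sum.elim A B)
      (fun i => Sum.elim I J ((splitPair k).symm i)) s, slotType k s)) =
      volForm k (fun j => stdVec (Sum.elim I A ((splitStar k).symm j))) *
      volForm k (fun j => stdVec (Sum.elim J B ((splitStar k).symm j))) := by
  rw [permSign_slotEquiv, Fintype.prod_bool, mul_comm]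
  congr 2
  · ext1 i
    obtain ⟨j, rfl⟩ := (splitStar k).surjective i
    rcases j with j | j <;> simp [slotEquiv]
  · ext1 i
    obtain ⟨j, rfl⟩ := (splitStar k).surjective i
    rcases j with j | j <;> simp [slotEquiv]

/-- The value of `a ⊗ b ⊗ c`, where `a` is pulled back from the first factor, `b` from the second,
and `c` under the difference map, on a tuple of basis vectors of `ℝ^n × ℝ^n`. -/
def slotTerm (a b : (Eucl k) [⋀^Fin (k + 1)]→ₗ[ℝ] ℝ) (c : (Eucl k) [⋀^Fin (2 * k)]→ₗ[ℝ] ℝ)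
    (T : Slots k → Fin (2 * k + 1) × Bool) : ℝ :=
  a (fun i => (pairVec k (T (Sum.inl (Sum.inl i)))).1) *
    b (fun i => (pairVec k (T (Sum.inl (Sum.inr i)))).2) *
    c (fun i => (pairVec k (T (Sum.inr i))).2 - (pairVec k (T (Sum.inr i))).1)

theorem slotTerm_slotType (a b : (Eucl k) [⋀^Fin (k + 1)]→ₗ[ℝ] ℝ)
    (c : (Eucl k) [⋀^Fin (2 * k)]→ₗ[ℝ] ℝ) (A B : Fin (k + 1) → Fin (2 * k + 1))
    (I J : Fin k → Fin (2 * k + 1)) :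
    slotTerm a b c (fun s => (Sum.elim (Sum.elim A B)
      (fun i => Sum.elim I J ((splitPair k).symm i)) s, slotType k s)) =
      (-1) ^ k * (a (fun i => stdVec (A i)) * b (fun i => stdVec (B i)) *
      c (fun i => Sum.elim (fun j => stdVec (I j)) (fun j => stdVec (J j))
        ((splitPair k).symm i))) := by
  have h : (fun i => (pairVec k (Sum.elim I J ((splitPair k).symm i), slotType k (Sum.inr i))).2 -
      (pairVec k (Sum.elim I J ((splitPair k).symm i), slotType k (Sum.inr i))).1) =
      fun i => (Sum.elim (fun _ => (-1 : ℝ)) (fun _ => 1) ((splitPair k).symm i)) •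
        (Sum.elim (fun j => stdVec (I j)) (fun j => stdVec (J j)) ((splitPair k).symm i) :
          Eucl k) := by
    ext1 i
    obtain ⟨j, rfl⟩ := (splitPair k).surjective i
    rcases j with j | j <;> simp [slotType, pairVec]
  have hc := c.toMultilinearMap.map_smul_univ
    (fun i => (Sum.elim (fun _ => (-1 : ℝ)) (fun _ => 1) ((splitPair k).symm i)))
    (fun i => (Sum.elim (fun j => stdVec (I j)) (fun j => stdVec (J j)) ((splitPair k).symm i) :
          Eucl k))
  rw [(splitPair k).symm.prod_comp (Sum.elim (fun _ => (-1 : ℝ)) (fun _ => 1))] at hc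
  simp only [Fintype.prod_sum_type, Sum.elim_inl, Sum.elim_inr, Finset.prod_const,
    Finset.card_univ, Fintype.card_fin, one_pow, mul_one, smul_eq_mul,
    AlternatingMap.coe_multilinearMap] at hc
  unfold slotTerm
  simp only [Sum.elim_inr, Sum.elim_inl]
  rw [h, hc]
  simp only [slotType, pairVec, Sum.elim_inl, Sum.elim_inr]
  simp
  ring

/-- A tuple of basis vectors whose distribution over the two factors is not that of `slotType`, up
to a permutation of the slots of the `2k`-form, does not contribute. -/
theorem slotType_of_ne_zero (a b : (Eucl k) [⋀^Fin (k + 1)]→ₗ[ℝ] ℝ)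
    (c : (Eucl k) [⋀^Fin (2 * k)]→ₗ[ℝ] ℝ) (e : Slots k ≃ Fin (2 * k + 1) × Bool)
    (T : Slots k → Fin (2 * k + 1) × Bool) (h : permSign e T * slotTerm a b c T ≠ 0) :
    ∃ ρ : Equiv.Perm (Fin (2 * k)),
      (fun s => (T s).2) = slotType k ∘ Equiv.sumCongr (Equiv.refl _) ρ := by
  have hT := injective_of_permSign_ne_zero (left_ne_zero_of_mul h)
  have hT' : Function.Bijective T :=
    (Fintype.bijective_iff_injective_and_card T).2 ⟨hT, Fintype.card_congr e⟩
  have hs := right_ne_zero_of_mul h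
  unfold slotTerm at hs
  have hA : ∀ i, (T (Sum.inl (Sum.inl i))).2 = false := by
    intro i
    by_contra hi
    refine hs ?_
    rw [a.map_coord_zero i (by simp [pairVec, hi])]
    simp
  have hB : ∀ i, (T (Sum.inl (Sum.inr i))).2 = true := by
    intro i
    by_contra hi
    refine hs ?_
    rw [b.map_coord_zero i (by simp [pairVec, hi])]
    simp
  -- Both assignments of slots to factors have fibres of `2k+1` elements, and they agree on the
  -- slots of the two `(k+1)`-forms.
  have hcard : ∀ d : Bool, Fintype.card {i : Fin (2 * k) // (T (Sum.inr i)).2 = d} =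
      Fintype.card {i : Fin (2 * k) // slotType k (Sum.inr i) = d} := by
    intro d
    have h1 : Fintype.card {s : Slots k // (T s).2 = d} =
        Fintype.card {s : Slots k // slotType k s = d} := by
      have e1 : {s : Slots k // (T s).2 = d} ≃ {p : Fin (2 * k + 1) × Bool // p.2 = d} :=
        (Equiv.ofBijective T hT').subtypeEquiv (fun s => by simp)
      have e2 : {s : Slots k // slotType k s = d} ≃ {p : Fin (2 * k + 1) × Bool // p.2 = d} :=
        (slotEquiv k).subtypeEquiv (fun s => by rw [slotEquiv_snd])
      exact Fintype.card_congr (e1.trans e2.symm)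
    have h2 : ∀ χ : Slots k → Bool, Fintype.card {s : Slots k // χ s = d} =
        Fintype.card {s : Fin (k + 1) ⊕ Fin (k + 1) // χ (Sum.inl s) = d} +
        Fintype.card {i : Fin (2 * k) // χ (Sum.inr i) = d} := by
      intro χ
      rw [← Fintype.card_sum]
      exact Fintype.card_congr (Equiv.subtypeSum (p := fun s => χ s = d))
    rw [h2, h2] at h1
    have h3 : Fintype.card {s : Fin (k + 1) ⊕ Fin (k + 1) // (T (Sum.inl s)).2 = d} =
        Fintype.card {s : Fin (k + 1) ⊕ Fin (k + 1) // slotType k (Sum.inl s) = d} := by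
      refine Fintype.card_congr (Equiv.subtypeEquivRight ?_)
      rintro (i | i)
      · rw [hA]; rfl
      · rw [hB]; rfl
    omega
  let ρ : Equiv.Perm (Fin (2 * k)) := Equiv.ofFiberEquiv
    (f := fun i => (T (Sum.inr i)).2) (g := fun i => slotType k (Sum.inr i))
    (fun d => Fintype.equivOfCardEq (hcard d))
  refine ⟨ρ, ?_⟩
  ext1 s
  rcases s with (i | i) | i
  · rw [hA]; rfl
  · rw [hB]; rfl
  · exact (Equiv.ofFiberEquiv_map (f := fun i => (T (Sum.inr i)).2)
      (g := fun i => slotType k (Sum.inr i)) _ i).symm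

theorem slotTerm_comp_perm (a b : (Eucl k) [⋀^Fin (k + 1)]→ₗ[ℝ] ℝ)
    (c : (Eucl k) [⋀^Fin (2 * k)]→ₗ[ℝ] ℝ) (e : Slots k ≃ Fin (2 * k + 1) × Bool)
    (T : Slots k → Fin (2 * k + 1) × Bool) (ρ : Equiv.Perm (Fin (2 * k))) :
    permSign e (T ∘ Equiv.sumCongr (Equiv.refl _) ρ) *
      slotTerm a b c (T ∘ Equiv.sumCongr (Equiv.refl _) ρ) = permSign e T * slotTerm a b c T := by
  have h1 := permSign_comp_perm e T (Equiv.sumCongr (Equiv.refl _) ρ)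
  have h2 := c.map_perm (fun i => (pairVec k (T (Sum.inr i))).2 - (pairVec k (T (Sum.inr i))).1) ρ
  rw [h1]
  unfold slotTerm
  simp only [Function.comp_apply, Equiv.sumCongr_apply, Sum.map_inl, Sum.map_inr,
    Equiv.refl_apply]
  rw [show (fun i => (pairVec k (T (Sum.inr (ρ i)))).2 - (pairVec k (T (Sum.inr (ρ i)))).1) =
    (fun i => (pairVec k (T (Sum.inr i))).2 - (pairVec k (T (Sum.inr i))).1) ∘ ρ from rfl, h2]
  have hs : Equiv.Perm.sign (Equiv.sumCongr (Equiv.refl (Fin (k + 1) ⊕ Fin (k + 1))) ρ) =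
      Equiv.Perm.sign ρ := by
    simp
  rw [hs, Units.smul_def, zsmul_eq_mul]
  have hq : (((Equiv.Perm.sign ρ : ℤˣ) : ℤ) : ℝ) * (((Equiv.Perm.sign ρ : ℤˣ) : ℤ) : ℝ) = 1 := by
    rcases Int.units_eq_one_or (Equiv.Perm.sign ρ) with h | h <;> simp [h]
  linear_combination (permSign e T * (a fun i => (pairVec k (T (Sum.inl (Sum.inl i)))).1) *
    (b fun i => (pairVec k (T (Sum.inl (Sum.inr i)))).2) *
    (c fun i => (pairVec k (T (Sum.inr i))).2 - (pairVec k (T (Sum.inr i))).1)) * hq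

/-- The contribution of one distribution of the basis vectors over the slots. Summing over the
arguments of `a` and `b` produces their star coordinates. -/
theorem sum_permSign_mul_slotTerm (a b : (Eucl k) [⋀^Fin (k + 1)]→ₗ[ℝ] ℝ)
    (c : (Eucl k) [⋀^Fin (2 * k)]→ₗ[ℝ] ℝ) :
    ∑ Z : Slots k → Fin (2 * k + 1),
      permSign (slotEquiv k) (fun s => (Z s, slotType k s)) *
        slotTerm a b c (fun s => (Z s, slotType k s)) =
      (-1) ^ k * ∑ I : Fin k → Fin (2 * k + 1), ∑ J : Fin k → Fin (2 * k + 1),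
        starCoord a I * starCoord b J * c (fun i => Sum.elim (fun j => stdVec (I j))
          (fun j => stdVec (J j)) ((splitPair k).symm i)) := by
  let Ψ : ((Fin k → Fin (2 * k + 1)) × (Fin k → Fin (2 * k + 1))) ×
      ((Fin (k + 1) → Fin (2 * k + 1)) × (Fin (k + 1) → Fin (2 * k + 1))) ≃
      (Slots k → Fin (2 * k + 1)) :=
    (Equiv.prodComm _ _).trans
      ((Equiv.prodCongr (Equiv.sumArrowEquivProdArrow _ _ _).symm
        ((Equiv.sumArrowEquivProdArrow _ _ _).symm.trans
          (Equiv.arrowCongr (splitPair k) (Equiv.refl _)))).trans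
        (Equiv.sumArrowEquivProdArrow _ _ _).symm)
  have hΨ : ∀ I J A B, Ψ ((I, J), (A, B)) = Sum.elim (Sum.elim A B)
      (fun i => Sum.elim I J ((splitPair k).symm i)) := by
    intro I J A B
    ext1 s
    rcases s with (s | s) | s <;> simp [Ψ]; rfl
  rw [← Equiv.sum_comp Ψ]
  simp_rw [Fintype.sum_prod_type, hΨ, permSign_slotEquiv_eq, slotTerm_slotType, starCoord]
  simp_rw [Finset.sum_mul_sum, Finset.sum_mul, Finset.mul_sum]
  refine Finset.sum_congr rfl fun I _ => Finset.sum_congr rfl fun J _ =>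
    Finset.sum_congr rfl fun A _ => Finset.sum_congr rfl fun B _ => ?_
  ring

/-- The product of a form pulled back from the first factor, one pulled back from the second, and
one pulled back under the difference map, in terms of star coordinates. The constant, which depends
only on `k`, is immaterial. -/
theorem exists_wedge_wedge_stdFrame (k : ℕ) : ∃ C : ℝ,
    ∀ (a b : (Eucl k) [⋀^Fin (k + 1)]→ₗ[ℝ] ℝ) (c : (Eucl k) [⋀^Fin (2 * k)]→ₗ[ℝ] ℝ),
      wedge (wedge (a.compLinearMap (LinearMap.fst ℝ (Eucl k) (Eucl k)))
          (b.compLinearMap (LinearMap.snd ℝ (Eucl k) (Eucl k))))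
        (c.compLinearMap (LinearMap.snd ℝ (Eucl k) (Eucl k) - LinearMap.fst ℝ (Eucl k) (Eucl k)))
        (stdFrame k) =
      C * ∑ I : Fin k → Fin (2 * k + 1), ∑ J : Fin k → Fin (2 * k + 1),
        starCoord a I * starCoord b J * c (fun i => Sum.elim (fun j => stdVec (I j))
          (fun j => stdVec (J j)) ((splitPair k).symm i)) := by
  classical
  set q : Fin ((k + 1) + (k + 1) + 2 * k) ≃ Slots k := finSumFinEquiv.symm.trans
    (Equiv.sumCongr finSumFinEquiv.symm (Equiv.refl (Fin (2 * k)))) with hq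
  let d : Fin ((k + 1) + (k + 1) + 2 * k) ≃ Fin (2 * k + 1) × Bool :=
    ((finCongr (by omega : (k + 1) + (k + 1) + 2 * k = (2 * k + 1) + (2 * k + 1))).trans
      finSumFinEquiv.symm).trans ((Equiv.boolProdEquivSum _).symm.trans (Equiv.prodComm _ _))
  have hd : stdFrame k = pairVec k ∘ d := by
    ext1 i
    obtain ⟨j, rfl⟩ := (finCongr (by omega :
      (k + 1) + (k + 1) + 2 * k = (2 * k + 1) + (2 * k + 1))).symm.surjective i
    obtain ⟨l, rfl⟩ := finSumFinEquiv.surjective j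
    rcases l with l | l <;> simp [stdFrame, d, pairVec, -Fin.natAdd_eq_addNat]
  let e : Slots k ≃ Fin (2 * k + 1) × Bool := q.symm.trans d
  have he : stdFrame k = (pairVec k ∘ e) ∘ q := by
    rw [hd]; ext1 i; simp [e]
  let ρ : Equiv.Perm (Slots k) := e.trans (slotEquiv k).symm
  have hρ : e = ρ.trans (slotEquiv k) := by ext1 i; simp [ρ]
  set N : ℝ := (((k + 1).factorial : ℝ) * (k + 1).factorial * (2 * k).factorial) with hN
  have hN0 : N ≠ 0 := by positivity
  let S : Finset (Slots k → Bool) := Finset.univ.filter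
    (fun χ => ∃ π : Equiv.Perm (Fin (2 * k)), χ = slotType k ∘ Equiv.sumCongr (Equiv.refl _) π)
  refine ⟨N⁻¹ * (((Equiv.Perm.sign ρ : ℤˣ) : ℤ) : ℝ) * S.card * (-1) ^ k, fun a b c => ?_⟩
  have h1 := wedge_wedge_apply (a.compLinearMap (LinearMap.fst ℝ (Eucl k) (Eucl k)))
    (b.compLinearMap (LinearMap.snd ℝ (Eucl k) (Eucl k)))
    (c.compLinearMap (LinearMap.snd ℝ (Eucl k) (Eucl k) - LinearMap.fst ℝ (Eucl k) (Eucl k)))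
    (pairVec k) e
  rw [← hN, ← hq, ← he] at h1
  have h2 : ∀ T : Slots k → Fin (2 * k + 1) × Bool, permSign e T *
        (a.compLinearMap (LinearMap.fst ℝ (Eucl k) (Eucl k))
          (fun i => pairVec k (T (Sum.inl (Sum.inl i)))) *
        b.compLinearMap (LinearMap.snd ℝ (Eucl k) (Eucl k))
          (fun i => pairVec k (T (Sum.inl (Sum.inr i)))) *
        c.compLinearMap (LinearMap.snd ℝ (Eucl k) (Eucl k) - LinearMap.fst ℝ (Eucl k) (Eucl k))
          (fun i => pairVec k (T (Sum.inr i)))) =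
      (((Equiv.Perm.sign ρ : ℤˣ) : ℤ) : ℝ) * (permSign (slotEquiv k) T * slotTerm a b c T) := by
    intro T
    rw [hρ, permSign_perm_trans, mul_assoc]
    rfl
  simp_rw [h2, ← Finset.mul_sum] at h1
  let P : (Slots k → Bool) → ℝ := fun χ => ∑ Z : Slots k → Fin (2 * k + 1),
      permSign (slotEquiv k) (fun s => (Z s, χ s)) * slotTerm a b c (fun s => (Z s, χ s))
  have h3 : ∑ T : Slots k → Fin (2 * k + 1) × Bool,
      permSign (slotEquiv k) T * slotTerm a b c T = ∑ χ, P χ := by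
    rw [← Equiv.sum_comp (Equiv.arrowProdEquivProdArrow (Slots k) (fun _ => Fin (2 * k + 1))
      (fun _ => Bool)).symm, Fintype.sum_prod_type, Finset.sum_comm]
    rfl
  have h4 : ∀ χ, P χ = if χ ∈ S then P (slotType k) else 0 := by
    intro χ
    split_ifs with hχ
    · obtain ⟨π, rfl⟩ := (Finset.mem_filter.1 hχ).2
      change ∑ Z, _ = ∑ Z, _
      rw [← Equiv.sum_comp (Equiv.arrowCongr
        (Equiv.sumCongr (Equiv.refl (Fin (k + 1) ⊕ Fin (k + 1))) π).symm
        (Equiv.refl (Fin (2 * k + 1))))]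
      refine Finset.sum_congr rfl fun Z _ => ?_
      exact slotTerm_comp_perm a b c (slotEquiv k) (fun s => (Z s, slotType k s)) π
    · refine Finset.sum_eq_zero fun Z _ => ?_
      by_contra hne
      obtain ⟨π, hπ⟩ := slotType_of_ne_zero a b c (slotEquiv k) _ hne
      exact hχ (Finset.mem_filter.2 ⟨Finset.mem_univ _, π, hπ⟩)
  have h5 : P (slotType k) = _ := sum_permSign_mul_slotTerm a b c
  rw [h3, Finset.sum_congr rfl (fun χ _ => h4 χ), Finset.sum_ite_mem, Finset.univ_inter,
    Finset.sum_const, nsmul_eq_mul, h5] at h1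
  apply mul_left_cancel₀ hN0
  simp only [h1, mul_assoc]
  rw [mul_inv_cancel_left₀ hN0]

/-- The kernel `z / ‖z‖ ^ n` of the helicity, `n = 2k+1`: the radial field with divergence zero away
from the origin. -/
def kernel (k : ℕ) (z : Eucl k) : Eucl k := (‖z‖ ^ (2 * k + 1))⁻¹ • z

/-- The pullback of the volume form of the sphere under the Gauss map depends on `y - x` only. The
radial part of the derivative of the Gauss map drops out, since the radial vector already stands
in the determinant. -/
theorem gaussForm_eq {x y : Eucl k} (h : x ≠ y) :
    gaussForm (x, y) = ((sphereArea k)⁻¹ • (volForm k).curryLeft (kernel k (y - x))).compLinearMap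
      (LinearMap.snd ℝ (Eucl k) (Eucl k) - LinearMap.fst ℝ (Eucl k) (Eucl k)) := by
  have hw : y - x ≠ 0 := sub_ne_zero.2 h.symm
  have hn : ‖y - x‖ ≠ 0 := norm_ne_zero_iff.2 hw
  -- The derivative of the Gauss map is a multiple of the difference, up to the radial direction.
  obtain ⟨ℓ, hℓ⟩ : ∃ ℓ : Eucl k × Eucl k → ℝ, ∀ v, fderiv ℝ gaussMap (x, y) v =
      ‖y - x‖⁻¹ • (v.2 - v.1) + ℓ v • (y - x) := by
    have h1 : DifferentiableAt ℝ (fun z : Eucl k × Eucl k => ‖z.2 - z.1‖⁻¹) (x, y) := by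
      refine DifferentiableAt.inv ?_ hn
      exact (DifferentiableAt.norm ℝ (by fun_prop) hw)
    have h2 : HasFDerivAt (fun z : Eucl k × Eucl k => z.2 - z.1)
        (ContinuousLinearMap.snd ℝ _ _ - ContinuousLinearMap.fst ℝ _ _) (x, y) :=
      hasFDerivAt_snd.sub hasFDerivAt_fst
    refine ⟨fun v => fderiv ℝ (fun z : Eucl k × Eucl k => ‖z.2 - z.1‖⁻¹) (x, y) v, fun v => ?_⟩
    have h3 := (h1.hasFDerivAt.smul h2).fderiv
    change fderiv ℝ (fun z : Eucl k × Eucl k => ‖z.2 - z.1‖⁻¹ • (z.2 - z.1)) (x, y) v = _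
    rw [show (fun z : Eucl k × Eucl k => ‖z.2 - z.1‖⁻¹ • (z.2 - z.1)) =
      ((fun z : Eucl k × Eucl k => ‖z.2 - z.1‖⁻¹) • fun z : Eucl k × Eucl k => z.2 - z.1) from rfl,
      h3]
    simp
  ext v
  simp only [gaussForm, AlternatingMap.compLinearMap_apply, sphereForm, AlternatingMap.smul_apply,
    smul_eq_mul]
  congr 1
  change volForm k (Matrix.vecCons _ _) = volForm k (Matrix.vecCons _ _)
  rw [volForm_apply, volForm_apply]
  have hr : ‖y - x‖ ^ (2 * k + 1) ≠ 0 := pow_ne_zero _ hn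
  have key : ∀ B : Matrix (Fin (2 * k + 1)) (Fin (2 * k + 1)) ℝ,
      ((‖y - x‖⁻¹) ^ (2 * k + 1)) * B.det = Matrix.det (‖y - x‖⁻¹ • B) := by
    intro B
    rw [Matrix.det_smul, Fintype.card_fin]
  set B : Matrix (Fin (2 * k + 1)) (Fin (2 * k + 1)) ℝ := Matrix.of fun i j =>
    (Matrix.vecCons (y - x) (fun i => (v i).2 - (v i).1) : Fin (2 * k + 1) → Eucl k) i j with hB
  trans ((‖y - x‖⁻¹) ^ (2 * k + 1)) * B.det
  · rw [key]
    refine Matrix.det_eq_of_forall_row_eq_smul_add_const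
      (Fin.cons 0 (fun i => ‖y - x‖ * ℓ (v i))) 0 (by simp) ?_
    intro i j
    refine Fin.cases ?_ (fun i => ?_) i
    · simp [hB, gaussMap]
    · simp [hB, gaussMap, hℓ]
      field_simp
  · rw [inv_pow]
    have := Matrix.det_updateRow_smul B 0 ((‖y - x‖ ^ (2 * k + 1))⁻¹) (y - x).ofLp
    rw [show B.updateRow 0 (y - x).ofLp = B by
      ext i j
      refine Fin.cases ?_ (fun i => ?_) i
      · simp [hB]
      · simp [Matrix.updateRow_apply]] at this
    rw [← this]
    congr 1
    ext i j
    refine Fin.cases ?_ (fun i => ?_) i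
    · simp [kernel, Matrix.updateRow_apply]
    · simp [hB, Matrix.updateRow_apply]

/-- The helicity density at a pair of distinct points, in terms of star coordinates. -/
theorem exists_helicityDensity_eq (k : ℕ) : ∃ C : ℝ, ∀ (α : Form k (k + 1)) (x y : Eucl k), x ≠ y →
    helicityDensity α (x, y) = C * ∑ I : Fin k → Fin (2 * k + 1), ∑ J : Fin k → Fin (2 * k + 1),
      starCoord (α x).toAlternatingMap I * starCoord (α y).toAlternatingMap J *
        triple (kernel k (y - x)) (fun j => stdVec (I j)) (fun j => stdVec (J j)) := by
  obtain ⟨C, hC⟩ := exists_wedge_wedge_stdFrame k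
  refine ⟨C * (sphereArea k)⁻¹, fun α x y h => ?_⟩
  unfold helicityDensity helicityForm
  rw [gaussForm_eq h, hC, mul_assoc, Finset.mul_sum (a := (sphereArea k)⁻¹)]
  simp_rw [Finset.mul_sum (a := (sphereArea k)⁻¹)]
  congr 1
  refine Finset.sum_congr rfl fun I _ => Finset.sum_congr rfl fun J _ => ?_
  rw [AlternatingMap.smul_apply, smul_eq_mul]
  rw [show ((volForm k).curryLeft (kernel k (y - x))) (fun i => Sum.elim (fun j => stdVec (I j))
          (fun j => stdVec (J j)) ((splitPair k).symm i)) =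
    triple (kernel k (y - x)) (fun j => stdVec (I j)) (fun j => stdVec (J j)) from rfl]
  ring

/-! ### Star coordinates under linear maps; closed and Dirichlet forms -/

theorem sum_coord_smul_stdVec (v : Eucl k) : ∑ i, v i • (stdVec i : Eucl k) = v := by
  have := (EuclideanSpace.basisFun (Fin (2 * k + 1)) ℝ).sum_repr v
  simpa using this

/-- The volume form on tuples indexed by `k + (k+1)` slots. -/
def starForm (k : ℕ) : (Eucl k) [⋀^Fin k ⊕ Fin (k + 1)]→ₗ[ℝ] ℝ :=
  (volForm k).domDomCongr (splitStar k).symm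

theorem starCoord_eq (a : (Eucl k) [⋀^Fin (k + 1)]→ₗ[ℝ] ℝ) (I : Fin k → Fin (2 * k + 1)) :
    starCoord a I = ∑ A : Fin (k + 1) → Fin (2 * k + 1),
      starForm k (fun s => stdVec (Sum.elim I A s)) * a (fun j => stdVec (A j)) := rfl

/-- In a sum over all tuples of basis vectors, linear maps in the arguments of one multilinear map
can be moved to the arguments of the other one as their transposes `L'`. -/
theorem sum_mul_comp_eq_sum_comp_mul {σ : Type*} [Fintype σ] [DecidableEq σ]
    (H F : MultilinearMap ℝ (fun _ : σ => Eucl k) ℝ) (L L' : σ → Eucl k →ₗ[ℝ] Eucl k)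
    (hL : ∀ s i j, L s (stdVec j) i = L' s (stdVec i) j) :
    ∑ T : σ → Fin (2 * k + 1), H (fun s => stdVec (T s)) * F (fun s => L s (stdVec (T s))) =
      ∑ T : σ → Fin (2 * k + 1), H (fun s => L' s (stdVec (T s))) * F (fun s => stdVec (T s)) := by
  have h1 : ∀ T : σ → Fin (2 * k + 1), F (fun s => L s (stdVec (T s))) =
      ∑ Q : σ → Fin (2 * k + 1), (∏ s, L s (stdVec (T s)) (Q s)) * F (fun s => stdVec (Q s)) := by
    intro T
    conv_lhs => rw [show (fun s => L s (stdVec (T s))) =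
      fun s => ∑ i, (L s (stdVec (T s)) i) • (stdVec i : Eucl k) from
        funext fun s => (sum_coord_smul_stdVec _).symm]
    rw [F.map_sum]
    exact Finset.sum_congr rfl fun Q _ => F.map_smul_univ _ _
  have h2 : ∀ Q : σ → Fin (2 * k + 1), H (fun s => L' s (stdVec (Q s))) =
      ∑ T : σ → Fin (2 * k + 1), (∏ s, L s (stdVec (T s)) (Q s)) * H (fun s => stdVec (T s)) := by
    intro Q
    conv_lhs => rw [show (fun s => L' s (stdVec (Q s))) =
      fun s => ∑ i, (L' s (stdVec (Q s)) i) • (stdVec i : Eucl k) from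
        funext fun s => (sum_coord_smul_stdVec _).symm]
    rw [H.map_sum]
    refine Finset.sum_congr rfl fun T _ => ?_
    rw [H.map_smul_univ]
    simp_rw [hL]
    rfl
  simp_rw [h1, h2, Finset.mul_sum, Finset.sum_mul]
  rw [Finset.sum_comm]
  refine Finset.sum_congr rfl fun Q _ => Finset.sum_congr rfl fun T _ => ?_
  ring

/-- The tensor product of two multilinear maps, in both groups of variables. -/
def tensorForm {σ σ' : Type*} (F : MultilinearMap ℝ (fun _ : σ => Eucl k) ℝ)
    (G : MultilinearMap ℝ (fun _ : σ' => Eucl k) ℝ) :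
    MultilinearMap ℝ (fun _ : σ ⊕ σ' => Eucl k) ℝ :=
  (LinearMap.mul' ℝ ℝ).compMultilinearMap (F.domCoprod G)

theorem tensorForm_apply {σ σ' : Type*} (F : MultilinearMap ℝ (fun _ : σ => Eucl k) ℝ)
    (G : MultilinearMap ℝ (fun _ : σ' => Eucl k) ℝ) (v : σ ⊕ σ' → Eucl k) :
    tensorForm F G v = F (fun s => v (Sum.inl s)) * G (fun s => v (Sum.inr s)) := by
  simp [tensorForm, MultilinearMap.domCoprod_apply]

theorem sum_starCoord_mul (a : (Eucl k) [⋀^Fin (k + 1)]→ₗ[ℝ] ℝ)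
    (f : (Fin k → Fin (2 * k + 1)) → ℝ) :
    ∑ I, starCoord a I * f I = ∑ T : Fin k ⊕ Fin (k + 1) → Fin (2 * k + 1),
      starForm k (fun s => stdVec (T s)) *
        (f (fun s => T (Sum.inl s)) * a (fun s => stdVec (T (Sum.inr s)))) := by
  rw [← Equiv.sum_comp (Equiv.sumArrowEquivProdArrow _ _ _).symm, Fintype.sum_prod_type]
  refine Finset.sum_congr rfl fun I _ => ?_
  rw [starCoord_eq, Finset.sum_mul]
  refine Finset.sum_congr rfl fun A _ => ?_
  simp only [Equiv.sumArrowEquivProdArrow]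
  change _ = starForm k (fun s => stdVec (Sum.elim I A s)) * (f I * a (fun s => stdVec (A s)))
  ring

theorem det_eq_det_of_transpose (L L' : Eucl k →ₗ[ℝ] Eucl k)
    (hL : ∀ i j, L (stdVec j) i = L' (stdVec i) j) : LinearMap.det L = LinearMap.det L' := by
  let b := (EuclideanSpace.basisFun (Fin (2 * k + 1)) ℝ).toBasis
  rw [← LinearMap.det_toMatrix b, ← LinearMap.det_toMatrix b, ← Matrix.det_transpose]
  congr 1
  ext i j
  simp [LinearMap.toMatrix_apply, b, hL]

theorem adjoint_stdVec (L : Eucl k →ₗ[ℝ] Eucl k) (i j : Fin (2 * k + 1)) :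
    L (stdVec j) i = LinearMap.adjoint L (stdVec i) j := by
  have h := LinearMap.adjoint_inner_left L (stdVec j) (stdVec i)
  rw [EuclideanSpace.inner_single_right, EuclideanSpace.inner_single_left] at h
  simpa using h.symm

theorem starForm_comp (L : Eucl k →ₗ[ℝ] Eucl k) (v : Fin k ⊕ Fin (k + 1) → Eucl k) :
    starForm k (fun s => L (v s)) = LinearMap.det L * starForm k v :=
  (EuclideanSpace.basisFun (Fin (2 * k + 1)) ℝ).toBasis.det_comp L _

/-- The star coordinates of a form transform under a change of coordinates `A` as those of a
`k`-vector with values in densities. -/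
theorem det_mul_sum_starCoord_comp (a : (Eucl k) [⋀^Fin (k + 1)]→ₗ[ℝ] ℝ)
    (A B : Eucl k →ₗ[ℝ] Eucl k) (hAB : A ∘ₗ B = LinearMap.id)
    (Ψ : MultilinearMap ℝ (fun _ : Fin k => Eucl k) ℝ) :
    LinearMap.det A * ∑ I, starCoord (a.compLinearMap B) I * Ψ (fun j => stdVec (I j)) =
      ∑ I, starCoord a I * Ψ (fun j => A (stdVec (I j))) := by
  have hdet : LinearMap.det A * LinearMap.det B = 1 := by
    rw [← LinearMap.det_comp, hAB, LinearMap.det_id]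
  set A' := LinearMap.adjoint A with hA'
  set B' := LinearMap.adjoint B with hB'
  have hBA : B' ∘ₗ A' = LinearMap.id := by
    rw [hA', hB', ← LinearMap.adjoint_comp, hAB, LinearMap.adjoint_id]
  have hdB : LinearMap.det B = LinearMap.det B' := det_eq_det_of_transpose _ _ (adjoint_stdVec B)
  let L : (X : Eucl k →ₗ[ℝ] Eucl k) → (Y : Eucl k →ₗ[ℝ] Eucl k) → Fin k ⊕ Fin (k + 1) →
    Eucl k →ₗ[ℝ] Eucl k := fun X Y => Sum.elim (fun _ => X) (fun _ => Y)
  have hid : ∀ i j : Fin (2 * k + 1), ((LinearMap.id : Eucl k →ₗ[ℝ] Eucl k) (stdVec j)) i =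
      ((LinearMap.id : Eucl k →ₗ[ℝ] Eucl k) (stdVec i)) j := by
    intro i j; simp [eq_comm]
  have h1 := sum_mul_comp_eq_sum_comp_mul (starForm k).toMultilinearMap
    (tensorForm Ψ a.toMultilinearMap) (L LinearMap.id B) (L LinearMap.id B') (by
      rintro (s | s) i j
      · exact hid i j
      · exact adjoint_stdVec B i j)
  have h2 := sum_mul_comp_eq_sum_comp_mul (starForm k).toMultilinearMap
    (tensorForm Ψ a.toMultilinearMap) (L A LinearMap.id) (L A' LinearMap.id) (by
      rintro (s | s) i j
      · exact adjoint_stdVec A i j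
      · exact hid i j)
  simp only [tensorForm_apply, AlternatingMap.coe_multilinearMap] at h1 h2
  rw [sum_starCoord_mul, sum_starCoord_mul]
  trans LinearMap.det A * (LinearMap.det B * ∑ T : Fin k ⊕ Fin (k + 1) → Fin (2 * k + 1),
    starForm k (fun s => L A' LinearMap.id s (stdVec (T s))) *
      (Ψ (fun s => stdVec (T (Sum.inl s))) * a (fun s => stdVec (T (Sum.inr s)))))
  · congr 1
    trans ∑ T : Fin k ⊕ Fin (k + 1) → Fin (2 * k + 1),
      starForm k (fun s => L LinearMap.id B' s (stdVec (T s))) *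
        (Ψ (fun s => stdVec (T (Sum.inl s))) * a (fun s => stdVec (T (Sum.inr s))))
    · exact h1
    · rw [Finset.mul_sum]
      refine Finset.sum_congr rfl fun T _ => ?_
      rw [← mul_assoc (LinearMap.det B), hdB, ← starForm_comp]
      congr 2
      ext1 s
      rcases s with s | s
      · exact (LinearMap.congr_fun hBA (stdVec (T (Sum.inl s)))).symm
      · rfl
  · rw [← mul_assoc, hdet, one_mul]
    exact h2.symm

theorem starCoord_comp_swap (a : (Eucl k) [⋀^Fin (k + 1)]→ₗ[ℝ] ℝ) (I : Fin k → Fin (2 * k + 1))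
    {p q : Fin k} (hpq : p ≠ q) : starCoord a (I ∘ Equiv.swap p q) = - starCoord a I := by
  rw [starCoord_eq, starCoord_eq, ← Finset.sum_neg_distrib]
  refine Finset.sum_congr rfl fun A _ => ?_
  have h := (starForm k).map_swap (fun s => stdVec (Sum.elim I A s))
    (i := Sum.inl p) (j := Sum.inl q) (by simpa using hpq)
  rw [show (fun s => (stdVec (Sum.elim I A s) : Eucl k)) ∘ Equiv.swap (Sum.inl p) (Sum.inl q) =
    fun s => stdVec (Sum.elim (I ∘ Equiv.swap p q) A s) by
      ext1 s
      rcases s with s | s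
      · simp only [Function.comp_apply, Sum.elim_inl, Equiv.swap_apply_def, Sum.inl.injEq]
        split_ifs <;> rfl
      · simp [Equiv.swap_apply_def]] at h
  rw [h]
  ring

/-- Closedness, in terms of star coordinates: if the exterior derivative formed with the derivative
`D` vanishes, then the `k`-vector is divergence free. -/
theorem sum_starCoord_update_eq_zero (D : Eucl k → (Eucl k) [⋀^Fin (k + 1)]→ₗ[ℝ] ℝ)
    (hD : ∀ v : Fin (k + 2) → Eucl k,
      ∑ p : Fin (k + 2), (-1 : ℝ) ^ (p : ℕ) * D (v p) (p.removeNth v) = 0)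
    (I : Fin k → Fin (2 * k + 1)) (m : Fin k) :
    ∑ i, starCoord (D (stdVec i)) (Function.update I m i) = 0 := by
  let j : Fin (k + 2) ↪ Fin k ⊕ Fin (k + 1) :=
    ⟨Fin.cons (Sum.inl m) (fun a => Sum.inr a), by
      rw [Fin.cons_injective_iff]
      exact ⟨by simp, Sum.inr_injective⟩⟩
  let h : (Fin (k + 2) → Fin (2 * k + 1)) → ℝ := fun w =>
    starForm k (fun s => stdVec (Sum.elim (Function.update I m (w 0)) (fun a => w a.succ) s))
  have hh : ∀ w (π : Equiv.Perm (Fin (k + 2))), h (w ∘ π) = (Equiv.Perm.sign π : ℤ) * h w := by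
    intro w π
    have := (starForm k).map_perm
      (fun s => stdVec (Sum.elim (Function.update I m (w 0)) (fun a => w a.succ) s))
      (π.viaFintypeEmbedding j)
    rw [Equiv.Perm.viaFintypeEmbedding_sign, Units.smul_def, zsmul_eq_mul] at this
    change _ = _ * starForm k _
    rw [← this]
    change starForm k _ = _
    congr 1
    have hj : ∀ w : Fin (k + 2) → Fin (2 * k + 1), ∀ q,
        Sum.elim (Function.update I m (w 0)) (fun a => w a.succ) (j q) = w q := by
      intro w q
      refine Fin.cases ?_ (fun a => ?_) q <;> simp [j]
    ext1 s
    by_cases hs : s ∈ Set.range j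
    · obtain ⟨q, rfl⟩ := hs
      have h1 := hj (w ∘ π) q
      simp only [Function.comp_apply] at h1 ⊢
      rw [h1, Equiv.Perm.viaFintypeEmbedding_apply_image, hj]
    · have h1 := Equiv.Perm.viaFintypeEmbedding_apply_notMem_range π j hs
      simp only [Function.comp_apply]
      rw [h1]
      rcases s with s | s
      · have : s ≠ m := by
          rintro rfl
          exact hs ⟨0, rfl⟩
        simp [this]
      · exact absurd ⟨s.succ, rfl⟩ hs
  let g : (Fin (k + 2) → Fin (2 * k + 1)) → ℝ := fun w =>
    h w * D (stdVec (w 0)) (fun a => stdVec (w a.succ))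
  have hg : ∑ i, starCoord (D (stdVec i)) (Function.update I m i) = ∑ w, g w := by
    rw [← Equiv.sum_comp (Fin.consEquiv (fun _ : Fin (k + 2) => Fin (2 * k + 1))),
      Fintype.sum_prod_type]
    refine Finset.sum_congr rfl fun i _ => ?_
    rw [starCoord_eq]
    rfl
  have hp : ∀ p : Fin (k + 2), ∑ w : Fin (k + 2) → Fin (2 * k + 1),
      h w * ((-1 : ℝ) ^ (p : ℕ) * D (stdVec (w p)) (p.removeNth (fun q => stdVec (w q)))) =
      ∑ w, g w := by
    intro p
    rw [← Equiv.sum_comp (Equiv.arrowCongr p.cycleRange (Equiv.refl (Fin (2 * k + 1)))) g]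
    refine Finset.sum_congr rfl fun w _ => ?_
    change _ = h (w ∘ p.cycleRange.symm) * D (stdVec (w (p.cycleRange.symm 0)))
      (fun a => stdVec (w (p.cycleRange.symm a.succ)))
    rw [hh, Equiv.Perm.sign_symm, Fin.sign_cycleRange, Fin.cycleRange_symm_zero]
    simp_rw [Fin.cycleRange_symm_succ]
    push_cast
    rw [show (p.removeNth fun q => (stdVec (w q) : Eucl k)) = fun a => stdVec (w (p.succAbove a))
      from rfl]
    ring
  have hz : ((k + 2 : ℕ) : ℝ) * ∑ w, g w = 0 := by
    have h1 : ∑ p : Fin (k + 2), ∑ w : Fin (k + 2) → Fin (2 * k + 1),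
      h w * ((-1 : ℝ) ^ (p : ℕ) * D (stdVec (w p)) (p.removeNth (fun q => stdVec (w q)))) = 0 := by
      rw [Finset.sum_comm]
      refine Finset.sum_eq_zero fun w _ => ?_
      rw [← Finset.mul_sum, hD (fun q => stdVec (w q)), mul_zero]
    rw [Finset.sum_congr rfl fun p _ => hp p] at h1
    simpa using h1
  rw [hg]
  exact (mul_eq_zero.1 hz).resolve_left (by positivity)

/-- The Dirichlet condition, in terms of star coordinates: if `a` vanishes on the hyperplane
orthogonal to `g`, then the `k`-vector is tangent to it. -/
theorem sum_coord_mul_starCoord_update_eq_zero (a : (Eucl k) [⋀^Fin (k + 1)]→ₗ[ℝ] ℝ) (g : Eucl k)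
    (hg : g ≠ 0) (ha : ∀ V : Fin (k + 1) → Eucl k, (∀ i, inner ℝ g (V i) = 0) → a V = 0)
    (I : Fin k → Fin (2 * k + 1)) (m : Fin k) :
    ∑ i, g i * starCoord a (Function.update I m i) = 0 := by
  have hg2 : ‖g‖ ^ 2 ≠ 0 := by simpa using hg
  -- The orthogonal projection to the hyperplane.
  let P : Eucl k →ₗ[ℝ] Eucl k :=
    LinearMap.id - (‖g‖ ^ 2)⁻¹ • (innerₛₗ ℝ g).smulRight g
  have hP : ∀ v, P v = v - ((‖g‖ ^ 2)⁻¹ * inner ℝ g v) • g := by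
    intro v; simp [P, mul_smul]
  have hPt : ∀ i j, P (stdVec j) i = P (stdVec i) j := by
    intro i j
    simp only [hP, EuclideanSpace.inner_single_right]
    simp [eq_comm]
    ring
  have hPg : ∀ v, inner ℝ g (P v) = 0 := by
    intro v
    rw [hP, inner_sub_right, inner_smul_right, real_inner_self_eq_norm_sq]
    field_simp
    ring
  let c : (Fin (k + 1) → Eucl k) → Fin k ⊕ Fin (k + 1) → Eucl k := fun V =>
    Sum.elim (Function.update (fun s => stdVec (I s)) m g) V
  let H : MultilinearMap ℝ (fun _ : Fin (k + 1) => Eucl k) ℝ :=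
    (starForm k).toMultilinearMap.currySum (Function.update (fun s => stdVec (I s)) m g)
  have hHc : ∀ V, H V = starForm k (c V) := by
    intro V
    rfl
  have hH : ∀ V : Fin (k + 1) → Eucl k, H (fun a => P (V a)) = H V := by
    intro V
    rw [hHc, hHc]
    change volForm k _ = volForm k _
    rw [volForm_apply, volForm_apply]
    refine Matrix.det_eq_of_forall_row_eq_smul_add_const
      (fun r => Sum.elim (fun _ => 0) (fun a => - ((‖g‖ ^ 2)⁻¹ * inner ℝ g (V a)))
        ((splitStar k).symm r)) (splitStar k (Sum.inl m)) (by simp) ?_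
    intro r l
    obtain ⟨s, rfl⟩ := (splitStar k).surjective r
    rcases s with s | s
    · simp only [Matrix.of_apply, Equiv.symm_apply_apply, Function.comp_apply, Sum.elim_inl,
        zero_mul, add_zero, c]
    · simp only [Matrix.of_apply, Equiv.symm_apply_apply, Function.comp_apply, Sum.elim_inl,
        Sum.elim_inr, Function.update_self, hP, sub_eq_add_neg, PiLp.add_apply, PiLp.neg_apply,
        PiLp.smul_apply, smul_eq_mul, neg_mul, c]
  have h1 : ∑ i, g i * starCoord a (Function.update I m i) =
      ∑ A : Fin (k + 1) → Fin (2 * k + 1), H (fun s => stdVec (A s)) *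
        a.toMultilinearMap (fun s => stdVec (A s)) := by
    simp_rw [starCoord_eq, Finset.mul_sum]
    rw [Finset.sum_comm]
    refine Finset.sum_congr rfl fun A _ => ?_
    have h2 := (starForm k).map_update_sum Finset.univ (Sum.inl m) (fun i => g i • stdVec i)
      (c (fun s => stdVec (A s)))
    rw [sum_coord_smul_stdVec] at h2
    have h3 : Function.update (c (fun s => stdVec (A s))) (Sum.inl m) g =
        c (fun s => stdVec (A s)) := by
      rw [Function.update_eq_self_iff]
      exact (Function.update_self m g (fun s => (stdVec (I s) : Eucl k))).symm
    rw [h3] at h2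
    rw [hHc, h2, Finset.sum_mul]
    refine Finset.sum_congr rfl fun i _ => ?_
    rw [AlternatingMap.map_update_smul, smul_eq_mul, AlternatingMap.coe_multilinearMap, mul_assoc]
    congr 4
    ext1 s
    rcases s with s | s
    · by_cases hs : s = m
      · subst hs; rw [Function.update_self, Sum.elim_inl, Function.update_self]
      · rw [Function.update_of_ne (by simpa using hs), Sum.elim_inl, Function.update_of_ne hs]
        exact (Function.update_of_ne hs g (fun s => (stdVec (I s) : Eucl k))).symm
    · rw [Function.update_of_ne (by simp)]; rfl
  rw [h1]
  simp_rw [← hH (fun s => stdVec _)]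
  rw [← sum_mul_comp_eq_sum_comp_mul H a.toMultilinearMap (fun _ => P) (fun _ => P)
    (fun _ => hPt)]
  refine Finset.sum_eq_zero fun A _ => ?_
  rw [AlternatingMap.coe_multilinearMap, ha _ (fun i => hPg _), mul_zero]

/-- The derivation of the determinant induced by a linear map is multiplication by the trace. -/
theorem sum_volForm_update (L : Eucl k →ₗ[ℝ] Eucl k) (c : Fin (2 * k + 1) → Eucl k) :
    ∑ i, volForm k (Function.update c i (L (c i))) = (∑ j, L (stdVec j) j) * volForm k c := by
  set C : Matrix (Fin (2 * k + 1)) (Fin (2 * k + 1)) ℝ := Matrix.of fun i j => c i j with hC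
  have h1 : ∀ i, volForm k (Function.update c i (L (c i))) =
      ∑ j, C.adjugate j i * L (c i) j := by
    intro i
    rw [volForm_apply]
    trans (C.updateRow i (L (c i)).ofLp).det
    · congr 1
      ext p q
      by_cases hp : p = i
      · subst hp; rw [Matrix.updateRow_self, Matrix.of_apply, Function.update_self]
      · rw [Matrix.updateRow_ne hp, Matrix.of_apply, Function.update_of_ne hp]; rfl
    · rw [← Matrix.cramer_transpose_apply, Matrix.cramer_eq_adjugate_mulVec,
        ← Matrix.adjugate_transpose]
      rfl
  have h2 : ∀ i j, L (c i) j = ∑ l, C i l * L (stdVec l) j := by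
    intro i j
    conv_lhs => rw [← sum_coord_smul_stdVec (c i)]
    simp [hC]
  have h3 : ∀ j l, ∑ i, C.adjugate j i * C i l = C.det * if j = l then 1 else 0 := by
    intro j l
    have := congrFun (congrFun (Matrix.adjugate_mul C) j) l
    rw [Matrix.mul_apply] at this
    rw [this]
    simp [Matrix.one_apply]
  simp_rw [h1, h2, Finset.mul_sum]
  rw [Finset.sum_comm]
  rw [volForm_apply, ← hC, Finset.sum_mul]
  refine Finset.sum_congr rfl fun j _ => ?_
  rw [Finset.sum_comm]
  trans ∑ l, (∑ i, C.adjugate j i * C i l) * L (stdVec l) j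
  · refine Finset.sum_congr rfl fun l _ => ?_
    rw [Finset.sum_mul]
    refine Finset.sum_congr rfl fun i _ => ?_
    ring
  · simp_rw [h3]
    simp [mul_comm]

/-! ### The divergence theorem -/

/-- The part of a small ball where a function with nonzero differential lies in `[-δ, 0]` has
volume `O(δ)`: use the function as one of the coordinates. -/
theorem exists_volume_tube_le {ρ : Eucl k → ℝ} {L : Eucl k →L[ℝ] ℝ} {x₀ : Eucl k}
    (hρ : HasStrictFDerivAt ρ L x₀) (hL : L ≠ 0) :
    ∃ N ∈ 𝓝 x₀, ∃ C : ℝ, 0 ≤ C ∧ ∀ δ : ℝ, 0 ≤ δ →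
      volume {y ∈ N | -δ ≤ ρ y ∧ ρ y ≤ 0} ≤ ENNReal.ofReal (C * δ) := by
  obtain ⟨i, hi⟩ : ∃ i, L (stdVec i) ≠ 0 := by
    by_contra! h
    refine hL (ContinuousLinearMap.ext fun v => ?_)
    rw [← sum_coord_smul_stdVec v]
    simp [h]
  let c : Eucl k →L[ℝ] ℝ := EuclideanSpace.proj i
  let f : Eucl k → Eucl k := fun y => y + (ρ y - c y) • stdVec i
  let A : Eucl k →L[ℝ] Eucl k := ContinuousLinearMap.id ℝ _ + (L - c).smulRight (stdVec i)
  have hf : HasStrictFDerivAt f A x₀ :=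
    (hasStrictFDerivAt_id x₀).add ((hρ.sub c.hasStrictFDerivAt).smul_const (stdVec i))
  have hfi : ∀ y, f y i = ρ y := by
    intro y; simp [f, c]
  have hA : A.det ≠ 0 := by
    intro h0
    have h1 := LinearMap.bot_lt_ker_of_det_eq_zero (f := (A : Eucl k →ₗ[ℝ] Eucl k)) h0
    obtain ⟨v, hv, hv0⟩ := (Submodule.ne_bot_iff _).1 h1.ne'
    have h2 : v + (L v - v i) • stdVec i = 0 := by simpa [A, c] using hv
    have h3 : v = v i • stdVec i := by
      ext j
      by_cases hj : j = i
      · subst hj; simp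
      · have := congrArg (fun w : Eucl k => w j) h2
        simpa [hj] using this
    have h4 : L v = 0 := by
      have := congrArg (fun w : Eucl k => w i) h2
      simpa using this
    rw [h3, map_smul, smul_eq_mul] at h4
    have h5 : v i = 0 := (mul_eq_zero.1 h4).resolve_right hi
    exact hv0 (by rw [h3, h5, zero_smul])
  set m : NNReal := Real.toNNReal (|A.det| / 2) with hm
  have hm0 : 0 < m := by
    rw [hm, Real.toNNReal_pos]; positivity
  have hmA : (m : ENNReal) < ENNReal.ofReal |A.det| := by
    rw [hm]
    exact (ENNReal.ofReal_lt_ofReal_iff (by positivity)).2 (half_lt_self (by positivity))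
  obtain ⟨d, hd, hd0⟩ :=
    ((mul_le_addHaar_image_of_lt_det volume A hmA).and self_mem_nhdsWithin).exists
  obtain ⟨s, hs, hsA⟩ := hf.approximates_deriv_on_nhds (c := d) (Or.inr hd0)
  have hball : f ⁻¹' Metric.ball (f x₀) 1 ∈ 𝓝 x₀ :=
    hf.continuousAt.preimage_mem_nhds (Metric.ball_mem_nhds _ one_pos)
  refine ⟨s ∩ f ⁻¹' Metric.ball (f x₀) 1, inter_mem hs hball, (m : ℝ)⁻¹ * 2 ^ (2 * k),
    by positivity, fun δ hδ => ?_⟩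
  set S := {y ∈ s ∩ f ⁻¹' Metric.ball (f x₀) 1 | -δ ≤ ρ y ∧ ρ y ≤ 0} with hS
  have h1 : (m : ENNReal) * volume S ≤ volume (f '' S) :=
    hd S f (hsA.mono_set fun y hy => hy.1.1)
  let a : Fin (2 * k + 1) → ℝ := Function.update (fun j => f x₀ j - 1) i (-δ)
  let b : Fin (2 * k + 1) → ℝ := Function.update (fun j => f x₀ j + 1) i 0
  have h2 : f '' S ⊆ (MeasurableEquiv.toLp 2 (Fin (2 * k + 1) → ℝ)).symm ⁻¹' Icc a b := by
    rintro _ ⟨y, hy, rfl⟩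
    have hc : ∀ j, |f y j - f x₀ j| ≤ 1 := by
      intro j
      have h3 : ‖f y - f x₀‖ < 1 := by
        have : f y ∈ Metric.ball (f x₀) 1 := hy.1.2
        rwa [mem_ball_iff_norm] at this
      have h4 := PiLp.norm_apply_le (f y - f x₀) j
      rw [Real.norm_eq_abs] at h4
      exact h4.trans h3.le
    refine ⟨fun j => ?_, fun j => ?_⟩
    · by_cases hj : j = i
      · subst hj
        simp only [a, Function.update_self]
        exact hy.2.1.trans_eq (hfi y).symm
      · simp only [a, Function.update_of_ne hj]
        have := (abs_le.1 (hc j)).1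
        change f x₀ j - 1 ≤ f y j
        linarith
    · by_cases hj : j = i
      · subst hj
        simp only [b, Function.update_self]
        exact (hfi y).trans_le hy.2.2
      · simp only [b, Function.update_of_ne hj]
        have := (abs_le.1 (hc j)).2
        change f y j ≤ f x₀ j + 1
        linarith
  have h3 : volume ((MeasurableEquiv.toLp 2 (Fin (2 * k + 1) → ℝ)).symm ⁻¹' Icc a b) =
      ENNReal.ofReal (2 ^ (2 * k) * δ) := by
    rw [(EuclideanSpace.volume_preserving_symm_measurableEquiv_toLp _).measure_preimage
      measurableSet_Icc.nullMeasurableSet, Real.volume_Icc_pi,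
      Fintype.prod_eq_mul_prod_compl i]
    have h4 : ∀ j ∈ ({i}ᶜ : Finset (Fin (2 * k + 1))), ENNReal.ofReal (b j - a j) =
        ENNReal.ofReal 2 := by
      intro j hj
      have hj' : j ≠ i := by simpa using hj
      simp only [a, b, Function.update_of_ne hj']
      congr 1; ring
    rw [Finset.prod_congr rfl h4, Finset.prod_const, Finset.card_compl, Fintype.card_fin,
      Finset.card_singleton, Nat.add_sub_cancel, ENNReal.ofReal_mul (by positivity),
      ENNReal.ofReal_pow (by norm_num), mul_comm]
    simp [a, b]
  have h5 : (m : ENNReal) * volume S ≤ ENNReal.ofReal (2 ^ (2 * k) * δ) :=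
    h1.trans ((measure_mono h2).trans_eq h3)
  have hmne : (m : ENNReal) ≠ 0 := by exact_mod_cast hm0.ne'
  have h6 : volume S ≤ (m : ENNReal)⁻¹ * ENNReal.ofReal (2 ^ (2 * k) * δ) := by
    refine (ENNReal.mul_le_iff_le_inv hmne ENNReal.coe_ne_top).1 h5
  refine h6.trans_eq ?_
  rw [mul_assoc, ENNReal.ofReal_mul (p := (m : ℝ)⁻¹) (by positivity),
    ENNReal.ofReal_inv_of_pos (by exact_mod_cast hm0), ENNReal.ofReal_coe_nnreal]

theorem contDiff_of_forall_mem_tsupport {E F : Type*} [NormedAddCommGroup E] [NormedSpace ℝ E]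
    [NormedAddCommGroup F] [NormedSpace ℝ F] {n : WithTop ℕ∞} {g : E → F}
    (h : ∀ x ∈ tsupport g, ContDiffAt ℝ n g x) : ContDiff ℝ n g := by
  rw [contDiff_iff_contDiffAt]
  intro x
  by_cases hx : x ∈ tsupport g
  · exact h x hx
  · exact contDiffAt_const.congr_of_eventuallyEq (notMem_tsupport_iff_eventuallyEq.1 hx)

/-- The divergence of a vector field. -/
def divergence (W : Eucl k → Eucl k) (x : Eucl k) : ℝ := ∑ i, fderiv ℝ W x (stdVec i) i

theorem integral_divergence_eq_zero_of_hasCompactSupport {W : Eucl k → Eucl k}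
    (hW : ContDiff ℝ 1 W) (hc : HasCompactSupport W) : ∫ x, divergence W x = 0 := by
  have hcont : Continuous (fderiv ℝ W) := hW.continuous_fderiv one_ne_zero
  have hint : ∀ v, Integrable (fun x => fderiv ℝ W x v) := fun v =>
    (hcont.clm_apply continuous_const).integrable_of_hasCompactSupport (hc.fderiv_apply ℝ v)
  have hcoord : ∀ i, Integrable (fun x => fderiv ℝ W x (stdVec i) i) := fun i =>
    (EuclideanSpace.proj i : Eucl k →L[ℝ] ℝ).integrable_comp
      (hint (stdVec i))
  unfold divergence
  rw [integral_finsetSum _ fun i _ => hcoord i]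
  refine Finset.sum_eq_zero fun i _ => ?_
  let p : Eucl k →L[ℝ] ℝ := EuclideanSpace.proj i
  have hd : ∀ x, fderiv ℝ (fun x => p (W x)) x (stdVec i) = fderiv ℝ W x (stdVec i) i := by
    intro x
    have := (p.hasFDerivAt.comp x (hW.differentiable one_ne_zero x).hasFDerivAt).fderiv
    rw [show (fun x => p (W x)) = p ∘ W from rfl, this]
    rfl
  have hpW : Integrable (fun x => p (W x)) :=
    p.integrable_comp (hW.continuous.integrable_of_hasCompactSupport hc)
  have h := integral_mul_fderiv_eq_neg_fderiv_mul_of_integrable (μ := volume)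
    (f := fun _ : Eucl k => (1 : ℝ)) (g := fun x => p (W x)) (v := stdVec i)
    (by simp) (by simpa [hd] using hcoord i) (by simpa using hpW) (fun x _ => by fun_prop)
    (fun x _ => p.differentiableAt.comp x (hW.differentiable one_ne_zero x))
  simpa [hd] using h

/-- A vector field inside `Ω` which is tangent to the boundary at its smooth points, in the sense
that its normal component tends to zero there. The field and its divergence are bounded by `B`; no
limit at the boundary is required of the field itself. -/
structure IsTangentField (Ω : Set (Eucl k)) (W : Eucl k → Eucl k) (B : ℝ) : Prop where
  contDiffOn : ContDiffOn ℝ 1 W (interior Ω)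
  norm_le : ∀ x ∈ interior Ω, ‖W x‖ ≤ B
  abs_divergence_le : ∀ x ∈ interior Ω, |divergence W x| ≤ B
  tendsto : ∀ x ∈ frontier Ω, ∀ U ρ, IsDefiningFunctionAt Ω x U ρ →
    Tendsto (fun y => fderiv ℝ ρ y (W y)) (𝓝[interior Ω] x) (𝓝 0)

/-- The divergence of `χ W`. -/
def cutDiv (W : Eucl k → Eucl k) (χ : Eucl k → ℝ) (x : Eucl k) : ℝ :=
  χ x * divergence W x + fderiv ℝ χ x (W x)

theorem divergence_smul {W : Eucl k → Eucl k} {χ : Eucl k → ℝ} {x : Eucl k}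
    (hW : DifferentiableAt ℝ W x) (hχ : DifferentiableAt ℝ χ x) :
    divergence (fun y => χ y • W y) x = cutDiv W χ x := by
  unfold divergence cutDiv divergence
  rw [show (fun y => χ y • W y) = χ • W from rfl, (hχ.hasFDerivAt.smul hW.hasFDerivAt).fderiv]
  conv_rhs => rw [← sum_coord_smul_stdVec (W x)]
  simp [Finset.sum_add_distrib, Finset.mul_sum, mul_comm]

theorem integral_cutDiv_of_tsupport_subset_interior {Ω : Set (Eucl k)} {W : Eucl k → Eucl k}
    (hW : ContDiffOn ℝ 1 W (interior Ω)) {χ : Eucl k → ℝ} (hχ : ContDiff ℝ 1 χ)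
    (hc : HasCompactSupport χ) (hs : tsupport χ ⊆ interior Ω) :
    ∫ x in interior Ω, cutDiv W χ x = 0 := by
  have h1 : ∀ x ∈ interior Ω, ContDiffAt ℝ 1 W x := fun x hx =>
    hW.contDiffAt (isOpen_interior.mem_nhds hx)
  have h2 : tsupport (fun y => χ y • W y) ⊆ tsupport χ := tsupport_smul_subset_left χ W
  have h3 : ContDiff ℝ 1 (fun y => χ y • W y) := contDiff_of_forall_mem_tsupport fun x hx =>
    hχ.contDiffAt.smul (h1 x (hs (h2 hx)))
  have h4 := integral_divergence_eq_zero_of_hasCompactSupport h3 hc.smul_right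
  rw [← h4, ← setIntegral_eq_integral_of_forall_compl_eq_zero (s := interior Ω)
    (f := divergence (fun y => χ y • W y))]
  · refine setIntegral_congr_fun isOpen_interior.measurableSet fun x hx => ?_
    exact (divergence_smul ((h1 x hx).differentiableAt one_ne_zero)
      (hχ.differentiable one_ne_zero x)).symm
  · intro x hx
    have : x ∉ tsupport (fun y => χ y • W y) := fun h => hx (hs (h2 h))
    have h5 := fderiv_of_notMem_tsupport (𝕜 := ℝ) this
    simp [divergence, h5]

theorem exists_abs_deriv_smoothTransition_le : ∃ M : ℝ, 0 ≤ M ∧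
    (∀ s, |deriv Real.smoothTransition s| ≤ M) ∧
    ∀ s, s ∉ Icc (0 : ℝ) 1 → deriv Real.smoothTransition s = 0 := by
  have h0 : ∀ s, s ∉ Icc (0 : ℝ) 1 → deriv Real.smoothTransition s = 0 := by
    intro s hs
    rcases not_and_or.1 hs with h | h
    · have : Real.smoothTransition =ᶠ[𝓝 s] fun _ => 0 := by
        filter_upwards [Iio_mem_nhds (not_le.1 h)] with t ht
        exact Real.smoothTransition.zero_of_nonpos (le_of_lt ht)
      rw [this.deriv_eq, deriv_const]
    · have : Real.smoothTransition =ᶠ[𝓝 s] fun _ => 1 := by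
        filter_upwards [Ioi_mem_nhds (not_le.1 h)] with t ht
        exact Real.smoothTransition.one_of_one_le (le_of_lt ht)
      rw [this.deriv_eq, deriv_const]
  have hc : Continuous (deriv Real.smoothTransition) :=
    (Real.smoothTransition.contDiff (n := 1)).continuous_deriv le_rfl
  obtain ⟨M, hM⟩ := isCompact_Icc.exists_bound_of_continuousOn (s := Icc (0 : ℝ) 1) hc.continuousOn
  refine ⟨max M 0, le_max_right _ _, fun s => ?_, h0⟩
  by_cases hs : s ∈ Icc (0 : ℝ) 1
  · exact (hM s hs).trans (le_max_left _ _)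
  · rw [h0 s hs, abs_zero]; exact le_max_right _ _

section DefiningFunction

variable {Ω : Set (Eucl k)} {x₀ : Eucl k} {U : Set (Eucl k)} {ρ : Eucl k → ℝ}

theorem IsDefiningFunctionAt.contDiffAt (h : IsDefiningFunctionAt Ω x₀ U ρ) {y : Eucl k}
    (hy : y ∈ U) : ContDiffAt ℝ ∞ ρ y :=
  h.smooth.contDiffAt (h.isOpen.mem_nhds hy)

theorem IsDefiningFunctionAt.mem_interior (h : IsDefiningFunctionAt Ω x₀ U ρ) {y : Eucl k}
    (hy : y ∈ U) (hn : ρ y < 0) : y ∈ interior Ω := by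
  rw [mem_interior_iff_mem_nhds]
  filter_upwards [h.isOpen.mem_nhds hy,
    (h.contDiffAt hy).continuousAt.eventually_lt continuousAt_const hn] with z hz hz'
  exact (h.inter_eq.symm.subset (show z ∈ {y ∈ U | ρ y ≤ 0} from ⟨hz, hz'.le⟩)).1

theorem IsDefiningFunctionAt.neg_of_mem_interior (h : IsDefiningFunctionAt Ω x₀ U ρ) {y : Eucl k}
    (hy : y ∈ U) (hd : fderiv ℝ ρ y ≠ 0) (hi : y ∈ interior Ω) : ρ y < 0 := by
  have hle : ∀ z ∈ U, z ∈ Ω → ρ z ≤ 0 := fun z hz hz' => (h.inter_eq.subset ⟨hz', hz⟩).2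
  refine lt_of_le_of_ne (hle y hy (interior_subset hi)) fun h0 => hd ?_
  refine IsLocalMax.fderiv_eq_zero ?_
  filter_upwards [h.isOpen.mem_nhds hy, mem_interior_iff_mem_nhds.1 hi] with z hz hz'
  rw [h0]; exact hle z hz hz'

theorem IsDefiningFunctionAt.mem_frontier (h : IsDefiningFunctionAt Ω x₀ U ρ) {y : Eucl k}
    (hy : y ∈ U) (hd : fderiv ℝ ρ y ≠ 0) (h0 : ρ y = 0) : y ∈ frontier Ω :=
  ⟨subset_closure (h.inter_eq.symm.subset (show y ∈ {y ∈ U | ρ y ≤ 0} from ⟨hy, h0.le⟩)).1,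
    fun hi => (h.neg_of_mem_interior hy hd hi).ne h0⟩

theorem IsDefiningFunctionAt.of_mem (h : IsDefiningFunctionAt Ω x₀ U ρ) {y : Eucl k}
    (hy : y ∈ U) (hd : fderiv ℝ ρ y ≠ 0) (h0 : ρ y = 0) : IsDefiningFunctionAt Ω y U ρ :=
  ⟨h.isOpen, hy, h.smooth, h0, hd, h.inter_eq⟩

theorem IsDefiningFunctionAt.eq_zero_of_mem_frontier (h : IsDefiningFunctionAt Ω x₀ U ρ)
    (hΩ : IsClosed Ω) {y : Eucl k} (hy : y ∈ U) (hf : y ∈ frontier Ω) : ρ y = 0 := by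
  have h1 : y ∈ Ω := hΩ.frontier_subset hf
  have h2 : ρ y ≤ 0 := (h.inter_eq.subset ⟨h1, hy⟩).2
  exact le_antisymm h2 (not_lt.1 fun h3 => hf.2 (h.mem_interior hy h3))

theorem IsDefiningFunctionAt.eventually_fderiv_ne_zero (h : IsDefiningFunctionAt Ω x₀ U ρ) :
    ∀ᶠ y in 𝓝 x₀, y ∈ U ∧ fderiv ℝ ρ y ≠ 0 := by
  have hc : ContinuousAt (fderiv ℝ ρ) x₀ :=
    ((h.contDiffAt h.mem).fderiv_right (m := 0) (by simp)).continuousAt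
  exact (h.isOpen.eventually_mem h.mem).and (hc.eventually_ne h.regular)

end DefiningFunction

section CutDiv

variable {Ω : Set (Eucl k)} {W : Eucl k → Eucl k} {B : ℝ}

theorem continuousOn_divergence (hW : ContDiffOn ℝ 1 W (interior Ω)) :
    ContinuousOn (divergence W) (interior Ω) := by
  have h := hW.continuousOn_fderiv_of_isOpen isOpen_interior le_rfl
  unfold divergence
  refine continuousOn_finsetSum _ fun i _ => ?_
  exact (EuclideanSpace.proj i : Eucl k →L[ℝ] ℝ).continuous.comp_continuousOn
    (h.clm_apply continuousOn_const)

theorem continuousOn_cutDiv (hW : ContDiffOn ℝ 1 W (interior Ω)) {χ : Eucl k → ℝ}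
    (hχ : ContDiff ℝ 1 χ) : ContinuousOn (cutDiv W χ) (interior Ω) :=
  (hχ.continuous.continuousOn.mul (continuousOn_divergence hW)).add
    ((hχ.continuous_fderiv one_ne_zero).continuousOn.clm_apply hW.continuousOn)

theorem IsTangentField.nonneg (hW : IsTangentField Ω W B) {x : Eucl k} (hx : x ∈ interior Ω) :
    0 ≤ B := (norm_nonneg _).trans (hW.norm_le x hx)

theorem IsTangentField.abs_cutDiv_le (hW : IsTangentField Ω W B) {χ : Eucl k → ℝ}
    {x : Eucl k} (hx : x ∈ interior Ω) :
    |cutDiv W χ x| ≤ |χ x| * B + ‖fderiv ℝ χ x‖ * B := by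
  unfold cutDiv
  refine (abs_add_le _ _).trans (add_le_add ?_ ?_)
  · rw [abs_mul]
    exact mul_le_mul_of_nonneg_left (hW.abs_divergence_le x hx) (abs_nonneg _)
  · rw [← Real.norm_eq_abs]
    exact (ContinuousLinearMap.le_opNorm _ _).trans
      (mul_le_mul_of_nonneg_left (hW.norm_le x hx) (norm_nonneg _))

theorem IsTangentField.exists_abs_cutDiv_le (hW : IsTangentField Ω W B) {χ : Eucl k → ℝ}
    (hχ : ContDiff ℝ 1 χ) (hc : HasCompactSupport χ) :
    ∃ C, ∀ x ∈ interior Ω, |cutDiv W χ x| ≤ C := by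
  obtain ⟨C₁, h1⟩ := hχ.continuous.bounded_above_of_compact_support hc
  obtain ⟨C₂, h2⟩ := (hχ.continuous_fderiv one_ne_zero).bounded_above_of_compact_support
    (hc.fderiv ℝ)
  refine ⟨C₁ * B + C₂ * B, fun x hx => (hW.abs_cutDiv_le hx).trans ?_⟩
  have := hW.nonneg hx
  gcongr
  · exact h1 x
  · exact h2 x

theorem integrableOn_of_continuousOn_of_abs_le {U : Set (Eucl k)} (hU : IsOpen U)
    (hv : volume U ≠ ⊤) {F : Eucl k → ℝ} (hF : ContinuousOn F U) {C : ℝ}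
    (hC : ∀ x ∈ U, |F x| ≤ C) : IntegrableOn F U := by
  have : IsFiniteMeasure (volume.restrict U) := ⟨by simpa [lt_top_iff_ne_top] using hv⟩
  exact Integrable.of_bound (hF.aestronglyMeasurable hU.measurableSet) C
    ((ae_restrict_iff' hU.measurableSet).2 (Eventually.of_forall hC))

theorem volume_interior_ne_top (hΩ : IsCompact Ω) : volume (interior Ω) ≠ ⊤ :=
  ((measure_mono interior_subset).trans_lt hΩ.measure_lt_top).ne

theorem IsTangentField.integrableOn_cutDiv (hW : IsTangentField Ω W B) (hΩ : IsCompact Ω)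
    {χ : Eucl k → ℝ} (hχ : ContDiff ℝ 1 χ) (hc : HasCompactSupport χ) :
    IntegrableOn (cutDiv W χ) (interior Ω) := by
  obtain ⟨C, hC⟩ := hW.exists_abs_cutDiv_le hχ hc
  exact integrableOn_of_continuousOn_of_abs_le isOpen_interior (volume_interior_ne_top hΩ)
    (continuousOn_cutDiv hW.contDiffOn hχ) hC

theorem cutDiv_eq_zero_of_notMem_tsupport {χ : Eucl k → ℝ} {x : Eucl k} (hx : x ∉ tsupport χ) :
    cutDiv W χ x = 0 := by
  simp [cutDiv, fderiv_of_notMem_tsupport (𝕜 := ℝ) hx, image_eq_zero_of_notMem_tsupport hx]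

/-- The divergence theorem near a smooth point of the boundary: the cutoff functions
`η (-ρ / δ)`, of slope `1 / δ`, live on a tube of volume `O(δ)`, where the normal component of the
field is small. -/
theorem IsTangentField.exists_nhds_integral_cutDiv_eq_zero (hW : IsTangentField Ω W B)
    (hΩ : IsCompact Ω) {x₀ : Eucl k} {U : Set (Eucl k)} {ρ : Eucl k → ℝ}
    (hρ : IsDefiningFunctionAt Ω x₀ U ρ) :
    ∃ N, IsOpen N ∧ x₀ ∈ N ∧ ∀ χ : Eucl k → ℝ, ContDiff ℝ 1 χ → HasCompactSupport χ →
      tsupport χ ⊆ N → ∫ x in interior Ω, cutDiv W χ x = 0 := by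
  classical
  obtain ⟨N₀, hN₀, C, hC0, hC⟩ := exists_volume_tube_le
    ((hρ.contDiffAt hρ.mem).hasStrictFDerivAt (by simp)) hρ.regular
  have hN1 : N₀ ∩ {y | y ∈ U ∧ fderiv ℝ ρ y ≠ 0} ∈ 𝓝 x₀ :=
    inter_mem hN₀ hρ.eventually_fderiv_ne_zero
  refine ⟨interior (N₀ ∩ {y | y ∈ U ∧ fderiv ℝ ρ y ≠ 0}), isOpen_interior,
    mem_interior_iff_mem_nhds.2 hN1, fun χ hχ hχc hχs => ?_⟩
  set K := tsupport χ with hK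
  have hKc : IsCompact K := hχc
  have hKN : ∀ y ∈ K, y ∈ N₀ ∧ y ∈ U ∧ fderiv ℝ ρ y ≠ 0 := fun y hy =>
    interior_subset (s := N₀ ∩ {y | y ∈ U ∧ fderiv ℝ ρ y ≠ 0}) (hχs hy)
  obtain ⟨M, hM0, hM, hM'⟩ := exists_abs_deriv_smoothTransition_le
  obtain ⟨C₁, hC₁⟩ := hχ.continuous.bounded_above_of_compact_support hχc
  obtain ⟨C₂, hC₂⟩ := hW.exists_abs_cutDiv_le hχ hχc
  have hC₁0 : 0 ≤ C₁ := (norm_nonneg _).trans (hC₁ x₀)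
  let g : ℝ → Eucl k → ℝ := fun δ y => Real.smoothTransition (-ρ y / δ - 1)
  let χ' : ℝ → Eucl k → ℝ := fun δ y => χ y * g δ y
  have hgle : ∀ δ y, |g δ y| ≤ 1 := fun δ y => by
    rw [abs_of_nonneg (Real.smoothTransition.nonneg _)]
    exact Real.smoothTransition.le_one _
  have hgd : ∀ δ, ∀ y ∈ K, HasFDerivAt (g δ)
      ((deriv Real.smoothTransition (-ρ y / δ - 1) * (-δ⁻¹)) • fderiv ℝ ρ y) y := by
    intro δ y hy
    have h1 : HasFDerivAt ρ (fderiv ℝ ρ y) y :=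
      ((hρ.contDiffAt (hKN y hy).2.1).differentiableAt (by simp)).hasFDerivAt
    have h2 : HasFDerivAt (fun y => -ρ y / δ - 1) ((-δ⁻¹) • fderiv ℝ ρ y) y := by
      have := (h1.const_mul (-δ⁻¹)).sub_const 1
      rwa [show (fun y => -δ⁻¹ * ρ y - 1) = fun y => -ρ y / δ - 1 by ext z; ring] at this
    have h3 := ((Real.smoothTransition.contDiff (n := 1)).differentiable one_ne_zero
      (-ρ y / δ - 1)).hasDerivAt.comp_hasFDerivAt y h2
    rw [smul_smul] at h3
    exact h3
  have hgc : ∀ δ, ∀ y ∈ K, ContDiffAt ℝ 1 (g δ) y := by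
    intro δ y hy
    have h1 : ContDiffAt ℝ 1 ρ y := (hρ.contDiffAt (hKN y hy).2.1).of_le (by simp)
    exact Real.smoothTransition.contDiff.contDiffAt.comp y
      ((h1.neg.div_const δ).sub contDiffAt_const)
  have hχ's : ∀ δ, tsupport (χ' δ) ⊆ K := fun δ => tsupport_mul_subset_left
  have hχ'd : ∀ δ, ContDiff ℝ 1 (χ' δ) := fun δ =>
    contDiff_of_forall_mem_tsupport fun y hy => hχ.contDiffAt.mul (hgc δ y (hχ's δ hy))
  have hχ'c : ∀ δ, HasCompactSupport (χ' δ) := fun δ => hχc.mul_right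
  have hχ'i : ∀ δ, 0 < δ → tsupport (χ' δ) ⊆ interior Ω := by
    intro δ hδ y hy
    have hyK := hχ's δ hy
    refine hρ.mem_interior (hKN y hyK).2.1 ?_
    by_contra! hge
    have h1 : ContinuousAt ρ y := (hρ.contDiffAt (hKN y hyK).2.1).continuousAt
    have h2 : χ' δ =ᶠ[𝓝 y] 0 := by
      filter_upwards [h1.eventually (lt_mem_nhds (show -δ < ρ y by linarith))] with z hz
      have : -ρ z / δ - 1 ≤ 0 := by
        rw [sub_nonpos, div_le_one hδ]; linarith
      simp [χ', g, Real.smoothTransition.zero_of_nonpos this]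
    exact (notMem_tsupport_iff_eventuallyEq.2 h2) hy
  have hzero : ∀ δ, 0 < δ → ∫ x in interior Ω, cutDiv W (χ' δ) x = 0 := fun δ hδ =>
    integral_cutDiv_of_tsupport_subset_interior hW.contDiffOn (hχ'd δ) (hχ'c δ) (hχ'i δ hδ)
  have hF_cont : ∀ δ, ContinuousOn (fun y => g δ y * cutDiv W χ y) (interior Ω) := by
    intro δ y hy
    refine ContinuousAt.continuousWithinAt ?_
    by_cases hyK : y ∈ K
    · exact (hgc δ y hyK).continuousAt.mul
        ((continuousOn_cutDiv hW.contDiffOn hχ).continuousAt (isOpen_interior.mem_nhds hy))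
    · refine (continuousAt_const (y := (0 : ℝ))).congr ?_
      filter_upwards [(isClosed_tsupport χ).isOpen_compl.mem_nhds hyK] with z hz
      rw [cutDiv_eq_zero_of_notMem_tsupport hz, mul_zero]
  have hF_le : ∀ δ, ∀ y ∈ interior Ω, |g δ y * cutDiv W χ y| ≤ C₂ := by
    intro δ y hy
    rw [abs_mul]
    calc _ ≤ 1 * |cutDiv W χ y| := mul_le_mul_of_nonneg_right (hgle δ y) (abs_nonneg _)
      _ ≤ C₂ := by rw [one_mul]; exact hC₂ y hy
  have hF_int : ∀ δ, IntegrableOn (fun y => g δ y * cutDiv W χ y) (interior Ω) := fun δ =>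
    integrableOn_of_continuousOn_of_abs_le isOpen_interior (volume_interior_ne_top hΩ)
      (hF_cont δ) (hF_le δ)
  have hR : ∀ δ, ∀ y ∈ interior Ω, cutDiv W (χ' δ) y - g δ y * cutDiv W χ y =
      if y ∈ K then χ y * (deriv Real.smoothTransition (-ρ y / δ - 1) * (-δ⁻¹) *
        fderiv ℝ ρ y (W y)) else 0 := by
    intro δ y hy
    split_ifs with hyK
    · have h1 := ((hχ.differentiable one_ne_zero y).hasFDerivAt.mul (hgd δ y hyK)).fderiv
      unfold cutDiv
      rw [show fderiv ℝ (χ' δ) y = _ from h1]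
      simp [χ']
      ring
    · rw [cutDiv_eq_zero_of_notMem_tsupport hyK,
        cutDiv_eq_zero_of_notMem_tsupport (fun h => hyK (hχ's δ h))]
      simp
  -- The normal component is small on the tube, uniformly.
  have hunif : ∀ ε > 0, ∃ δ₀ > 0, ∀ y ∈ K, y ∈ interior Ω → |ρ y| < δ₀ →
      |fderiv ℝ ρ y (W y)| ≤ ε := by
    intro ε hε
    have h1 : ∀ x ∈ K, ∀ᶠ y in (𝓟 (interior Ω) ⊓ comap ρ (𝓝 0)) ⊓ 𝓝 x,
        |fderiv ℝ ρ y (W y)| ≤ ε := by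
      intro x hx
      obtain ⟨-, hxU, hxd⟩ := hKN x hx
      by_cases h0 : ρ x = 0
      · have h2 := hW.tendsto x (hρ.mem_frontier hxU hxd h0) U ρ (hρ.of_mem hxU hxd h0)
        have h3 : ∀ᶠ y in 𝓝[interior Ω] x, |fderiv ℝ ρ y (W y)| ≤ ε := by
          filter_upwards [h2.eventually (Metric.closedBall_mem_nhds 0 hε)] with y hy
          simpa using hy
        refine h3.filter_mono ?_
        rw [nhdsWithin, inf_comm]
        exact inf_le_inf_left _ inf_le_left
      · have h2 : ContinuousAt ρ x := (hρ.contDiffAt hxU).continuousAt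
        have h3 : Disjoint (comap ρ (𝓝 0)) (𝓝 x) := by
          have h4 : Disjoint (𝓝 (0 : ℝ)) (𝓝 (ρ x)) := disjoint_nhds_nhds.2 (Ne.symm h0)
          exact (disjoint_comap h4).mono_right (tendsto_iff_comap.1 h2)
        rw [inf_assoc, h3.eq_bot, inf_bot_eq]
        exact eventually_bot
    have h2 : ∀ᶠ y in (𝓟 (interior Ω) ⊓ comap ρ (𝓝 0)) ⊓ 𝓝ˢ K, |fderiv ℝ ρ y (W y)| ≤ ε := by
      rw [hKc.inf_nhdsSet_eq_biSup, eventually_iSup]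
      intro x
      rw [eventually_iSup]
      exact h1 x
    have h3 : ∀ᶠ y in comap ρ (𝓝 0) ⊓ 𝓟 (K ∩ interior Ω), |fderiv ℝ ρ y (W y)| ≤ ε := by
      refine h2.filter_mono ?_
      rw [← inf_principal]
      refine le_inf (le_inf ?_ inf_le_left) ?_
      · exact inf_le_right.trans inf_le_right
      · exact (inf_le_right.trans inf_le_left).trans principal_le_nhdsSet
    rw [eventually_inf_principal] at h3
    obtain ⟨t, ht, h4⟩ := mem_comap.1 h3
    obtain ⟨δ₀, hδ₀, h5⟩ := Metric.mem_nhds_iff.1 ht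
    refine ⟨δ₀, hδ₀, fun y hy hyi hyρ => h4 (h5 ?_) ⟨hy, hyi⟩⟩
    simpa using hyρ
  have hbound : ∀ ε > 0, ∀ᶠ δ in 𝓝[>] (0 : ℝ),
      |∫ x in interior Ω, g δ x * cutDiv W χ x| ≤ ε * (C₁ * M * (C * 2)) := by
    intro ε hε
    obtain ⟨δ₀, hδ₀, hδ₀'⟩ := hunif ε hε
    filter_upwards [self_mem_nhdsWithin, nhdsWithin_le_nhds (Iio_mem_nhds (half_pos hδ₀))]
      with δ (hδ : 0 < δ) (hδ2 : δ < δ₀ / 2)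
    set A := K ∩ interior Ω ∩ {y ∈ N₀ | -(2 * δ) ≤ ρ y ∧ ρ y ≤ 0} with hA
    set R : Eucl k → ℝ := fun y => cutDiv W (χ' δ) y - g δ y * cutDiv W χ y with hRdef
    have h1 : ∫ x in interior Ω, g δ x * cutDiv W χ x = - ∫ x in interior Ω, R x := by
      rw [hRdef, integral_sub (hW.integrableOn_cutDiv hΩ (hχ'd δ) (hχ'c δ)) (hF_int δ),
        hzero δ hδ]
      ring
    have hRz : ∀ y ∈ interior Ω, y ∉ A → R y = 0 := by
      intro y hy hyA
      rw [hRdef]; dsimp only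
      rw [hR δ y hy]
      split_ifs with hyK
      · have : deriv Real.smoothTransition (-ρ y / δ - 1) = 0 := by
          refine hM' _ fun h => hyA ⟨⟨hyK, hy⟩, (hKN y hyK).1, ?_, ?_⟩
          · have h2 := h.2
            rw [sub_le_iff_le_add, div_le_iff₀ hδ] at h2
            linarith
          · have h2 := h.1
            rw [sub_nonneg, le_div_iff₀ hδ] at h2
            linarith
        rw [this]; ring
      · rfl
    have hRA : ∀ y ∈ A, ‖R y‖ ≤ C₁ * (M * δ⁻¹ * ε) := by
      intro y hy
      rw [hRdef]; dsimp only
      rw [hR δ y hy.1.2, if_pos hy.1.1, norm_mul, norm_mul, norm_mul, norm_neg]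
      have h2 : ‖(fderiv ℝ ρ y) (W y)‖ ≤ ε := by
        refine hδ₀' y hy.1.1 hy.1.2 ?_
        rw [abs_lt]
        constructor <;> linarith [hy.2.2.1, hy.2.2.2]
      have h3 : ‖δ⁻¹‖ = δ⁻¹ := by rw [Real.norm_eq_abs, abs_of_pos (by positivity)]
      rw [h3]
      gcongr
      · exact hC₁ y
      · exact hM _
    have hAvol : volume A ≤ ENNReal.ofReal (C * (2 * δ)) :=
      (measure_mono inter_subset_right).trans (hC (2 * δ) (by positivity))
    have h4 : ∫ x in interior Ω, R x = ∫ x in A, R x := by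
      refine (setIntegral_eq_of_subset_of_forall_sdiff_eq_zero isOpen_interior.measurableSet
        (fun y hy => hy.1.2) fun y hy => hRz y hy.1 hy.2)
    rw [h1, abs_neg, h4, ← Real.norm_eq_abs]
    have h5 := norm_setIntegral_le_of_norm_le_const (μ := volume) (f := R) (s := A)
      (hAvol.trans_lt ENNReal.ofReal_lt_top) hRA
    refine h5.trans ?_
    have h6 : volume.real A ≤ C * (2 * δ) :=
      ENNReal.toReal_le_of_le_ofReal (by positivity) hAvol
    calc C₁ * (M * δ⁻¹ * ε) * volume.real A ≤ C₁ * (M * δ⁻¹ * ε) * (C * (2 * δ)) := by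
          gcongr
      _ = ε * (C₁ * M * (C * 2)) := by field_simp
  have hlim0 : Tendsto (fun δ => ∫ x in interior Ω, g δ x * cutDiv W χ x) (𝓝[>] 0) (𝓝 0) := by
    rw [Metric.tendsto_nhds]
    intro ε hε
    have hD : 0 < C₁ * M * (C * 2) + 1 := by positivity
    filter_upwards [hbound (ε / (C₁ * M * (C * 2) + 1)) (by positivity)] with δ h
    rw [dist_zero_right, Real.norm_eq_abs]
    refine h.trans_lt ?_
    rw [div_mul_eq_mul_div, div_lt_iff₀ hD]
    nlinarith
  have hlim : Tendsto (fun δ => ∫ x in interior Ω, g δ x * cutDiv W χ x) (𝓝[>] 0)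
      (𝓝 (∫ x in interior Ω, cutDiv W χ x)) := by
    have : IsFiniteMeasure (volume.restrict (interior Ω)) :=
      ⟨by simpa [lt_top_iff_ne_top] using volume_interior_ne_top hΩ⟩
    refine tendsto_integral_filter_of_dominated_convergence (fun _ => C₂) ?_ ?_
      (integrable_const _) ?_
    · exact Eventually.of_forall fun δ =>
        (hF_cont δ).aestronglyMeasurable isOpen_interior.measurableSet
    · exact Eventually.of_forall fun δ =>
        (ae_restrict_iff' isOpen_interior.measurableSet).2 (Eventually.of_forall (hF_le δ))
    · refine (ae_restrict_iff' isOpen_interior.measurableSet).2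
        (Eventually.of_forall fun y hy => ?_)
      by_cases hyK : y ∈ K
      · have hneg := hρ.neg_of_mem_interior (hKN y hyK).2.1 (hKN y hyK).2.2 hy
        refine tendsto_const_nhds.congr' ?_
        filter_upwards [self_mem_nhdsWithin,
          nhdsWithin_le_nhds (Iio_mem_nhds (show (0 : ℝ) < -ρ y / 2 by linarith))]
          with δ (hδ : 0 < δ) (hδ2 : δ < -ρ y / 2)
        have : 1 ≤ -ρ y / δ - 1 := by
          rw [le_sub_iff_add_le, le_div_iff₀ hδ]; linarith
        simp [g, Real.smoothTransition.one_of_one_le this]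
      · rw [cutDiv_eq_zero_of_notMem_tsupport hyK]
        simp
  exact tendsto_nhds_unique hlim hlim0

end CutDiv

/-! ### The exceptional part of the boundary -/

/-- The points of the boundary where it is not a smooth hypersurface. -/
def singularBoundary (Ω : Set (Eucl k)) : Set (Eucl k) :=
  {x ∈ frontier Ω | ¬ IsSmoothBoundaryPoint Ω x}

theorem isClosed_singularBoundary {Ω : Set (Eucl k)} (hΩ : IsClosed Ω) :
    IsClosed (singularBoundary Ω) := by
  rw [← isOpen_compl_iff, isOpen_iff_mem_nhds]
  intro x hx
  by_cases hf : x ∈ frontier Ω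
  · obtain ⟨U, ρ, hρ⟩ : IsSmoothBoundaryPoint Ω x := by
      by_contra h
      exact hx ⟨hf, h⟩
    filter_upwards [hρ.eventually_fderiv_ne_zero] with y hy hyb
    exact hyb.2 ⟨U, ρ, hρ.of_mem hy.1 hy.2 (hρ.eq_zero_of_mem_frontier hΩ hy.1 hyb.1)⟩
  · filter_upwards [isClosed_frontier.isOpen_compl.mem_nhds hf] with y hy hyb
    exact hy hyb.1

/-- A compact set of vanishing `d`-dimensional Hausdorff measure has finite covers by balls of
arbitrarily small `d`-dimensional content. -/
theorem exists_finite_cover_balls_of_hausdorffMeasure_eq_zero {X : Type*} [MetricSpace X]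
    [Nonempty X] [MeasurableSpace X] [BorelSpace X] {s : Set X} (hs : IsCompact s) (d : ℕ)
    (h0 : Measure.hausdorffMeasure (d : ℝ) s = 0) {ε : ℝ} (hε : 0 < ε) :
    ∃ (F : Finset ℕ) (c : ℕ → X) (r : ℕ → ℝ), (∀ n ∈ F, 0 < r n ∧ r n ≤ 1) ∧
      s ⊆ ⋃ n ∈ F, Metric.ball (c n) (r n) ∧ ∑ n ∈ F, r n ^ d ≤ ε := by
  have h1 := Measure.hausdorffMeasure_apply (d : ℝ) s
  rw [h0] at h1
  have h2 := (ENNReal.iSup_eq_zero.1 h1.symm) (1 / 2)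
  have h3 := (ENNReal.iSup_eq_zero.1 h2) (by norm_num)
  have h4 : (⨅ (t : ℕ → Set X) (_ : s ⊆ ⋃ n, t n) (_ : ∀ n, Metric.ediam (t n) ≤ 1 / 2),
      ∑' n, ⨆ _ : (t n).Nonempty, Metric.ediam (t n) ^ (d : ℝ)) < ENNReal.ofReal (ε / 2) := by
    rw [h3]; exact ENNReal.ofReal_pos.2 (half_pos hε)
  simp only [iInf_lt_iff] at h4
  obtain ⟨t, hst, htd, hsum⟩ := h4
  let D : ℕ → ℝ := fun n => (Metric.ediam (t n)).toReal
  have hDtop : ∀ n, Metric.ediam (t n) ≠ ⊤ := fun n =>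
    ((htd n).trans_lt (by simp)).ne
  have hD0 : ∀ n, 0 ≤ D n := fun n => ENNReal.toReal_nonneg
  have hDle : ∀ n, D n ≤ 1 / 2 := by
    intro n
    have := ENNReal.toReal_mono (by simp) (htd n)
    simpa [D] using this
  -- Enlarge the radii a little, so that they are positive.
  have hδ : ∀ n, ∃ δ : ℝ, 0 < δ ∧ δ ≤ 1 / 2 ∧ (D n + δ) ^ d ≤ D n ^ d + ε / 2 / 2 / 2 ^ n := by
    intro n
    have hc : Tendsto (fun δ : ℝ => (D n + δ) ^ d) (𝓝[>] 0) (𝓝 (D n ^ d)) := by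
      have : ContinuousAt (fun δ : ℝ => (D n + δ) ^ d) 0 := by fun_prop
      have h := this.tendsto
      rw [add_zero] at h
      exact h.mono_left nhdsWithin_le_nhds
    have h5 := hc.eventually (gt_mem_nhds (show D n ^ d < D n ^ d + ε / 2 / 2 / 2 ^ n by
      have : 0 < ε / 2 / 2 / 2 ^ n := by positivity
      linarith))
    have h6 : ∀ᶠ δ : ℝ in 𝓝[>] 0, δ ≤ 1 / 2 :=
      nhdsWithin_le_nhds (Iic_mem_nhds (show (0 : ℝ) < 1 / 2 by norm_num))
    have h7 : ∀ᶠ δ : ℝ in 𝓝[>] 0, 0 < δ := self_mem_nhdsWithin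
    obtain ⟨δ, h8, h9, h10⟩ := (h5.and (h7.and h6)).exists
    exact ⟨δ, h9, h10, le_of_lt h8⟩
  choose δ hδ0 hδ1 hδ2 using hδ
  have hc : ∀ n, ∃ c : X, (t n).Nonempty → c ∈ t n := by
    intro n
    by_cases h : (t n).Nonempty
    · exact ⟨h.some, fun _ => h.some_mem⟩
    · exact ⟨Classical.arbitrary X, fun h' => (h h').elim⟩
  choose c hcmem using hc
  have hcov : s ⊆ ⋃ n : {n // (t n).Nonempty}, Metric.ball (c n) (D n + δ n) := by
    intro x hx
    obtain ⟨n, hn⟩ := mem_iUnion.1 (hst hx)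
    refine mem_iUnion.2 ⟨⟨n, ⟨x, hn⟩⟩, ?_⟩
    rw [Metric.mem_ball]
    have h := Metric.edist_le_ediam_of_mem hn (hcmem n ⟨x, hn⟩)
    have h' := ENNReal.toReal_mono (hDtop n) h
    rw [← dist_edist] at h'
    have := hδ0 n
    dsimp only [D]
    linarith
  obtain ⟨G, hG⟩ := hs.elim_finite_subcover _ (fun _ => Metric.isOpen_ball) hcov
  refine ⟨G.map (Function.Embedding.subtype _), c, fun n => D n + δ n, fun n _ => ?_, ?_, ?_⟩
  · have := hδ0 n
    have := hδ1 n
    have := hD0 n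
    have := hDle n
    constructor <;> linarith
  · intro x hx
    obtain ⟨n, hn, hxn⟩ := mem_iUnion₂.1 (hG hx)
    exact mem_iUnion₂.2 ⟨n, Finset.mem_map.2 ⟨n, hn, rfl⟩, hxn⟩
  · have hA : ∑ n ∈ G, D n ^ d ≤ ε / 2 := by
      have h5 : ENNReal.ofReal (∑ n ∈ G, D n ^ d) ≤ ENNReal.ofReal (ε / 2) := by
        rw [ENNReal.ofReal_sum_of_nonneg fun (n : {n // (t n).Nonempty}) _ =>
          pow_nonneg (hD0 n) d]
        refine le_trans ?_ hsum.le
        refine le_trans ?_ (ENNReal.sum_le_tsum (G.map (Function.Embedding.subtype _)))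
        rw [Finset.sum_map]
        refine Finset.sum_le_sum fun n _ => ?_
        refine le_trans ?_ (le_iSup _ n.2)
        dsimp only [D]
        rw [ENNReal.ofReal_pow ENNReal.toReal_nonneg, ENNReal.ofReal_toReal (hDtop n),
          Function.Embedding.subtype_apply, ENNReal.rpow_natCast]
      exact (ENNReal.ofReal_le_ofReal_iff (half_pos hε).le).1 h5
    have hB : ∑ n ∈ G.map (Function.Embedding.subtype _), ε / 2 / 2 / 2 ^ n ≤ ε / 2 := by
      refine ((summable_geometric_two' (ε / 2)).sum_le_tsum _ fun n _ => by positivity).trans_eq ?_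
      exact tsum_geometric_two' _
    rw [Finset.sum_map] at hB ⊢
    calc _ ≤ ∑ n ∈ G, (D n ^ d + ε / 2 / 2 / 2 ^ (n : ℕ)) :=
          Finset.sum_le_sum fun n _ => hδ2 n
      _ ≤ ε := by
          rw [Finset.sum_add_distrib]
          simp only [Function.Embedding.subtype_apply] at hB
          linarith

theorem cutDiv_sum {W : Eucl k → Eucl k} {ι : Type*} {s : Finset ι} {χ : ι → Eucl k → ℝ}
    (hχ : ∀ i ∈ s, ContDiff ℝ 1 (χ i)) (x : Eucl k) :
    cutDiv W (fun y => ∑ i ∈ s, χ i y) x = ∑ i ∈ s, cutDiv W (χ i) x := by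
  unfold cutDiv
  rw [fderiv_fun_sum fun i hi => (hχ i hi).differentiable one_ne_zero x, Finset.sum_add_distrib,
    Finset.sum_mul, sum_apply]

/-- The divergence theorem for fields cut off away from the singular part of the boundary, from the
local statement by a partition of unity. -/
theorem IsTangentField.integral_cutDiv_eq_zero {Ω : Set (Eucl k)} {W : Eucl k → Eucl k} {B : ℝ}
    (hW : IsTangentField Ω W B) (hΩ : IsCompact Ω) {χ : Eucl k → ℝ} (hχ : ContDiff ℝ 1 χ)
    (hc : HasCompactSupport χ) (hs : Disjoint (tsupport χ) (singularBoundary Ω)) :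
    ∫ x in interior Ω, cutDiv W χ x = 0 := by
  have h1 : ∀ x ∈ tsupport χ, ∃ N, IsOpen N ∧ x ∈ N ∧ ∀ χ : Eucl k → ℝ, ContDiff ℝ 1 χ →
      HasCompactSupport χ → tsupport χ ⊆ N → ∫ x in interior Ω, cutDiv W χ x = 0 := by
    intro x hx
    by_cases hi : x ∈ interior Ω
    · exact ⟨interior Ω, isOpen_interior, hi, fun χ h1 h2 h3 =>
        integral_cutDiv_of_tsupport_subset_interior hW.contDiffOn h1 h2 h3⟩
    by_cases hx' : x ∈ Ω
    · obtain ⟨U, ρ, hρ⟩ : IsSmoothBoundaryPoint Ω x := by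
        by_contra h
        exact disjoint_left.1 hs hx ⟨⟨subset_closure hx', hi⟩, h⟩
      exact hW.exists_nhds_integral_cutDiv_eq_zero hΩ hρ
    · refine ⟨Ωᶜ, hΩ.isClosed.isOpen_compl, hx', fun χ h1 h2 h3 => ?_⟩
      refine setIntegral_eq_zero_of_forall_eq_zero fun y hy => ?_
      exact cutDiv_eq_zero_of_notMem_tsupport fun h => h3 h (interior_subset hy)
  choose! N hNo hxN hN using h1
  obtain ⟨t, ht, hcov⟩ := IsCompact.elim_nhds_subcover (hc : IsCompact (tsupport χ)) N
    fun x hx => (hNo x hx).mem_nhds (hxN x hx)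
  obtain ⟨g, hg⟩ := SmoothPartitionOfUnity.exists_isSubordinate (modelWithCornersSelf ℝ (Eucl k))
    (isClosed_tsupport χ) (fun x : t => N x) (fun x => hNo x (ht x x.2))
    fun x hx => by
      obtain ⟨i, hi, hxi⟩ := mem_iUnion₂.1 (hcov hx)
      exact mem_iUnion.2 ⟨⟨i, hi⟩, hxi⟩
  have hgd : ∀ i, ContDiff ℝ 1 (g i) := fun i => (g i).contMDiff.contDiff.of_le (by simp)
  have h2 : ∀ x, χ x = ∑ i, g i x * χ x := by
    intro x
    by_cases hx : x ∈ tsupport χ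
    · have := g.sum_eq_one hx
      rw [finsum_eq_sum_of_fintype] at this
      rw [← Finset.sum_mul, this, one_mul]
    · simp [image_eq_zero_of_notMem_tsupport hx]
  have h3 : ∀ i, ContDiff ℝ 1 fun x => g i x * χ x := fun i => (hgd i).mul hχ
  have h4 : ∀ i, HasCompactSupport fun x => g i x * χ x := fun i => hc.mul_left
  have h5 : ∀ i, tsupport (fun x => g i x * χ x) ⊆ N i := fun i =>
    (tsupport_mul_subset_left (f := g i) (g := χ)).trans (hg i)
  have h6 : cutDiv W χ = fun x => ∑ i, cutDiv W (fun x => g i x * χ x) x := by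
    ext x
    rw [← cutDiv_sum fun i _ => h3 i]
    rw [← funext h2]
  rw [h6, integral_finsetSum _ fun i _ => hW.integrableOn_cutDiv hΩ (h3 i) (h4 i)]
  exact Finset.sum_eq_zero fun i _ => hN i (ht i i.2) _ (h3 i) (h4 i) (h5 i)

/-- Cutoff functions: `1` on a ball, `0` outside of the ball of twice the radius. -/
theorem exists_bump (k : ℕ) : ∃ ψ : Eucl k → ℝ, ∃ C : ℝ, 0 ≤ C ∧ ContDiff ℝ 1 ψ ∧
    (∀ x, 0 ≤ ψ x) ∧ (∀ x, ‖x‖ ≤ 1 → ψ x = 1) ∧ (∀ x, 2 < ‖x‖ → ψ x = 0 ∧ fderiv ℝ ψ x = 0) ∧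
    ∀ x, ‖fderiv ℝ ψ x‖ ≤ C := by
  let ψ : ContDiffBump (0 : Eucl k) := ⟨1, 2, one_pos, one_lt_two⟩
  obtain ⟨C, hC⟩ :=
    (ψ.contDiff.continuous_fderiv (n := 1) one_ne_zero).bounded_above_of_compact_support
    (ψ.hasCompactSupport.fderiv ℝ)
  refine ⟨ψ, C, (norm_nonneg _).trans (hC 0), ψ.contDiff, fun x => ψ.nonneg, fun x hx =>
    ψ.one_of_mem_closedBall (by simpa using hx), fun x hx => ?_, hC⟩
  have : x ∉ tsupport ψ := by
    rw [ψ.tsupport_eq]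
    simpa using hx
  exact ⟨image_eq_zero_of_notMem_tsupport this, fderiv_of_notMem_tsupport (𝕜 := ℝ) this⟩

/-- The divergence theorem for fields that are tangent to the boundary of a compact domain with
piecewise smooth boundary. The exceptional part of the boundary is cut off by functions whose
slope `1 / r` on balls of radius `r` is compensated by the volumes of these balls, since the sum of
the `r ^ (2 * k)` is small. -/
theorem IsTangentField.integral_divergence_eq_zero {Ω : Set (Eucl k)} {W : Eucl k → Eucl k}
    {B : ℝ} (hW : IsTangentField Ω W B) (hΩ : IsCompactDomain Ω) :
    ∫ x in interior Ω, divergence W x = 0 := by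
  rcases (interior Ω).eq_empty_or_nonempty with he | ⟨x₁, hx₁⟩
  · simp [he]
  have hB := hW.nonneg hx₁
  have hsing : IsCompact (singularBoundary Ω) :=
    hΩ.isCompact.of_isClosed_subset (isClosed_singularBoundary hΩ.isCompact.isClosed)
      fun x hx => hΩ.isCompact.isClosed.frontier_subset hx.1
  have hH : Measure.hausdorffMeasure ((2 * k : ℕ) : ℝ) (singularBoundary Ω) = 0 := by
    rw [Nat.cast_mul, Nat.cast_ofNat]; exact hΩ.piecewise_smooth
  obtain ⟨M, hM0, hM, hM'⟩ := exists_abs_deriv_smoothTransition_le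
  obtain ⟨ψ, C, hC0, hψ, hψ0, hψ1, hψ2, hC⟩ := exists_bump k
  obtain ⟨R, hR⟩ := hΩ.isCompact.isBounded.subset_ball 0
  let θ : ContDiffBump (0 : Eucl k) := ⟨max R 1, max R 1 + 1, by positivity, by linarith⟩
  have hθ : ∀ x ∈ interior Ω, (θ : Eucl k → ℝ) =ᶠ[𝓝 x] 1 := by
    intro x hx
    refine θ.eventuallyEq_one_of_mem_ball ?_
    exact Metric.ball_subset_ball (le_max_left _ _) (hR (interior_subset hx))
  set v : ℝ := volume.real (Metric.closedBall (0 : Eucl k) 1) with hv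
  have key : ∀ ε > 0, |∫ x in interior Ω, divergence W x| ≤
      ε * (B * (1 + M * C) * 2 ^ (2 * k + 1) * v) := by
    intro ε hε
    obtain ⟨F, c, r, hr, hcov, hsum⟩ :=
      exists_finite_cover_balls_of_hausdorffMeasure_eq_zero hsing (2 * k) hH hε
    let ψ' : ℕ → Eucl k → ℝ := fun i x => ψ ((r i)⁻¹ • (x - c i))
    let S : Eucl k → ℝ := fun x => ∑ i ∈ F, ψ' i x
    let χ : Eucl k → ℝ := fun x => θ x * (1 - Real.smoothTransition (S x))
    have hψ'd : ∀ i, ContDiff ℝ 1 (ψ' i) := fun i =>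
      hψ.comp ((contDiff_id.sub contDiff_const).const_smul _)
    have hSd : ContDiff ℝ 1 S := ContDiff.sum fun i _ => hψ'd i
    have hχd : ContDiff ℝ 1 χ := (θ.contDiff).mul
      (contDiff_const.sub (Real.smoothTransition.contDiff.comp hSd))
    have hχc : HasCompactSupport χ := θ.hasCompactSupport.mul_right
    have hdisj : Disjoint (tsupport χ) (singularBoundary Ω) := by
      rw [disjoint_right]
      intro x hx
      obtain ⟨i, hi, hxi⟩ := mem_iUnion₂.1 (hcov hx)
      rw [notMem_tsupport_iff_eventuallyEq]
      filter_upwards [Metric.isOpen_ball.mem_nhds hxi] with y hy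
      have h1 : ψ' i y = 1 := by
        refine hψ1 _ ?_
        rw [norm_smul, norm_inv, Real.norm_eq_abs, abs_of_pos (hr i hi).1,
          inv_mul_le_iff₀ (hr i hi).1, mul_one]
        exact (mem_ball_iff_norm.1 hy).le
      have h2 : 1 ≤ S y := h1.symm.le.trans
        (Finset.single_le_sum (f := fun i => ψ' i y) (fun j _ => hψ0 _) hi)
      simp [χ, Real.smoothTransition.one_of_one_le h2]
    have h0 := hW.integral_cutDiv_eq_zero hΩ.isCompact hχd hχc hdisj
    let D : ℕ → Set (Eucl k) := fun i => Metric.closedBall (c i) (2 * r i)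
    have hout : ∀ i ∈ F, ∀ x, x ∉ D i → ψ' i x = 0 ∧ fderiv ℝ (ψ' i) x = 0 := by
      intro i hi x hx
      have hri := (hr i hi).1
      have h1 : 2 < ‖(r i)⁻¹ • (x - c i)‖ := by
        rw [norm_smul, norm_inv, Real.norm_eq_abs, abs_of_pos hri,
          lt_inv_mul_iff₀ hri, mul_comm]
        simpa [D, dist_eq_norm] using hx
      refine ⟨(hψ2 _ h1).1, ?_⟩
      have h2 : HasFDerivAt (fun x : Eucl k => (r i)⁻¹ • (x - c i))
          ((r i)⁻¹ • ContinuousLinearMap.id ℝ (Eucl k)) x :=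
        ((hasFDerivAt_id x).sub_const (c i)).fun_const_smul (r i)⁻¹
      have h3 := ((hψ.differentiable one_ne_zero _).hasFDerivAt.comp x h2).fderiv
      rw [(hψ2 _ h1).2, ContinuousLinearMap.zero_comp] at h3
      exact h3
    have hder : ∀ i ∈ F, ∀ x, ‖fderiv ℝ (ψ' i) x‖ ≤ C * (r i)⁻¹ := by
      intro i hi x
      have hri := (hr i hi).1
      have h2 : HasFDerivAt (fun x : Eucl k => (r i)⁻¹ • (x - c i))
          ((r i)⁻¹ • ContinuousLinearMap.id ℝ (Eucl k)) x :=
        ((hasFDerivAt_id x).sub_const (c i)).fun_const_smul (r i)⁻¹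
      have h3 := ((hψ.differentiable one_ne_zero _).hasFDerivAt.comp x h2).fderiv
      rw [show ψ' i = ψ ∘ fun x : Eucl k => (r i)⁻¹ • (x - c i) from rfl, h3]
      refine (ContinuousLinearMap.opNorm_comp_le _ _).trans
        (mul_le_mul (hC _) ?_ (norm_nonneg _) hC0)
      rw [norm_smul, norm_inv, Real.norm_eq_abs, abs_of_pos hri]
      exact mul_le_of_le_one_right (by positivity) ContinuousLinearMap.norm_id_le
    have hpt : ∀ x ∈ interior Ω, |divergence W x - cutDiv W χ x| ≤
        ∑ i ∈ F, (D i).indicator (fun _ => B * (1 + M * C) * (r i)⁻¹) x := by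
      intro x hx
      set T : Eucl k → ℝ := fun x => Real.smoothTransition (S x) with hT
      have hTd : HasFDerivAt T (deriv Real.smoothTransition (S x) • fderiv ℝ S x) x :=
        (Real.smoothTransition.contDiff.differentiable (n := 1) one_ne_zero
          _).hasDerivAt.comp_hasFDerivAt x (hSd.differentiable one_ne_zero x).hasFDerivAt
      have h1 : χ =ᶠ[𝓝 x] fun y => 1 - T y := by
        filter_upwards [hθ x hx] with y hy
        simp [χ, hy, T]
      have h2 : fderiv ℝ χ x = -(deriv Real.smoothTransition (S x) • fderiv ℝ S x) := by
        rw [h1.fderiv_eq, (hTd.const_sub 1).fderiv]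
      have h3 : divergence W x - cutDiv W χ x = cutDiv W T x := by
        unfold cutDiv
        rw [h1.eq_of_nhds, h2, hTd.fderiv]
        simp
        ring
      rw [h3]
      refine (hW.abs_cutDiv_le hx).trans ?_
      rw [← add_mul]
      have h4 : |T x| ≤ ∑ i ∈ F, (D i).indicator (fun _ => (r i)⁻¹) x := by
        have hnn : ∀ i ∈ F, 0 ≤ (D i).indicator (fun _ => (r i)⁻¹) x := fun i hi =>
          indicator_nonneg (fun _ _ => inv_nonneg.2 (hr i hi).1.le) _
        by_cases hex : ∃ i ∈ F, x ∈ D i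
        · obtain ⟨i, hi, hxi⟩ := hex
          have h5 : (1 : ℝ) ≤ (D i).indicator (fun _ => (r i)⁻¹) x := by
            rw [indicator_of_mem hxi]
            exact (one_le_inv₀ (hr i hi).1).2 (hr i hi).2
          refine le_trans ?_ (h5.trans (Finset.single_le_sum hnn hi))
          rw [abs_of_nonneg (Real.smoothTransition.nonneg _)]
          exact Real.smoothTransition.le_one _
        · push Not at hex
          have : S x = 0 := Finset.sum_eq_zero fun i hi => (hout i hi x (hex i hi)).1
          simp only [hT, this, Real.smoothTransition.zero, abs_zero]
          exact Finset.sum_nonneg hnn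
      have h5 : ‖fderiv ℝ T x‖ ≤ M * ∑ i ∈ F, (D i).indicator (fun _ => C * (r i)⁻¹) x := by
        rw [hTd.fderiv, norm_smul]
        refine mul_le_mul (hM _) ?_ (norm_nonneg _) hM0
        rw [fderiv_fun_sum fun i _ => (hψ'd i).differentiable one_ne_zero x]
        refine (norm_sum_le _ _).trans (Finset.sum_le_sum fun i hi => ?_)
        by_cases hxi : x ∈ D i
        · rw [indicator_of_mem hxi]; exact hder i hi x
        · rw [indicator_of_notMem hxi, (hout i hi x hxi).2, norm_zero]
      calc (|T x| + ‖fderiv ℝ T x‖) * B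
          ≤ (∑ i ∈ F, (D i).indicator (fun _ => (r i)⁻¹) x +
            M * ∑ i ∈ F, (D i).indicator (fun _ => C * (r i)⁻¹) x) * B := by gcongr
        _ = _ := by
          rw [Finset.mul_sum, ← Finset.sum_add_distrib, Finset.sum_mul]
          refine Finset.sum_congr rfl fun i _ => ?_
          by_cases hxi : x ∈ D i
          · simp only [indicator_of_mem hxi]; ring
          · simp only [indicator_of_notMem hxi]; ring
    have hDm : ∀ i, MeasurableSet (D i) := fun i => Metric.isClosed_closedBall.measurableSet
    have hint : ∀ i, Integrable ((D i).indicator fun _ => B * (1 + M * C) * (r i)⁻¹)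
        (volume : Measure (Eucl k)) := fun i =>
      (integrable_indicator_iff (hDm i)).2
        (integrableOn_const (isCompact_closedBall _ _).measure_lt_top.ne)
    have hdivint : IntegrableOn (divergence W) (interior Ω) :=
      integrableOn_of_continuousOn_of_abs_le isOpen_interior
        (volume_interior_ne_top hΩ.isCompact) (continuousOn_divergence hW.contDiffOn)
        hW.abs_divergence_le
    have h6 : ∫ x in interior Ω, divergence W x =
        ∫ x in interior Ω, (divergence W x - cutDiv W χ x) := by
      rw [integral_sub hdivint (hW.integrableOn_cutDiv hΩ.isCompact hχd hχc), h0, sub_zero]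
    have hFint : Integrable (fun x => ∑ i ∈ F, (D i).indicator
        (fun _ => B * (1 + M * C) * (r i)⁻¹) x) (volume : Measure (Eucl k)) :=
      integrable_finsetSum _ fun i _ => hint i
    have hFnn : ∀ x, 0 ≤ ∑ i ∈ F, (D i).indicator (fun _ => B * (1 + M * C) * (r i)⁻¹) x :=
      fun x => Finset.sum_nonneg fun i hi => indicator_nonneg (fun _ _ => by
        have := (hr i hi).1
        positivity) _
    rw [h6, ← Real.norm_eq_abs]
    calc _ ≤ ∫ x in interior Ω, ∑ i ∈ F, (D i).indicator
            (fun _ => B * (1 + M * C) * (r i)⁻¹) x :=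
          norm_integral_le_of_norm_le hFint.integrableOn
            ((ae_restrict_iff' isOpen_interior.measurableSet).2 (Eventually.of_forall hpt))
      _ ≤ ∫ x, ∑ i ∈ F, (D i).indicator (fun _ => B * (1 + M * C) * (r i)⁻¹) x :=
          setIntegral_le_integral hFint (Eventually.of_forall hFnn)
      _ = ∑ i ∈ F, volume.real (D i) * (B * (1 + M * C) * (r i)⁻¹) := by
          rw [integral_finsetSum _ fun i _ => hint i]
          refine Finset.sum_congr rfl fun i _ => ?_
          rw [integral_indicator_const _ (hDm i), smul_eq_mul]
      _ = ∑ i ∈ F, r i ^ (2 * k) * (B * (1 + M * C) * 2 ^ (2 * k + 1) * v) := by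
          refine Finset.sum_congr rfl fun i hi => ?_
          have hri := (hr i hi).1
          rw [show volume.real (D i) = (2 * r i) ^ (2 * k + 1) * v by
            rw [hv, Measure.addHaar_real_closedBall' _ _ (by positivity)]
            simp, mul_pow, pow_succ (r i)]
          field_simp
      _ ≤ ε * (B * (1 + M * C) * 2 ^ (2 * k + 1) * v) := by
          rw [← Finset.sum_mul]
          exact mul_le_mul_of_nonneg_right hsum (by positivity)
  by_contra hne
  have hpos : 0 < |∫ x in interior Ω, divergence W x| := abs_pos.2 hne
  set K := B * (1 + M * C) * 2 ^ (2 * k + 1) * v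
  have hK : 0 ≤ K := by positivity
  have := key (|∫ x in interior Ω, divergence W x| / (K + 1)) (by positivity)
  rw [div_mul_eq_mul_div, le_div_iff₀ (by positivity)] at this
  nlinarith

/-- Near a smooth point the boundary lies in tubes of arbitrarily small volume; the remaining points
form a set of Hausdorff measure zero. -/
theorem volume_frontier_eq_zero {Ω : Set (Eucl k)} (hΩ : IsCompactDomain Ω) :
    volume (frontier Ω) = 0 := by
  have hcl := hΩ.isCompact.isClosed
  have hsing : IsCompact (singularBoundary Ω) :=
    hΩ.isCompact.of_isClosed_subset (isClosed_singularBoundary hcl)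
      fun x hx => hcl.frontier_subset hx.1
  have hH : Measure.hausdorffMeasure ((2 * k : ℕ) : ℝ) (singularBoundary Ω) = 0 := by
    rw [Nat.cast_mul, Nat.cast_ofNat]; exact hΩ.piecewise_smooth
  have h1 : volume (singularBoundary Ω) = 0 := by
    have h : Measure.hausdorffMeasure ((Module.finrank ℝ (Eucl k) : ℕ) : ℝ)
        (singularBoundary Ω) = 0 := by
      refine le_antisymm ((Measure.hausdorffMeasure_mono ?_ _).trans_eq hH) zero_le
      simp
    have h' : Measure.IsAddHaarMeasure (Measure.hausdorffMeasure
      ((Module.finrank ℝ (Eucl k) : ℕ) : ℝ) : Measure (Eucl k)) := inferInstance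
    exact (Measure.absolutelyContinuous_isAddHaarMeasure volume _) h
  have h2 : volume (frontier Ω \ singularBoundary Ω) = 0 := by
    refine measure_null_of_locally_null _ fun x hx => ?_
    obtain ⟨U, ρ, hρ⟩ : IsSmoothBoundaryPoint Ω x := by
      by_contra h
      exact hx.2 ⟨hx.1, h⟩
    obtain ⟨N, hN, C, hC0, hC⟩ := exists_volume_tube_le
      ((hρ.contDiffAt hρ.mem).hasStrictFDerivAt (by simp)) hρ.regular
    refine ⟨(frontier Ω \ singularBoundary Ω) ∩ (N ∩ U),
      inter_mem self_mem_nhdsWithin (mem_nhdsWithin_of_mem_nhds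
        (inter_mem hN (hρ.isOpen.mem_nhds hρ.mem))), ?_⟩
    have h := hC 0 le_rfl
    rw [mul_zero, ENNReal.ofReal_zero, nonpos_iff_eq_zero] at h
    refine measure_mono_null (fun y hy => ?_) h
    have := hρ.eq_zero_of_mem_frontier hcl hy.2.2 hy.1.1
    exact ⟨hy.2.1, by simp [this], this.le⟩
  exact measure_mono_null (fun x hx => by
    by_cases h : x ∈ singularBoundary Ω
    · exact Or.inl h
    · exact Or.inr ⟨hx, h⟩) (measure_union_null h1 h2)

/-! ### Integration by parts against closed Dirichlet forms -/

/-- `starCoord`, as a continuous linear functional of the form. -/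
def starCoordL (I : Fin k → Fin (2 * k + 1)) : (Eucl k) [⋀^Fin (k + 1)]→L[ℝ] ℝ →L[ℝ] ℝ :=
  ∑ A : Fin (k + 1) → Fin (2 * k + 1),
    volForm k (fun j => stdVec (Sum.elim I A ((splitStar k).symm j))) •
      ContinuousAlternatingMap.apply ℝ (Eucl k) ℝ (fun j => stdVec (A j))

theorem starCoordL_apply (I : Fin k → Fin (2 * k + 1)) (a : (Eucl k) [⋀^Fin (k + 1)]→L[ℝ] ℝ) :
    starCoordL I a = starCoord a.toAlternatingMap I := by
  simp [starCoordL, starCoord, sum_apply]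

theorem norm_stdVec (i : Fin (2 * k + 1)) : ‖(stdVec i : Eucl k)‖ = 1 := by simp

/-- A sum over tuples vanishes if the partial sums over the values in one slot do. -/
theorem sum_eq_zero_of_sum_update_eq_zero {n : ℕ} (m : Fin k) (F : (Fin k → Fin (n + 1)) → ℝ)
    (h : ∀ I, ∑ i, F (Function.update I m i) = 0) : ∑ I, F I = 0 := by
  rw [← (Equiv.funSplitAt m (Fin (n + 1))).symm.sum_comp, Fintype.sum_prod_type_right]
  refine Finset.sum_eq_zero fun r _ => ?_
  rw [← h ((Equiv.funSplitAt m (Fin (n + 1))).symm (0, r))]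
  refine Finset.sum_congr rfl fun i _ => congrArg F ?_
  ext1 j
  by_cases hj : j = m
  · subst hj; simp
  · simp [hj]

theorem divergence_sum_smul_stdVec {ι : Type*} [Fintype ι] {c : ι → Eucl k → ℝ}
    {q : ι → Fin (2 * k + 1)} {x : Eucl k} (hc : ∀ i, DifferentiableAt ℝ (c i) x) :
    divergence (fun y => ∑ i, c i y • stdVec (q i)) x = ∑ i, fderiv ℝ (c i) x (stdVec (q i)) := by
  have h : fderiv ℝ (fun y => ∑ i, c i y • (stdVec (q i) : Eucl k)) x =
      ∑ i, (fderiv ℝ (c i) x).smulRight (stdVec (q i)) :=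
    (HasFDerivAt.fun_sum fun i _ => (hc i).hasFDerivAt.smul_const (stdVec (q i))).fderiv
  unfold divergence
  rw [h]
  simp only [sum_apply, ContinuousLinearMap.smulRight_apply]
  have h2 : ∀ l : Fin (2 * k + 1), (∑ i, (fderiv ℝ (c i) x) (stdVec l) • (stdVec (q i) : Eucl k)) l
      = ∑ i, (fderiv ℝ (c i) x) (stdVec l) * if l = q i then 1 else 0 := by
    intro l
    simp [Pi.single_apply]
  rw [Finset.sum_congr rfl fun l _ => h2 l, Finset.sum_comm]
  simp

section IBP

variable {Ω : Set (Eucl k)} {α : Form k (k + 1)} (w : Fin k → Eucl k → Eucl k) (m : Fin k)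
  (Ψ : ContinuousMultilinearMap ℝ (fun _ : Fin k => Eucl k) ℝ)

theorem contDiffOn_starCoord (hα : IsClosedDirichlet Ω α) (I : Fin k → Fin (2 * k + 1)) :
    ContDiffOn ℝ ∞ (fun x => starCoord (α x).toAlternatingMap I) Ω := by
  have := (starCoordL I).contDiff.comp_contDiffOn (n := ∞) hα.smooth
  exact this.congr fun x _ => (starCoordL_apply I (α x)).symm

theorem exists_abs_starCoord_le (hΩ : IsCompact Ω) (hα : IsClosedDirichlet Ω α) :
    ∃ A : ℝ, 0 ≤ A ∧ ∀ I, ∀ x ∈ Ω, |starCoord (α x).toAlternatingMap I| ≤ A := by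
  have h1 : ∀ I, ∃ A : ℝ, ∀ x ∈ Ω, |starCoord (α x).toAlternatingMap I| ≤ A := fun I =>
    hΩ.exists_bound_of_continuousOn (contDiffOn_starCoord hα I).continuousOn
  choose A hA using h1
  refine ⟨∑ I, |A I|, Finset.sum_nonneg fun _ _ => abs_nonneg _, fun I x hx => ?_⟩
  exact (hA I x hx).trans ((le_abs_self _).trans
    (Finset.single_le_sum (f := fun I => |A I|) (fun _ _ => abs_nonneg _) (Finset.mem_univ I)))

/-- The closedness of the form, as the vanishing divergence of its star. -/
theorem sum_fderiv_starCoord_update_eq_zero (hα : IsClosedDirichlet Ω α) {x : Eucl k}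
    (hx : x ∈ interior Ω) (I : Fin k → Fin (2 * k + 1)) :
    ∑ i, fderiv ℝ (fun y => starCoord (α y).toAlternatingMap (Function.update I m i)) x
      (stdVec i) = 0 := by
  have hd : DifferentiableAt ℝ α x :=
    ((hα.smooth.contDiffAt (mem_interior_iff_mem_nhds.1 hx)).differentiableAt (by simp))
  have h1 : ∀ J v, fderiv ℝ (fun y => starCoord (α y).toAlternatingMap J) x v =
      starCoord (fderiv ℝ α x v).toAlternatingMap J := by
    intro J v
    simp_rw [← starCoordL_apply]
    rw [show (fun y => starCoordL J (α y)) = starCoordL J ∘ α from rfl,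
      ((starCoordL J).hasFDerivAt.comp x hd.hasFDerivAt).fderiv]
    rfl
  simp_rw [h1]
  refine sum_starCoord_update_eq_zero (fun v => (fderiv ℝ α x v).toAlternatingMap) (fun v => ?_) I m
  have h2 := congrArg (fun a => a v) (hα.closed x hx)
  rw [extDeriv_apply hd] at h2
  rw [← show (0 : (Eucl k) [⋀^Fin (k + 2)]→L[ℝ] ℝ) v = 0 from rfl, ← h2]
  refine Finset.sum_congr rfl fun p _ => ?_
  rw [zsmul_eq_mul]
  push_cast
  congr 1
  rw [show (fun y => α y (p.removeNth v)) =
    ContinuousAlternatingMap.apply ℝ (Eucl k) ℝ (p.removeNth v) ∘ α from rfl,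
    ((ContinuousAlternatingMap.apply ℝ (Eucl k) ℝ (p.removeNth v)).hasFDerivAt.comp x
    hd.hasFDerivAt).fderiv]
  rfl

/-- The arguments `Dw_j e_{I j}`, with the one in the slot `m` replaced by `w_m`. -/
def slotArgs (I : Fin k → Fin (2 * k + 1)) (x : Eucl k) : Fin k → Eucl k :=
  Function.update (fun j => fderiv ℝ (w j) x (stdVec (I j))) m (w m x)

/-- A primitive of the integrand in `integral_sum_starCoord_mul_fderiv_eq_zero`: a vector field of
which it is the divergence. -/
def primitiveField (α : Form k (k + 1)) (x : Eucl k) : Eucl k :=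
  ∑ I : Fin k → Fin (2 * k + 1),
    (starCoord (α x).toAlternatingMap I * Ψ (slotArgs w m I x)) • stdVec (I m)

variable {w}

theorem hasFDerivAt_slotArgs {x : Eucl k} (hw : ∀ j, ContDiffAt ℝ 2 (w j) x)
    (I : Fin k → Fin (2 * k + 1)) (j : Fin k) :
    HasFDerivAt (fun y => slotArgs w m I y j)
      (if j = m then fderiv ℝ (w m) x else
        (fderiv ℝ (fderiv ℝ (w j)) x).flip (stdVec (I j))) x := by
  split_ifs with hj
  · subst hj
    simp only [slotArgs, Function.update_self]
    exact ((hw j).differentiableAt (by simp)).hasFDerivAt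
  · simp only [slotArgs, Function.update_of_ne hj]
    have h := (((hw j).fderiv_right (m := 1) (by norm_num)).differentiableAt
      one_ne_zero).hasFDerivAt
    exact h.clm_apply (hasFDerivAt_const (stdVec (I j)) x) |>.congr_fderiv (by ext; simp)

theorem contDiffAt_slotArgs {x : Eucl k} (hw : ∀ j, ContDiffAt ℝ 2 (w j) x)
    (I : Fin k → Fin (2 * k + 1)) : ContDiffAt ℝ 1 (fun y => slotArgs w m I y) x := by
  rw [contDiffAt_pi]
  intro j
  by_cases hj : j = m
  · subst hj
    simp only [slotArgs, Function.update_self]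
    exact (hw j).of_le (by norm_num)
  · simp only [slotArgs, Function.update_of_ne hj]
    exact ((hw j).fderiv_right (m := 1) (by norm_num)).clm_apply contDiffAt_const

/-- Derivatives of the star coordinates cancel because `α` is closed, and second derivatives of the
`w_j` because those are symmetric while the star coordinates are antisymmetric. -/
theorem divergence_primitiveField (hα : IsClosedDirichlet Ω α) {x : Eucl k}
    (hx : x ∈ interior Ω) (hw : ∀ j, ContDiffAt ℝ 2 (w j) x) :
    divergence (primitiveField w m Ψ α) x = ∑ I : Fin k → Fin (2 * k + 1),
      starCoord (α x).toAlternatingMap I * Ψ (fun j => fderiv ℝ (w j) x (stdVec (I j))) := by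
  have hM : ∀ I, HasFDerivAt (fun y => starCoord (α y).toAlternatingMap I)
      (fderiv ℝ (fun y => starCoord (α y).toAlternatingMap I) x) x := fun I =>
    (((contDiffOn_starCoord hα I).contDiffAt (mem_interior_iff_mem_nhds.1 hx)).differentiableAt
      (by simp)).hasFDerivAt
  have hu : ∀ I, HasFDerivAt (fun y => Ψ (slotArgs w m I y)) _ x := fun I =>
    HasFDerivAt.multilinear_comp (f := Ψ) (hasFDerivAt_slotArgs m hw I)
  have hprod : ∀ I, HasFDerivAt (fun y => starCoord (α y).toAlternatingMap I *
    Ψ (slotArgs w m I y)) _ x := fun I => (hM I).mul (hu I)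
  unfold primitiveField
  rw [divergence_sum_smul_stdVec fun I => (hprod I).differentiableAt]
  have h1 : ∀ I, fderiv ℝ (fun y => starCoord (α y).toAlternatingMap I *
      Ψ (slotArgs w m I y)) x (stdVec (I m)) =
      starCoord (α x).toAlternatingMap I * Ψ (fun j => fderiv ℝ (w j) x (stdVec (I j))) +
      (∑ j ∈ Finset.univ.erase m, starCoord (α x).toAlternatingMap I *
        Ψ (Function.update (slotArgs w m I x) j
          (fderiv ℝ (fderiv ℝ (w j)) x (stdVec (I m)) (stdVec (I j)))) +
      Ψ (slotArgs w m I x) *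
        fderiv ℝ (fun y => starCoord (α y).toAlternatingMap I) x (stdVec (I m))) := by
    intro I
    rw [(hprod I).fderiv]
    simp only [add_apply, smul_apply, smul_eq_mul, sum_apply, ContinuousLinearMap.comp_apply,
      ContinuousMultilinearMap.toContinuousLinearMap_apply]
    rw [← Finset.add_sum_erase _ _ (Finset.mem_univ m), mul_add, Finset.mul_sum, add_assoc]
    refine congrArg₂ _ ?_ (congrArg₂ _ (Finset.sum_congr rfl fun j hj => ?_) rfl)
    · rw [if_pos rfl]
      simp only [slotArgs, Function.update_idem]
      rw [Function.update_eq_self_iff.2 rfl]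
    · rw [if_neg (Finset.ne_of_mem_erase hj)]
      rfl
  rw [Finset.sum_congr rfl fun I _ => h1 I, Finset.sum_add_distrib, Finset.sum_add_distrib]
  have h2 : ∑ I : Fin k → Fin (2 * k + 1), Ψ (slotArgs w m I x) *
      fderiv ℝ (fun y => starCoord (α y).toAlternatingMap I) x (stdVec (I m)) = 0 := by
    refine sum_eq_zero_of_sum_update_eq_zero m _ fun I => ?_
    have : ∀ i, slotArgs w m (Function.update I m i) x = slotArgs w m I x := by
      intro i
      ext1 j
      by_cases hj : j = m
      · subst hj; simp [slotArgs]
      · simp [slotArgs, hj]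
    simp only [this, Function.update_self]
    rw [← Finset.mul_sum, sum_fderiv_starCoord_update_eq_zero m hα hx, mul_zero]
  have h3 : ∑ I : Fin k → Fin (2 * k + 1), ∑ j ∈ Finset.univ.erase m,
      starCoord (α x).toAlternatingMap I * Ψ (Function.update (slotArgs w m I x) j
          (fderiv ℝ (fderiv ℝ (w j)) x (stdVec (I m)) (stdVec (I j)))) = 0 := by
    rw [Finset.sum_comm]
    refine Finset.sum_eq_zero fun j hj => ?_
    have hjm := Finset.ne_of_mem_erase hj
    -- The second derivatives are symmetric, the coordinates of the form antisymmetric.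
    have h4 := (Equiv.arrowCongr (Equiv.swap m j) (Equiv.refl (Fin (2 * k + 1)))).sum_comp
      (fun I => starCoord (α x).toAlternatingMap I * Ψ (Function.update (slotArgs w m I x) j
          (fderiv ℝ (fderiv ℝ (w j)) x (stdVec (I m)) (stdVec (I j)))))
    rw [← neg_eq_self, ← Finset.sum_neg_distrib, ← h4]
    refine Finset.sum_congr rfl fun I _ => ?_
    change _ = starCoord _ (I ∘ Equiv.swap m j) * Ψ (Function.update (slotArgs w m
      (I ∘ Equiv.swap m j) x) j (fderiv ℝ (fderiv ℝ (w j)) x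
      (stdVec ((I ∘ Equiv.swap m j) m)) (stdVec ((I ∘ Equiv.swap m j) j))))
    rw [starCoord_comp_swap _ _ hjm.symm, neg_mul]
    congr 3
    simp only [Function.comp_apply, Equiv.swap_apply_left, Equiv.swap_apply_right]
    have hsymm : IsSymmSndFDerivAt ℝ (w j) x :=
      (hw j).isSymmSndFDerivAt (by simp)
    rw [hsymm.eq (stdVec (I m)) (stdVec (I j))]
    ext1 l
    by_cases hl : l = j
    · subst hl; simp
    · rw [Function.update_of_ne hl, Function.update_of_ne hl]
      by_cases hlm : l = m
      · subst hlm; simp [slotArgs]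
      · simp [slotArgs, hlm, Equiv.swap_apply_of_ne_of_ne hlm hl]
  rw [h2, h3, add_zero, add_zero]

/-- The Dirichlet condition makes the star coordinates tangent to the boundary in every slot, hence
the primitive is tangent too. -/
theorem isTangentField_primitiveField (hΩ : IsCompact Ω) (hα : IsClosedDirichlet Ω α)
    (hw : ∀ j, ContDiffOn ℝ 2 (w j) (interior Ω)) {b : ℝ}
    (hwb : ∀ x ∈ interior Ω, ‖w m x‖ ≤ b)
    (hDw : ∀ j, ∀ x ∈ interior Ω, ‖fderiv ℝ (w j) x‖ ≤ b) :
    ∃ B, IsTangentField Ω (primitiveField w m Ψ α) B := by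
  obtain ⟨A, hA0, hA⟩ := exists_abs_starCoord_le hΩ hα
  have hwat : ∀ x ∈ interior Ω, ∀ j, ContDiffAt ℝ 2 (w j) x := fun x hx j =>
    (hw j).contDiffAt (isOpen_interior.mem_nhds hx)
  have hDe : ∀ j, ∀ x ∈ interior Ω, ∀ i, ‖fderiv ℝ (w j) x (stdVec i)‖ ≤ b := fun j x hx i =>
    ((fderiv ℝ (w j) x).le_opNorm _).trans (by rw [norm_stdVec, mul_one]; exact hDw j x hx)
  have hslot : ∀ x ∈ interior Ω, ∀ I, ‖Ψ (slotArgs w m I x)‖ ≤ ‖Ψ‖ * b ^ k := by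
    intro x hx I
    have hle : ‖slotArgs w m I x‖ ≤ b := by
      rw [pi_norm_le_iff_of_nonneg ((norm_nonneg _).trans (hwb x hx))]
      intro j
      by_cases hj : j = m
      · subst hj; simpa [slotArgs] using hwb x hx
      · simpa [slotArgs, hj] using hDe j x hx (I j)
    simpa using Ψ.le_opNorm_mul_pow_of_le hle
  have hfull : ∀ x ∈ interior Ω, ∀ I : Fin k → Fin (2 * k + 1),
      ‖Ψ (fun j => fderiv ℝ (w j) x (stdVec (I j)))‖ ≤ ‖Ψ‖ * b ^ k := by
    intro x hx I
    have hle : ‖fun j => fderiv ℝ (w j) x (stdVec (I j))‖ ≤ b := by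
      rw [pi_norm_le_iff_of_nonneg ((norm_nonneg _).trans (hwb x hx))]
      exact fun j => hDe j x hx (I j)
    simpa using Ψ.le_opNorm_mul_pow_of_le hle
  refine ⟨∑ I : Fin k → Fin (2 * k + 1), A * (‖Ψ‖ * b ^ k), ?_, fun x hx => ?_, fun x hx => ?_,
    fun x hx U ρ hρ => ?_⟩
  · intro x hx
    refine ContDiffAt.contDiffWithinAt ?_
    unfold primitiveField
    refine ContDiffAt.sum fun I _ => ?_
    have hc : ContDiffAt ℝ 1 (fun y => starCoord (α y).toAlternatingMap I) x :=
      ((contDiffOn_starCoord hα I).contDiffAt (mem_interior_iff_mem_nhds.1 hx)).of_le (by simp)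
    exact (hc.mul (Ψ.contDiff.contDiffAt.comp x (contDiffAt_slotArgs m (hwat x hx) I))).smul
      contDiffAt_const
  · refine (norm_sum_le _ _).trans (Finset.sum_le_sum fun I _ => ?_)
    rw [norm_smul, norm_stdVec, mul_one, norm_mul]
    exact mul_le_mul (hA I x (interior_subset hx)) (hslot x hx I) (norm_nonneg _) hA0
  · rw [divergence_primitiveField m Ψ hα hx (hwat x hx)]
    refine (Finset.abs_sum_le_sum_abs _ _).trans (Finset.sum_le_sum fun I _ => ?_)
    rw [abs_mul]
    exact mul_le_mul (hA I x (interior_subset hx)) (hfull x hx I) (abs_nonneg _) hA0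
  · have hρc : ContinuousAt (fderiv ℝ ρ) x :=
      ((hρ.contDiffAt hρ.mem).fderiv_right (m := 0) (by simp)).continuousAt
    -- The normal components of the star of the form tend to zero at the boundary.
    have h1 : ∀ I, Tendsto (fun y => ∑ i, fderiv ℝ ρ y (stdVec i) *
        starCoord (α y).toAlternatingMap (Function.update I m i)) (𝓝[interior Ω] x) (𝓝 0) := by
      intro I
      have hlim : ∑ i, fderiv ℝ ρ x (stdVec i) *
          starCoord (α x).toAlternatingMap (Function.update I m i) = 0 := by
        have hg : ∀ v, inner ℝ ((InnerProductSpace.toDual ℝ (Eucl k)).symm (fderiv ℝ ρ x)) v =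
            fderiv ℝ ρ x v := fun v => InnerProductSpace.toDual_symm_apply
        rw [← sum_coord_mul_starCoord_update_eq_zero (α x).toAlternatingMap
          ((InnerProductSpace.toDual ℝ (Eucl k)).symm (fderiv ℝ ρ x))
          (by simpa using hρ.regular) (fun V hV => hα.dirichlet x hx U ρ hρ V
            fun i => by rw [← hg]; exact hV i) I m]
        refine Finset.sum_congr rfl fun i _ => ?_
        rw [← hg, EuclideanSpace.inner_single_right]
        simp
      rw [← hlim]
      refine tendsto_finsetSum _ fun i _ => Tendsto.mul ?_ ?_
      · exact ((hρc.clm_apply continuousAt_const).tendsto).mono_left nhdsWithin_le_nhds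
      · exact ((contDiffOn_starCoord hα _).continuousOn.continuousWithinAt
          (hΩ.isClosed.frontier_subset hx)).mono interior_subset
    have h2 : ∀ I : Fin k → Fin (2 * k + 1), Tendsto (fun y => ∑ i, fderiv ℝ ρ y (stdVec i) *
        starCoord (α y).toAlternatingMap (Function.update I m i) * Ψ (slotArgs w m I y))
        (𝓝[interior Ω] x) (𝓝 0) := by
      intro I
      simp_rw [← Finset.sum_mul]
      refine (h1 I).zero_mul_isBoundedUnder_le ?_
      refine isBoundedUnder_of_eventually_le (a := ‖Ψ‖ * b ^ k) ?_
      filter_upwards [self_mem_nhdsWithin] with y hy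
      exact hslot y hy I
    have h3 := tendsto_finsetSum (Finset.univ : Finset (Fin k → Fin (2 * k + 1)))
      fun I _ => h2 I
    rw [Finset.sum_const_zero] at h3
    have h4 : ∀ y, fderiv ℝ ρ y (primitiveField w m Ψ α y) = (2 * k + 1 : ℝ)⁻¹ *
        ∑ I : Fin k → Fin (2 * k + 1), ∑ i, fderiv ℝ ρ y (stdVec i) *
        starCoord (α y).toAlternatingMap (Function.update I m i) * Ψ (slotArgs w m I y) := by
      intro y
      have hs : ∀ I i, slotArgs w m (Function.update I m i) y = slotArgs w m I y := by
        intro I i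
        ext1 j
        by_cases hj : j = m
        · subst hj; simp [slotArgs]
        · simp [slotArgs, hj]
      let F : (Fin k → Fin (2 * k + 1)) → ℝ := fun I => fderiv ℝ ρ y (stdVec (I m)) *
        starCoord (α y).toAlternatingMap I * Ψ (slotArgs w m I y)
      let G : (Fin k → Fin (2 * k + 1)) → ℝ := fun I =>
        F I - (2 * k + 1 : ℝ)⁻¹ * ∑ i, F (Function.update I m i)
      have hG := sum_eq_zero_of_sum_update_eq_zero m G fun I => by
        simp only [G, Function.update_idem, Finset.sum_sub_distrib, Finset.sum_const,
          Finset.card_univ, Fintype.card_fin, nsmul_eq_mul]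
        push_cast
        field_simp
        ring
      simp only [G, Finset.sum_sub_distrib, ← Finset.mul_sum, sub_eq_zero] at hG
      have hF : ∀ I i, F (Function.update I m i) = fderiv ℝ ρ y (stdVec i) *
          starCoord (α y).toAlternatingMap (Function.update I m i) * Ψ (slotArgs w m I y) := by
        intro I i
        simp only [F, hs, Function.update_self]
      simp_rw [hF] at hG
      rw [← hG, primitiveField, map_sum]
      refine Finset.sum_congr rfl fun I _ => ?_
      rw [map_smul, smul_eq_mul]
      simp only [F]
      ring
    simp_rw [h4]
    simpa using h3.const_mul (2 * k + 1 : ℝ)⁻¹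

/-- Integration by parts: the pairing of a closed Dirichlet form with an exact form
`dw_1 ∧ ... ∧ dw_k` vanishes. -/
theorem integral_sum_starCoord_mul_fderiv_eq_zero (hΩ : IsCompactDomain Ω)
    (hα : IsClosedDirichlet Ω α) (hw : ∀ j, ContDiffOn ℝ 2 (w j) (interior Ω)) {b : ℝ}
    (hwb : ∀ x ∈ interior Ω, ‖w m x‖ ≤ b)
    (hDw : ∀ j, ∀ x ∈ interior Ω, ‖fderiv ℝ (w j) x‖ ≤ b) :
    IntegrableOn (fun x => ∑ I : Fin k → Fin (2 * k + 1), starCoord (α x).toAlternatingMap I *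
        Ψ (fun j => fderiv ℝ (w j) x (stdVec (I j)))) (interior Ω) ∧
    ∫ x in interior Ω, ∑ I : Fin k → Fin (2 * k + 1), starCoord (α x).toAlternatingMap I *
        Ψ (fun j => fderiv ℝ (w j) x (stdVec (I j))) = 0 := by
  obtain ⟨B, hB⟩ := isTangentField_primitiveField m Ψ hΩ.isCompact hα hw hwb hDw
  have h : EqOn (divergence (primitiveField w m Ψ α)) (fun x => ∑ I : Fin k → Fin (2 * k + 1),
      starCoord (α x).toAlternatingMap I * Ψ (fun j => fderiv ℝ (w j) x (stdVec (I j))))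
      (interior Ω) := fun x hx => divergence_primitiveField m Ψ hα hx fun j =>
    (hw j).contDiffAt (isOpen_interior.mem_nhds hx)
  refine ⟨?_, ?_⟩
  · exact (integrableOn_of_continuousOn_of_abs_le isOpen_interior
      (volume_interior_ne_top hΩ.isCompact) (continuousOn_divergence hB.contDiffOn)
      hB.abs_divergence_le).congr_fun h isOpen_interior.measurableSet
  · rw [← hB.integral_divergence_eq_zero hΩ]
    exact setIntegral_congr_fun isOpen_interior.measurableSet h.symm

end IBP

/-! ### Uniform bounds for isotopies -/

section Taylor

variable {E F : Type*} [NormedAddCommGroup E] [NormedSpace ℝ E] [NormedAddCommGroup F]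
  [NormedSpace ℝ F] {f : E → F} {S R : Set E} {n : WithTop ℕ∞}

/-- A function that is smooth on a set `S`, which is not supposed to have unique derivatives, has
derivatives on subsets that extend continuously to `S`: the Taylor coefficients of the definition
of smoothness are such extensions. -/
theorem exists_tendsto_iteratedFDerivWithin (hf : ContDiffOn ℝ n f S) (hR : UniqueDiffOn ℝ R)
    (hRS : R ⊆ S) {m : ℕ} (hm : m ≤ n) {z : E} (hz : z ∈ S) :
    ∃ L, Tendsto (iteratedFDerivWithin ℝ m f R) (𝓝[R] z) (𝓝 L) := by
  obtain ⟨u, hu, p, hp⟩ := contDiffWithinAt_nat.1 ((hf z hz).of_le hm)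
  rw [insert_eq_of_mem hz] at hu
  obtain ⟨V, hV, hzV, hVu⟩ := mem_nhdsWithin.1 hu
  refine ⟨p z m, ?_⟩
  have h1 : Tendsto (fun y => p y m) (𝓝[R] z) (𝓝 (p z m)) := by
    have h2 := hp.cont m le_rfl z (hVu ⟨hzV, hz⟩)
    refine Tendsto.mono_left h2 ?_
    exact (nhdsWithin_mono z hRS).trans (nhdsWithin_le_iff.2 hu)
  refine h1.congr' ?_
  filter_upwards [self_mem_nhdsWithin, mem_nhdsWithin_of_mem_nhds (hV.mem_nhds hzV)] with y hyR hyV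
  have h3 := (hp.mono (show R ∩ V ⊆ u from fun y hy =>
    hVu ⟨hy.2, hRS hy.1⟩)).eq_iteratedFDerivWithin_of_uniqueDiffOn le_rfl (hR.inter hV) ⟨hyR, hyV⟩
  rw [h3, iteratedFDerivWithin_inter_open hV hyV]

theorem exists_tendsto_fderivWithin (hf : ContDiffOn ℝ n f S) (hR : UniqueDiffOn ℝ R)
    (hRS : R ⊆ S) (hn : 1 ≤ n) {z : E} (hz : z ∈ S) :
    ∃ L, Tendsto (fderivWithin ℝ f R) (𝓝[R] z) (𝓝 L) := by
  obtain ⟨L, hL⟩ := exists_tendsto_iteratedFDerivWithin (m := 1) hf hR hRS (by simpa using hn) hz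
  refine ⟨continuousMultilinearCurryFin1 ℝ E F L, ?_⟩
  have h := ((continuousMultilinearCurryFin1 ℝ E F).continuous.tendsto L).comp hL
  refine h.congr' ?_
  filter_upwards [self_mem_nhdsWithin] with y hy
  ext v
  simp [iteratedFDerivWithin_one_apply (hR y hy)]

/-- A function on `R ⊆ S` with limits at all points of the compact set `S` is bounded. -/
theorem exists_norm_le_of_exists_tendsto {X G : Type*} [TopologicalSpace X]
    [SeminormedAddCommGroup G] {H : X → G} {S R : Set X}
    (hS : IsCompact S) (hRS : R ⊆ S) (h : ∀ z ∈ S, ∃ L, Tendsto H (𝓝[R] z) (𝓝 L)) :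
    ∃ C, ∀ x ∈ R, ‖H x‖ ≤ C := by
  have h1 : ∃ C, ∀ x ∈ S, x ∈ R → ‖H x‖ ≤ C := by
    refine hS.induction_on (p := fun s => ∃ C, ∀ x ∈ s, x ∈ R → ‖H x‖ ≤ C) ⟨0, by simp⟩ ?_ ?_ ?_
    · rintro s t hst ⟨C, hC⟩
      exact ⟨C, fun x hx => hC x (hst hx)⟩
    · rintro s t ⟨C, hC⟩ ⟨C', hC'⟩
      refine ⟨max C C', fun x hx hxR => ?_⟩
      rcases hx with hx | hx
      · exact (hC x hx hxR).trans (le_max_left _ _)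
      · exact (hC' x hx hxR).trans (le_max_right _ _)
    · intro z hz
      obtain ⟨L, hL⟩ := h z hz
      have h2 : ∀ᶠ y in 𝓝[R] z, ‖H y‖ ≤ ‖L‖ + 1 :=
        hL.norm.eventually (Iic_mem_nhds (by linarith [norm_nonneg L]))
      rw [eventually_nhdsWithin_iff] at h2
      exact ⟨_, mem_nhdsWithin_of_mem_nhds h2, ‖L‖ + 1, fun x hx hxR => hx hxR⟩
  obtain ⟨C, hC⟩ := h1
  exact ⟨C, fun x hx => hC x (hRS hx) hx⟩

theorem exists_pos_le_abs_of_exists_tendsto {X : Type*} [TopologicalSpace X] {H : X → ℝ}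
    {S R : Set X} (hS : IsCompact S) (hRS : R ⊆ S)
    (h : ∀ z ∈ S, ∃ L, L ≠ 0 ∧ Tendsto H (𝓝[R] z) (𝓝 L)) (h0 : ∀ x ∈ R, H x ≠ 0) :
    ∃ c > 0, ∀ x ∈ R, c ≤ |H x| := by
  obtain ⟨C, hC⟩ := exists_norm_le_of_exists_tendsto (H := fun x => (H x)⁻¹) hS hRS fun z hz => by
    obtain ⟨L, hL0, hL⟩ := h z hz
    exact ⟨L⁻¹, hL.inv₀ hL0⟩
  refine ⟨(max C 1)⁻¹, by positivity, fun x hx => ?_⟩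
  have h1 : |H x|⁻¹ ≤ max C 1 := by
    rw [← abs_inv]
    exact (hC x hx).trans (le_max_left _ _)
  exact inv_le_of_inv_le₀ (abs_pos.2 (h0 x hx)) h1

end Taylor

/-- The properties of a smooth isotopy `F` of an open set `U`, with velocity `v`, that are used
for the invariance of the helicity: all first derivatives and the mixed second derivatives are
bounded, and the Jacobians are bounded from below. -/
structure IsRegularIsotopy (U : Set (Eucl k)) (F v : ℝ → Eucl k → Eucl k) (b c : ℝ) : Prop where
  isOpen : IsOpen U
  contDiffOn : ∀ t ∈ Icc (0 : ℝ) 1, ContDiffOn ℝ ∞ (F t) U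
  injOn : ∀ t ∈ Icc (0 : ℝ) 1, InjOn (F t) U
  norm_le : ∀ t ∈ Icc (0 : ℝ) 1, ∀ x ∈ U, ‖F t x‖ ≤ b
  norm_fderiv_le : ∀ t ∈ Icc (0 : ℝ) 1, ∀ x ∈ U, ‖fderiv ℝ (F t) x‖ ≤ b
  pos : 0 < c
  le_det : ∀ t ∈ Icc (0 : ℝ) 1, ∀ x ∈ U, c ≤ (fderiv ℝ (F t) x).det
  continuousOn : ∀ x ∈ U, ContinuousOn (fun t => F t x) (Icc 0 1)
  continuousOn_fderiv : ∀ x ∈ U, ContinuousOn (fun t => fderiv ℝ (F t) x) (Icc 0 1)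
  contDiffOn_velocity : ∀ t ∈ Ioo (0 : ℝ) 1, ContDiffOn ℝ ∞ (v t) U
  norm_velocity_le : ∀ t ∈ Ioo (0 : ℝ) 1, ∀ x ∈ U, ‖v t x‖ ≤ b
  norm_fderiv_velocity_le : ∀ t ∈ Ioo (0 : ℝ) 1, ∀ x ∈ U, ‖fderiv ℝ (v t) x‖ ≤ b
  hasDerivAt : ∀ t ∈ Ioo (0 : ℝ) 1, ∀ x ∈ U, HasDerivAt (fun s => F s x) (v t x) t
  hasDerivAt_fderiv : ∀ t ∈ Ioo (0 : ℝ) 1, ∀ x ∈ U,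
    HasDerivAt (fun s => fderiv ℝ (F s) x) (fderiv ℝ (v t) x) t

section Diffeo

variable {Ω : Set (Eucl k)} {g : Eucl k → Eucl k}

theorem IsDiffeoOn.contDiffAt (hg : IsDiffeoOn g Ω) {x : Eucl k} (hx : x ∈ interior Ω) :
    ContDiffAt ℝ ∞ g x := hg.smooth.contDiffAt (mem_interior_iff_mem_nhds.1 hx)

theorem IsDiffeoOn.invFunOn_apply (hg : IsDiffeoOn g Ω) {x : Eucl k} (hx : x ∈ Ω) :
    Function.invFunOn g Ω (g x) = x := hg.injOn.leftInvOn_invFunOn hx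

theorem IsDiffeoOn.fderivWithin_comp_fderiv (hg : IsDiffeoOn g Ω) {x : Eucl k}
    (hx : x ∈ interior Ω) :
    (fderivWithin ℝ (Function.invFunOn g Ω) (g '' Ω) (g x)).comp (fderiv ℝ g x) =
      ContinuousLinearMap.id ℝ (Eucl k) := by
  have hxΩ := interior_subset hx
  have h1 := ((hg.smooth_inv _ (mem_image_of_mem g hxΩ)).differentiableWithinAt
    (by simp)).hasFDerivWithinAt
  have h2 := (((hg.contDiffAt hx).differentiableAt (by simp)).hasFDerivAt).hasFDerivWithinAt
    (s := Ω)
  have h3 := h1.comp x h2 (mapsTo_image g Ω)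
  have h4 := h3.hasFDerivAt (mem_interior_iff_mem_nhds.1 hx)
  have h5 : HasFDerivAt (Function.invFunOn g Ω ∘ g) (ContinuousLinearMap.id ℝ (Eucl k)) x := by
    refine (hasFDerivAt_id x).congr_of_eventuallyEq ?_
    filter_upwards [mem_interior_iff_mem_nhds.1 hx] with y hy
    exact hg.invFunOn_apply hy
  exact h4.unique h5

theorem IsDiffeoOn.det_ne_zero (hg : IsDiffeoOn g Ω) {x : Eucl k} (hx : x ∈ interior Ω) :
    (fderiv ℝ g x).det ≠ 0 := by
  intro h0
  have h := congrArg ContinuousLinearMap.det (hg.fderivWithin_comp_fderiv hx)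
  have h2 : ((fderivWithin ℝ (Function.invFunOn g Ω) (g '' Ω) (g x)).comp (fderiv ℝ g x)).det =
    (fderivWithin ℝ (Function.invFunOn g Ω) (g '' Ω) (g x)).det * (fderiv ℝ g x).det :=
    LinearMap.det_comp _ _
  rw [h2, h0, mul_zero] at h
  have h3 : (ContinuousLinearMap.id ℝ (Eucl k)).det = 1 := LinearMap.det_id
  rw [h3] at h
  exact zero_ne_one h

theorem image_mem_nhds_of_det_ne_zero {x : Eucl k} {s : Set (Eucl k)} (hs : s ∈ 𝓝 x)
    (hg : HasStrictFDerivAt g (fderiv ℝ g x) x) (hd : (fderiv ℝ g x).det ≠ 0) :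
    g '' s ∈ 𝓝 (g x) := by
  let e : Eucl k ≃L[ℝ] Eucl k := (fderiv ℝ g x).toContinuousLinearEquivOfDetNeZero hd
  have h1 : HasStrictFDerivAt g (e : Eucl k →L[ℝ] Eucl k) x := by
    rwa [ContinuousLinearMap.coe_toContinuousLinearEquivOfDetNeZero]
  rw [← h1.map_nhds_eq_of_equiv]
  exact image_mem_map hs

theorem IsDiffeoOn.isOpen_image_interior (hg : IsDiffeoOn g Ω) : IsOpen (g '' interior Ω) := by
  rw [isOpen_iff_mem_nhds]
  rintro _ ⟨x, hx, rfl⟩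
  exact image_mem_nhds_of_det_ne_zero (isOpen_interior.mem_nhds hx)
    ((hg.contDiffAt hx).hasStrictFDerivAt (by simp)) (hg.det_ne_zero hx)

theorem IsDiffeoOn.fderivWithin_invFunOn (hg : IsDiffeoOn g Ω) {x : Eucl k}
    (hx : x ∈ interior Ω) : fderivWithin ℝ (Function.invFunOn g Ω) (g '' Ω) (g x) =
      fderiv ℝ (Function.invFunOn g Ω) (g x) :=
  fderivWithin_of_mem_nhds (mem_of_superset
    (hg.isOpen_image_interior.mem_nhds (mem_image_of_mem g hx)) (image_mono interior_subset))

/-- The Jacobian of a diffeomorphism is bounded from below, because that of its inverse is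
bounded. -/
theorem IsDiffeoOn.exists_pos_le_abs_det (hg : IsDiffeoOn g Ω) (hΩ : IsCompact Ω) :
    ∃ c > 0, ∀ x ∈ interior Ω, c ≤ |(fderiv ℝ g x).det| := by
  set h := Function.invFunOn g Ω with hh
  have hRS : g '' interior Ω ⊆ g '' Ω := image_mono interior_subset
  obtain ⟨C, hC⟩ := exists_norm_le_of_exists_tendsto
    (H := fun q => (fderivWithin ℝ h (g '' interior Ω) q).det)
    (hΩ.image_of_continuousOn hg.smooth.continuousOn) hRS fun z hz => by
      obtain ⟨L, hL⟩ := exists_tendsto_fderivWithin hg.smooth_inv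
        hg.isOpen_image_interior.uniqueDiffOn hRS (by simp) hz
      exact ⟨L.det, (ContinuousLinearMap.continuous_det.tendsto L).comp hL⟩
  refine ⟨(max C 1)⁻¹, by positivity, fun x hx => ?_⟩
  have hq : g x ∈ g '' interior Ω := mem_image_of_mem g hx
  have h1 := hC (g x) hq
  rw [fderivWithin_of_isOpen hg.isOpen_image_interior hq, ← hg.fderivWithin_invFunOn hx] at h1
  have h2 : (fderivWithin ℝ h (g '' Ω) (g x)).det * (fderiv ℝ g x).det = 1 := by
    have h3 := congrArg ContinuousLinearMap.det (hg.fderivWithin_comp_fderiv hx)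
    rwa [show ((fderivWithin ℝ h (g '' Ω) (g x)).comp (fderiv ℝ g x)).det =
      (fderivWithin ℝ h (g '' Ω) (g x)).det * (fderiv ℝ g x).det from LinearMap.det_comp _ _,
      show (ContinuousLinearMap.id ℝ (Eucl k)).det = 1 from LinearMap.det_id] at h3
  have h3 : |(fderiv ℝ g x).det| = |(fderivWithin ℝ h (g '' Ω) (g x)).det|⁻¹ := by
    rw [← abs_inv]
    congr 1
    exact eq_inv_of_mul_eq_one_right h2
  rw [h3]
  refine inv_anti₀ ?_ (h1.trans (le_max_left _ _))
  exact abs_pos.2 (left_ne_zero_of_mul_eq_one h2)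

end Diffeo

/-- The bounds come from the compactness of `Ω × [0, 1]`, as the derivatives of `f` have limits at
the boundary. The Jacobians do not vanish, and they are positive since `f_0 = id`. -/
theorem exists_isRegularIsotopy {Ω : Set (Eucl k)} (hΩ : IsCompactDomain Ω)
    {f : Eucl k × ℝ → Eucl k} (hf : ContDiffOn ℝ ∞ f (Ω ×ˢ Icc (0 : ℝ) 1))
    (hdiffeo : ∀ t ∈ Icc (0 : ℝ) 1, IsDiffeoOn (fun p => f (p, t)) Ω)
    (hzero : ∀ p ∈ Ω, f (p, 0) = p) :
    ∃ v b c, IsRegularIsotopy (interior Ω) (fun t p => f (p, t)) v b c := by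
  set U := interior Ω with hU
  set S := Ω ×ˢ Icc (0 : ℝ) 1 with hS
  set R := U ×ˢ Icc (0 : ℝ) 1 with hR
  set O := U ×ˢ Ioo (0 : ℝ) 1 with hO
  have hScpt : IsCompact S := hΩ.isCompact.prod isCompact_Icc
  have hRS : R ⊆ S := prod_mono interior_subset subset_rfl
  have hOR : O ⊆ R := prod_mono subset_rfl Ioo_subset_Icc_self
  have hRu : UniqueDiffOn ℝ R :=
    isOpen_interior.uniqueDiffOn.prod (uniqueDiffOn_Icc zero_lt_one)
  have hOo : IsOpen O := isOpen_interior.prod isOpen_Ioo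
  set G := fderivWithin ℝ f R with hG
  have hfR : ContDiffOn ℝ ∞ f R := hf.mono hRS
  have hfO : ∀ z ∈ O, ContDiffAt ℝ ∞ f z := fun z hz =>
    (hfR.mono hOR).contDiffAt (hOo.mem_nhds hz)
  have hGc : ContinuousOn G R := (hfR.fderivWithin hRu (m := 0) (by simp)).continuousOn
  have hGO : ∀ z ∈ O, fderiv ℝ f z = G z := fun z hz =>
    (fderivWithin_of_mem_nhds (mem_of_superset (hOo.mem_nhds hz) hOR)).symm
  let ι : Eucl k →L[ℝ] Eucl k × ℝ := ContinuousLinearMap.inl ℝ (Eucl k) ℝ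
  have hD : ∀ t ∈ Icc (0 : ℝ) 1, ∀ x ∈ U,
      HasFDerivAt (fun p => f (p, t)) ((G (x, t)).comp ι) x := by
    intro t ht x hx
    have h1 : HasFDerivWithinAt f (G (x, t)) R (x, t) :=
      ((hfR (x, t) ⟨hx, ht⟩).differentiableWithinAt (by simp)).hasFDerivWithinAt
    have h2 : HasFDerivWithinAt (fun p : Eucl k => (p, t)) ι U x :=
      (hasFDerivAt_prodMk_left x t).hasFDerivWithinAt
    exact (h1.comp x h2 (show MapsTo (fun p : Eucl k => (p, t)) U R from
      fun p hp => ⟨hp, ht⟩)).hasFDerivAt (isOpen_interior.mem_nhds hx)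
  have hDeq : ∀ t ∈ Icc (0 : ℝ) 1, ∀ x ∈ U, fderiv ℝ (fun p => f (p, t)) x = (G (x, t)).comp ι :=
    fun t ht x hx => (hD t ht x hx).fderiv
  -- Bounds.
  obtain ⟨b₀, hb₀⟩ := hScpt.exists_bound_of_continuousOn hf.continuousOn
  obtain ⟨b₁, hb₁⟩ := exists_norm_le_of_exists_tendsto (H := G) hScpt hRS fun z hz =>
    exists_tendsto_fderivWithin hf hRu hRS (by simp) hz
  obtain ⟨b₂, hb₂⟩ := exists_norm_le_of_exists_tendsto (H := iteratedFDerivWithin ℝ 2 f O) hScpt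
    (hOR.trans hRS) fun z hz => exists_tendsto_iteratedFDerivWithin hf hOo.uniqueDiffOn
      (hOR.trans hRS) (WithTop.coe_le_coe.2 (le_top : (2 : ℕ∞) ≤ ⊤)) hz
  have hb₂' : ∀ z ∈ O, ‖fderiv ℝ (fderiv ℝ f) z‖ ≤ b₂ := by
    intro z hz
    have h1 := hb₂ z hz
    rwa [iteratedFDerivWithin_of_isOpen 2 hOo hz,
      ← norm_iteratedFDeriv_fderiv, norm_iteratedFDeriv_one] at h1
  obtain ⟨c, hc0, hc⟩ := exists_pos_le_abs_of_exists_tendsto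
    (H := fun z => ((G z).comp ι).det) hScpt hRS (fun z hz => by
      obtain ⟨L, hL⟩ := exists_tendsto_fderivWithin hf hRu hRS (by simp) hz
      have hlim : Tendsto (fun z => ((G z).comp ι).det) (𝓝[R] z) (𝓝 (L.comp ι).det) := by
        have h1 : Continuous fun A : Eucl k × ℝ →L[ℝ] Eucl k => (A.comp ι).det :=
          ContinuousLinearMap.continuous_det.comp (continuous_id.clm_comp continuous_const)
        exact (h1.tendsto L).comp hL
      refine ⟨_, ?_, hlim⟩
      -- Restrict to the time slice of `z`.
      obtain ⟨x₀, t⟩ := z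
      obtain ⟨c, hc0, hc⟩ := (hdiffeo t hz.2).exists_pos_le_abs_det hΩ.isCompact
      have h2 : Tendsto (fun x : Eucl k => (x, t)) (𝓝[U] x₀) (𝓝[R] (x₀, t)) := by
        refine tendsto_nhdsWithin_of_tendsto_nhds_of_eventually_within _ ?_ ?_
        · exact (Continuous.prodMk_left t).continuousAt.tendsto.mono_left nhdsWithin_le_nhds
        · filter_upwards [self_mem_nhdsWithin] with x hx
          exact ⟨hx, hz.2⟩
      have h3 := (hlim.comp h2).abs
      have hne : (𝓝[U] x₀).NeBot := by
        rw [← mem_closure_iff_nhdsWithin_neBot, hΩ.closure_interior]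
        exact hz.1
      have h4 : c ≤ |(L.comp ι).det| := by
        refine ge_of_tendsto h3 ?_
        filter_upwards [self_mem_nhdsWithin] with x hx
        have := hc x hx
        rwa [hDeq t hz.2 x hx] at this
      exact abs_pos.1 (hc0.trans_le h4))
    (fun z hz => by
      obtain ⟨x, t⟩ := z
      rw [← hDeq t hz.2 x hz.1]
      exact (hdiffeo t hz.2).det_ne_zero hz.1)
  have hpos : ∀ t ∈ Icc (0 : ℝ) 1, ∀ x ∈ U, c ≤ ((G (x, t)).comp ι).det := by
    intro t ht x hx
    have hcont : ContinuousOn (fun s => ((G (x, s)).comp ι).det) (Icc (0 : ℝ) 1) := by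
      have h1 : Continuous fun A : Eucl k × ℝ →L[ℝ] Eucl k => (A.comp ι).det :=
        ContinuousLinearMap.continuous_det.comp (continuous_id.clm_comp continuous_const)
      refine h1.comp_continuousOn (hGc.comp (Continuous.prodMk_right x).continuousOn
        fun s hs => ⟨hx, hs⟩)
    have h0 : ((G (x, 0)).comp ι).det = 1 := by
      have h1 : HasFDerivAt (fun p => f (p, (0 : ℝ))) (ContinuousLinearMap.id ℝ (Eucl k)) x := by
        refine (hasFDerivAt_id x).congr_of_eventuallyEq ?_
        filter_upwards [mem_interior_iff_mem_nhds.1 hx] with p hp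
        exact hzero p hp
      rw [(hD 0 (by simp) x hx).unique h1]
      exact LinearMap.det_id
    have h2 := hc (x, t) ⟨hx, ht⟩
    rcases le_abs'.1 h2 with h3 | h3
    · exfalso
      have h4 : (0 : ℝ) ∈ Icc ((G (x, t)).comp ι).det ((G (x, 0)).comp ι).det :=
        ⟨by linarith, by rw [h0]; exact zero_le_one⟩
      obtain ⟨s, hs, hs0⟩ := isPreconnected_Icc.intermediate_value ht
        (left_mem_Icc.2 zero_le_one) hcont h4
      have h5 := hc (x, s) ⟨hx, hs⟩
      simp only at hs0 h5
      rw [hs0, abs_zero] at h5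
      exact absurd hc0 (not_lt.2 h5)
    · exact h3
  let b := max (max b₀ b₁) (max b₂ 0)
  have hι : ‖ι‖ ≤ 1 := ContinuousLinearMap.norm_inl_le_one ℝ _ _
  have he1 : ‖((0 : Eucl k), (1 : ℝ))‖ ≤ 1 := by simp
  refine ⟨fun t x => fderiv ℝ f (x, t) (0, 1), b, c, isOpen_interior, ?_, ?_, ?_, ?_, hc0, ?_,
    ?_, ?_, ?_, ?_, ?_, ?_, ?_⟩
  · exact fun t ht => (hdiffeo t ht).smooth.mono interior_subset
  · exact fun t ht => (hdiffeo t ht).injOn.mono interior_subset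
  · exact fun t ht x hx => (hb₀ (x, t) ⟨interior_subset hx, ht⟩).trans
      ((le_max_left _ _).trans (le_max_left _ _))
  · intro t ht x hx
    rw [hDeq t ht x hx]
    refine (ContinuousLinearMap.opNorm_comp_le _ _).trans ?_
    refine (mul_le_of_le_one_right (norm_nonneg _) hι).trans ((hb₁ (x, t) ⟨hx, ht⟩).trans ?_)
    exact (le_max_right _ _).trans (le_max_left _ _)
  · intro t ht x hx
    rw [hDeq t ht x hx]
    exact hpos t ht x hx
  · exact fun x hx => hfR.continuousOn.comp (Continuous.prodMk_right x).continuousOn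
      fun s hs => ⟨hx, hs⟩
  · intro x hx
    have h1 : ContinuousOn (fun t => (G (x, t)).comp ι) (Icc 0 1) :=
      (hGc.comp (Continuous.prodMk_right x).continuousOn fun s hs => ⟨hx, hs⟩).clm_comp
        continuousOn_const
    exact h1.congr fun t ht => hDeq t ht x hx
  · intro t ht x hx
    have h1 : ContDiffAt ℝ ∞ (fderiv ℝ f) (x, t) := (hfO (x, t) ⟨hx, ht⟩).fderiv_right (by simp)
    exact ((h1.comp x (contDiffAt_id.prodMk contDiffAt_const)).clm_apply
      contDiffAt_const).contDiffWithinAt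
  · intro t ht x hx
    refine (ContinuousLinearMap.le_opNorm _ _).trans
      ((mul_le_of_le_one_right (norm_nonneg _) he1).trans ?_)
    rw [hGO (x, t) ⟨hx, ht⟩]
    exact (hb₁ (x, t) ⟨hx, Ioo_subset_Icc_self ht⟩).trans
      ((le_max_right _ _).trans (le_max_left _ _))
  · intro t ht x hx
    have h1 : HasFDerivAt (fderiv ℝ f) (fderiv ℝ (fderiv ℝ f) (x, t)) (x, t) :=
      (((hfO (x, t) ⟨hx, ht⟩).fderiv_right (m := ∞) (by simp)).differentiableAt
        (by simp)).hasFDerivAt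
    have hcomp : HasFDerivAt (fun y => fderiv ℝ f (y, t))
        ((fderiv ℝ (fderiv ℝ f) (x, t)).comp ι) x := h1.comp x (hasFDerivAt_prodMk_left x t)
    have h2 := hcomp.clm_apply
      (hasFDerivAt_const ((0 : Eucl k), (1 : ℝ)) x)
    refine ContinuousLinearMap.opNorm_le_bound _ (by positivity) fun e => ?_
    rw [show fderiv ℝ (fun x => fderiv ℝ f (x, t) (0, 1)) x = _ from h2.fderiv]
    simp only [add_apply,
      ContinuousLinearMap.comp_apply, zero_apply, map_zero, zero_add,
      ContinuousLinearMap.flip_apply]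
    calc _ ≤ ‖fderiv ℝ (fderiv ℝ f) (x, t)‖ * ‖ι e‖ * ‖((0 : Eucl k), (1 : ℝ))‖ :=
          ContinuousLinearMap.le_opNorm₂ _ _ _
      _ ≤ b * ‖e‖ * 1 := by
          have h3 := hb₂' (x, t) ⟨hx, ht⟩
          have h4 : b₂ ≤ b := (le_max_left _ _).trans (le_max_right _ _)
          have h5 : ‖ι e‖ ≤ ‖e‖ := (ι.le_opNorm e).trans (mul_le_of_le_one_left (norm_nonneg _) hι)
          have h6 := h3.trans h4
          gcongr
      _ = b * ‖e‖ := mul_one _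
  · intro t ht x hx
    have h1 : HasFDerivAt f (fderiv ℝ f (x, t)) (x, t) :=
      ((hfO (x, t) ⟨hx, ht⟩).differentiableAt (by simp)).hasFDerivAt
    have h2 : HasDerivAt (fun s : ℝ => (x, s)) ((0 : Eucl k), (1 : ℝ)) t :=
      (hasDerivAt_const t x).prodMk (hasDerivAt_id t)
    exact h1.comp_hasDerivAt t h2
  · intro t ht x hx
    have h1 : HasFDerivAt (fderiv ℝ f) (fderiv ℝ (fderiv ℝ f) (x, t)) (x, t) :=
      (((hfO (x, t) ⟨hx, ht⟩).fderiv_right (m := ∞) (by simp)).differentiableAt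
        (by simp)).hasFDerivAt
    have h2 : HasDerivAt (fun s : ℝ => (x, s)) ((0 : Eucl k), (1 : ℝ)) t :=
      (hasDerivAt_const t x).prodMk (hasDerivAt_id t)
    have h3 := (h1.comp_hasDerivAt t h2).clm_comp (hasDerivAt_const t ι)
    have h4 : (fun s => fderiv ℝ (fun p => f (p, s)) x) =ᶠ[𝓝 t]
        fun s => (fderiv ℝ f (x, s)).comp ι := by
      filter_upwards [isOpen_Ioo.mem_nhds ht] with s hs
      rw [hDeq s (Ioo_subset_Icc_self hs) x hx, hGO (x, s) ⟨hx, hs⟩]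
    refine (h3.congr_of_eventuallyEq h4).congr_deriv ?_
    have hcomp : HasFDerivAt (fun y => fderiv ℝ f (y, t))
        ((fderiv ℝ (fderiv ℝ f) (x, t)).comp ι) x := h1.comp x (hasFDerivAt_prodMk_left x t)
    have h5 := hcomp.clm_apply
      (hasFDerivAt_const ((0 : Eucl k), (1 : ℝ)) x)
    rw [show fderiv ℝ (fun x => fderiv ℝ f (x, t) (0, 1)) x = _ from h5.fderiv]
    have hsymm : IsSymmSndFDerivAt ℝ f (x, t) :=
      (hfO (x, t) ⟨hx, ht⟩).isSymmSndFDerivAt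
      (by simpa using (WithTop.coe_le_coe.2 (le_top : (2 : ℕ∞) ≤ ⊤) : (2 : WithTop ℕ∞) ≤ ∞))
    ext1 e
    simp only [ContinuousLinearMap.comp_apply, zero_add,
      ContinuousLinearMap.flip_apply, add_zero, ContinuousLinearMap.comp_zero]
    exact hsymm.eq _ _

/-! ### The regularized kernel -/

/-- The helicity kernel, regularized at the origin: `z / (‖z‖² + ε²) ^ (n / 2)`, `n = 2k+1`. -/
def regKernel (k : ℕ) (ε : ℝ) (z : Eucl k) : Eucl k :=
  (‖z‖ ^ 2 + ε ^ 2) ^ (-((2 * k + 1 : ℝ) / 2)) • z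

/-- The divergence of the regularized kernel, an approximate multiple of the delta function. -/
def regDelta (k : ℕ) (ε : ℝ) (z : Eucl k) : ℝ :=
  (2 * k + 1) * ε ^ 2 * (‖z‖ ^ 2 + ε ^ 2) ^ (-((2 * k + 1 : ℝ) / 2) - 1)

theorem kernel_exponent (z : Eucl k) :
    (‖z‖ ^ 2) ^ (-((2 * k + 1 : ℝ) / 2)) = (‖z‖ ^ (2 * k + 1))⁻¹ := by
  rw [← Real.rpow_natCast ‖z‖ 2, ← Real.rpow_mul (norm_nonneg z), ← Real.rpow_natCast,
    ← Real.rpow_neg (norm_nonneg z)]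
  congr 1
  push_cast
  ring

theorem regKernel_zero : regKernel k 0 = kernel k := by
  ext1 z
  rw [regKernel, kernel, ← kernel_exponent]
  simp

theorem norm_regKernel_le (ε : ℝ) (z : Eucl k) : ‖regKernel k ε z‖ ≤ ‖kernel k z‖ := by
  rcases eq_or_ne z 0 with rfl | hz
  · simp [regKernel]
  have h0 : 0 < ‖z‖ ^ 2 := by positivity
  rw [regKernel, kernel, norm_smul, norm_smul, ← kernel_exponent, Real.norm_eq_abs,
    Real.norm_eq_abs, abs_of_nonneg (by positivity), abs_of_nonneg (by positivity)]
  refine mul_le_mul_of_nonneg_right ?_ (norm_nonneg z)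
  exact Real.rpow_le_rpow_of_nonpos h0 (by nlinarith [sq_nonneg ε])
    (by rw [neg_nonpos]; positivity)

theorem tendsto_regKernel (z : Eucl k) :
    Tendsto (fun ε => regKernel k ε z) (𝓝 0) (𝓝 (kernel k z)) := by
  rcases eq_or_ne z 0 with rfl | hz
  · simp [regKernel, kernel]
  rw [← regKernel_zero]
  have h : ContinuousAt (fun ε : ℝ => (‖z‖ ^ 2 + ε ^ 2) ^ (-((2 * k + 1 : ℝ) / 2))) 0 := by
    refine ContinuousAt.rpow_const (by fun_prop) (Or.inl ?_)
    have : ‖z‖ ≠ 0 := by simpa using hz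
    simpa using this
  exact h.tendsto.smul_const z

section Positive

variable {ε : ℝ} (hε : 0 < ε)
include hε

theorem norm_sq_add_sq_pos (z : Eucl k) : 0 < ‖z‖ ^ 2 + ε ^ 2 := by positivity

theorem contDiff_regKernel : ContDiff ℝ ∞ (regKernel k ε) :=
  (((contDiff_norm_sq ℝ).add contDiff_const).rpow_const_of_ne
    fun z => (norm_sq_add_sq_pos hε z).ne').smul contDiff_id

theorem sum_fderiv_regKernel (z : Eucl k) :
    ∑ j, fderiv ℝ (regKernel k ε) z (stdVec j) j = regDelta k ε z := by
  set p : ℝ := -((2 * k + 1 : ℝ) / 2) with hp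
  have hs := norm_sq_add_sq_pos hε z
  have h1 : HasFDerivAt (fun z : Eucl k => (‖z‖ ^ 2 + ε ^ 2) ^ p)
      ((p * (‖z‖ ^ 2 + ε ^ 2) ^ (p - 1)) • ((2 : ℝ) • innerSL ℝ z)) z := by
    have h2 : HasFDerivAt (fun z : Eucl k => ‖z‖ ^ 2 + ε ^ 2) ((2 : ℝ) • innerSL ℝ z) z := by
      have := ((hasStrictFDerivAt_norm_sq z).hasFDerivAt).add_const (ε ^ 2)
      rwa [two_smul ℕ, ← two_smul ℝ] at this
    exact h2.rpow_const (Or.inl hs.ne')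
  have h3 : HasFDerivAt (regKernel k ε) _ z := h1.smul (hasFDerivAt_id z)
  rw [h3.fderiv]
  have h4 : ∀ j : Fin (2 * k + 1), innerSL ℝ z (stdVec j) = z j := fun j => by
    simp [EuclideanSpace.inner_single_right]
  have h5 : ∑ j, z j * z j = ‖z‖ ^ 2 := by
    rw [EuclideanSpace.norm_sq_eq]
    simp [sq]
  simp only [add_apply, smul_apply, ContinuousLinearMap.smulRight_apply, h4, smul_eq_mul,
    PiLp.add_apply, PiLp.smul_apply, Finset.sum_add_distrib, ContinuousLinearMap.id_apply]
  have h6 : ∑ j : Fin (2 * k + 1), (‖z‖ ^ 2 + ε ^ 2) ^ p * (stdVec j : Eucl k) j =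
      (2 * k + 1) * (‖z‖ ^ 2 + ε ^ 2) ^ p := by
    simp
  have h7 : ∑ j : Fin (2 * k + 1), p * (‖z‖ ^ 2 + ε ^ 2) ^ (p - 1) * (2 * z j) * z j =
      -(2 * k + 1) * (‖z‖ ^ 2 + ε ^ 2) ^ (p - 1) * ‖z‖ ^ 2 := by
    rw [← h5, Finset.mul_sum]
    refine Finset.sum_congr rfl fun j _ => ?_
    rw [hp]; ring
  rw [h6, h7, regDelta]
  have h8 : (‖z‖ ^ 2 + ε ^ 2) ^ p = (‖z‖ ^ 2 + ε ^ 2) ^ (p - 1) * (‖z‖ ^ 2 + ε ^ 2) := by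
    rw [← Real.rpow_add_one hs.ne', sub_add_cancel]
  rw [h8]
  ring

theorem regDelta_nonneg (z : Eucl k) : 0 ≤ regDelta k ε z := by
  unfold regDelta; positivity

theorem continuous_regDelta : Continuous (regDelta k ε) :=
  continuous_const.mul (((continuous_norm.pow 2).add continuous_const).rpow_const
    fun z => Or.inl (norm_sq_add_sq_pos hε z).ne')

theorem regDelta_le {δ : ℝ} (hδ : 0 < δ) {z : Eucl k} (hz : δ ≤ ‖z‖) :
    regDelta k ε z ≤ (2 * k + 1) * ε ^ 2 * (δ ^ 2) ^ (-((2 * k + 1 : ℝ) / 2) - 1) := by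
  unfold regDelta
  gcongr ?_ * ?_
  refine Real.rpow_le_rpow_of_nonpos (by positivity) ?_ ?_
  · nlinarith [sq_nonneg ε]
  · have : (0 : ℝ) ≤ k := by positivity
    linarith

theorem regDelta_eq_smul (z : Eucl k) :
    regDelta k ε z = (ε⁻¹) ^ (2 * k + 1) * regDelta k 1 (ε⁻¹ • z) := by
  unfold regDelta
  set q : ℝ := -((2 * k + 1 : ℝ) / 2) - 1 with hq
  have h1 : ‖z‖ ^ 2 + ε ^ 2 = ε ^ 2 * (‖ε⁻¹ • z‖ ^ 2 + 1 ^ 2) := by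
    rw [norm_smul, norm_inv, Real.norm_eq_abs, abs_of_pos hε]
    field_simp
  have h2 : (ε ^ 2) ^ q = (ε⁻¹) ^ (2 * k + 1) * (ε ^ 2)⁻¹ := by
    rw [← Real.rpow_natCast ε 2, ← Real.rpow_mul hε.le, inv_pow, ← Real.rpow_natCast,
      ← Real.rpow_neg hε.le, ← Real.rpow_neg hε.le, ← Real.rpow_add hε]
    congr 1
    rw [hq]; push_cast; ring
  rw [h1, Real.mul_rpow (by positivity) (by positivity), h2]
  field_simp

end Positive

theorem integrable_regDelta_one : Integrable (regDelta k 1) := by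
  have h := integrable_rpow_neg_one_add_norm_sq (E := Eucl k) (μ := volume)
    (r := (2 * k + 1 : ℝ) + 2) (by simp)
  refine (h.const_mul (2 * k + 1)).congr (Eventually.of_forall fun z => ?_)
  simp only [regDelta]
  rw [show -((2 * k + 1 : ℝ) + 2) / 2 = -((2 * k + 1 : ℝ) / 2) - 1 by ring, one_pow, mul_one,
    add_comm (‖z‖ ^ 2)]

theorem lintegral_regDelta {ε : ℝ} (hε : 0 < ε) :
    ∫⁻ z : Eucl k, ENNReal.ofReal (regDelta k ε z) =
      ENNReal.ofReal (∫ z : Eucl k, regDelta k 1 z) := by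
  have h1 : regDelta k ε = fun z => (ε⁻¹) ^ (2 * k + 1) * regDelta k 1 (ε⁻¹ • z) :=
    funext (regDelta_eq_smul hε)
  have hint : Integrable (regDelta k ε) := by
    rw [h1]
    exact (integrable_regDelta_one.comp_smul (inv_ne_zero hε.ne')).const_mul _
  rw [← ofReal_integral_eq_lintegral_ofReal hint (Eventually.of_forall (regDelta_nonneg hε))]
  congr 1
  rw [h1, integral_const_mul, Measure.integral_comp_smul]
  have : (0 : ℝ) < (ε⁻¹) ^ (2 * k + 1) := by positivity
  simp only [finrank_euclideanSpace, Fintype.card_fin, smul_eq_mul]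
  rw [abs_of_pos (inv_pos.2 this), ← mul_assoc, mul_inv_cancel₀ this.ne', one_mul]

theorem measurable_kernel : Measurable (kernel k) := by
  unfold kernel; fun_prop

/-- The kernel is locally integrable. -/
theorem exists_lintegral_kernel_le (k : ℕ) (R : ℝ) : ∃ C : ENNReal, C ≠ ⊤ ∧ ∀ p : Eucl k, ‖p‖ ≤ R →
    ∫⁻ q in Metric.closedBall 0 R, ‖kernel k (q - p)‖ₑ ≤ C := by
  have h1 : LocallyIntegrable (kernel k) volume := by
    refine locallyIntegrable_of_norm_le_rpow (C := 1) (α := 2 * k) (by simp) (by simp) ?_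
      measurable_kernel.aestronglyMeasurable
    refine Eventually.of_forall fun z => ?_
    rcases eq_or_ne z 0 with rfl | hz
    · simp only [kernel, smul_zero, norm_zero, one_mul]; positivity
    · have h0 : 0 < ‖z‖ := norm_pos_iff.2 hz
      rw [kernel, norm_smul, norm_inv, norm_pow, norm_norm, Real.rpow_neg h0.le, one_mul,
        show (2 * k : ℝ) = ((2 * k : ℕ) : ℝ) by push_cast; rfl, Real.rpow_natCast, pow_succ]
      apply le_of_eq
      field_simp
  have h2 := h1.integrableOn_isCompact (isCompact_closedBall (0 : Eucl k) (2 * R))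
  refine ⟨∫⁻ q in Metric.closedBall 0 (2 * R), ‖kernel k q‖ₑ, h2.2.ne, fun p hp => ?_⟩
  have hm : Measurable fun z : Eucl k => ‖kernel k z‖ₑ := measurable_kernel.enorm
  rw [← lintegral_indicator Metric.isClosed_closedBall.measurableSet,
    ← lintegral_indicator Metric.isClosed_closedBall.measurableSet,
    ← lintegral_sub_right_eq_self (fun q : Eucl k => (Metric.closedBall 0 (2 * R)).indicator
      (fun q => ‖kernel k q‖ₑ) q) p]
  refine lintegral_mono fun q => ?_
  by_cases hq : q ∈ Metric.closedBall (0 : Eucl k) R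
  · have : q - p ∈ Metric.closedBall (0 : Eucl k) (2 * R) := by
      rw [mem_closedBall_zero_iff] at hq ⊢
      exact (norm_sub_le _ _).trans (by linarith)
    rw [indicator_of_mem hq, indicator_of_mem this]
  · rw [indicator_of_notMem hq]; exact zero_le

/-! ### The determinant of a vector and two `k`-tuples -/

/-- The determinant, as a continuous multilinear map. -/
def volFormC (k : ℕ) : ContinuousMultilinearMap ℝ (fun _ : Fin (2 * k + 1) => Eucl k) ℝ :=
  { (volForm k).toMultilinearMap with
    cont := by
      change Continuous fun v : Fin (2 * k + 1) → Eucl k => volForm k v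
      simp_rw [volForm_apply]
      refine Continuous.matrix_det (continuous_matrix fun i j => ?_)
      exact (EuclideanSpace.proj j : Eucl k →L[ℝ] ℝ).continuous.comp (continuous_apply i) }

/-- `triple`, as a continuous multilinear map. -/
def tripleL (k : ℕ) : Eucl k →L[ℝ] ContinuousMultilinearMap ℝ (fun _ : Fin k => Eucl k)
    (ContinuousMultilinearMap ℝ (fun _ : Fin k => Eucl k) ℝ) :=
  (ContinuousMultilinearMap.currySumEquiv ℝ (Fin k) (Fin k) (Eucl
    k) ℝ).toContinuousLinearEquiv.toContinuousLinearMap ∘L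
    (ContinuousMultilinearMap.domDomCongrₗᵢ ℝ (Eucl k) ℝ
      (splitPair k).symm).toContinuousLinearEquiv.toContinuousLinearMap ∘L (volFormC k).curryLeft

theorem tripleL_apply (K : Eucl k) (a b : Fin k → Eucl k) : tripleL k K a b = triple K a b := by
  change volForm k (Fin.cons K fun j => Sum.elim a b ((splitPair k).symm j)) = _
  rfl

/-- `triple` for fixed last arguments. -/
def tripleLeft (b : Fin k → Eucl k) :
    Eucl k →L[ℝ] ContinuousMultilinearMap ℝ (fun _ : Fin k => Eucl k) ℝ :=
  ContinuousLinearMap.compContinuousMultilinearMapL ℝ _ _ _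
    (ContinuousMultilinearMap.apply ℝ (fun _ : Fin k => Eucl k) ℝ b) ∘L tripleL k

theorem tripleLeft_apply (K : Eucl k) (a b : Fin k → Eucl k) :
    tripleLeft b K a = triple K a b := tripleL_apply K a b

/-- `triple` for fixed middle arguments. -/
def tripleRight (a : Fin k → Eucl k) :
    Eucl k →L[ℝ] ContinuousMultilinearMap ℝ (fun _ : Fin k => Eucl k) ℝ :=
  ContinuousMultilinearMap.apply ℝ (fun _ : Fin k => Eucl k) _ a ∘L tripleL k

theorem tripleRight_apply (K : Eucl k) (a b : Fin k → Eucl k) :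
    tripleRight a K b = triple K a b := tripleL_apply K a b

theorem norm_tripleVec_le {K : Eucl k} {a b : Fin k → Eucl k} {s : ℝ} (_ : 0 ≤ s)
    (ha : ∀ j, ‖a j‖ ≤ s) (hb : ∀ j, ‖b j‖ ≤ s) :
    |triple K a b| ≤ ‖volFormC k‖ * s ^ (2 * k) * ‖K‖ := by
  have h1 := (volFormC k).le_opNorm (tripleVec K a b)
  refine h1.trans ?_
  rw [mul_assoc, Fin.prod_univ_succ, mul_comm (s ^ _)]
  gcongr
  · simp [tripleVec]
  · refine (Finset.prod_le_prod (fun _ _ => norm_nonneg _) (g := fun _ => s) fun i _ => ?_).trans_eq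
      (by simp)
    simp only [tripleVec, Fin.cons_succ]
    rcases (splitPair k).symm i with j | j
    · exact ha j
    · exact hb j

theorem sum_volForm_update_tripleVec (K K' : Eucl k) (a a' b b' : Fin k → Eucl k) :
    ∑ i, volForm k (Function.update (tripleVec K a b) i (tripleVec K' a' b' i)) =
      triple K' a b + (∑ m, triple K (Function.update a m (a' m)) b +
        ∑ m, triple K a (Function.update b m (b' m))) := by
  rw [Fin.sum_univ_succ, ← (splitPair k).sum_comp, Fintype.sum_sum_type]
  refine congrArg₂ _ ?_ (congrArg₂ _ (Finset.sum_congr rfl fun m _ => ?_)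
    (Finset.sum_congr rfl fun m _ => ?_))
  · unfold triple tripleVec
    rw [Fin.update_cons_zero, Fin.cons_zero]
  all_goals
    unfold triple tripleVec
    rw [← Fin.cons_update, Fin.cons_succ]
    congr 2
    ext1 i
    obtain ⟨s, rfl⟩ := (splitPair k).surjective i
    rcases s with s | s <;> by_cases hs : s = m <;> simp [Function.update_apply, hs]

/-- The derivation induced by `P` on determinants is multiplication by the trace of `P`. -/
theorem triple_trace (P : Eucl k →ₗ[ℝ] Eucl k) (K : Eucl k) (a b : Fin k → Eucl k) :
    triple (P K) a b + (∑ m, triple K (Function.update a m (P (a m))) b +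
        ∑ m, triple K a (Function.update b m (P (b m)))) =
      (∑ j, P (stdVec j) j) * triple K a b := by
  have h := sum_volForm_update P (tripleVec K a b)
  rw [show (∑ j, P (stdVec j) j) * triple K a b =
    (∑ j, P (stdVec j) j) * volForm k (tripleVec K a b) from rfl, ← h,
    ← sum_volForm_update_tripleVec K (P K) a (fun m => P (a m)) b (fun m => P (b m))]
  refine Finset.sum_congr rfl fun i _ => ?_
  congr 2
  refine Fin.cases ?_ (fun i => ?_) i
  · simp [tripleVec]
  · simp only [tripleVec, Fin.cons_succ]
    rcases (splitPair k).symm i with j | j <;> rfl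

theorem volForm_comp_swap (v : Fin (2 * k + 1) → Eucl k) {i j : Fin (2 * k + 1)} (h : i ≠ j) :
    volForm k (v ∘ Equiv.swap i j) = -volForm k v := (volForm k).map_swap v h

theorem tripleVec_zero (K : Eucl k) (a b : Fin k → Eucl k) : tripleVec K a b 0 = K := rfl

theorem tripleVec_inl (K : Eucl k) (a b : Fin k → Eucl k) (j : Fin k) :
    tripleVec K a b (splitPair k (Sum.inl j)).succ = a j := by
  rw [tripleVec, Fin.cons_succ, Equiv.symm_apply_apply, Sum.elim_inl]

theorem tripleVec_inr (K : Eucl k) (a b : Fin k → Eucl k) (j : Fin k) :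
    tripleVec K a b (splitPair k (Sum.inr j)).succ = b j := by
  rw [tripleVec, Fin.cons_succ, Equiv.symm_apply_apply, Sum.elim_inr]

theorem triple_update_left_swap (K u : Eucl k) (a b : Fin k → Eucl k) (m : Fin k) :
    triple K (Function.update a m u) b = -triple u (Function.update a m K) b := by
  unfold triple
  rw [← volForm_comp_swap (tripleVec u (Function.update a m K) b)
    (Fin.succ_ne_zero (splitPair k (Sum.inl m))).symm]
  congr 1
  ext1 i
  rw [Function.comp_apply]
  refine Fin.cases ?_ (fun i => ?_) i
  · rw [Equiv.swap_apply_left, tripleVec_zero, tripleVec_inl, Function.update_self]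
  · obtain ⟨s, rfl⟩ := (splitPair k).surjective i
    by_cases hs : s = Sum.inl m
    · subst hs
      rw [Equiv.swap_apply_right, tripleVec_zero, tripleVec_inl, Function.update_self]
    · rw [Equiv.swap_apply_of_ne_of_ne (Fin.succ_ne_zero _)
        (fun h => hs ((splitPair k).injective (Fin.succ_injective _ h)))]
      rcases s with s | s
      · have : s ≠ m := fun h => hs (congrArg _ h)
        rw [tripleVec_inl, tripleVec_inl, Function.update_of_ne this, Function.update_of_ne this]
      · rw [tripleVec_inr, tripleVec_inr]

theorem triple_update_right_swap (K u : Eucl k) (a b : Fin k → Eucl k) (m : Fin k) :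
    triple K a (Function.update b m u) = -triple u a (Function.update b m K) := by
  unfold triple
  rw [← volForm_comp_swap (tripleVec u a (Function.update b m K))
    (Fin.succ_ne_zero (splitPair k (Sum.inr m))).symm]
  congr 1
  ext1 i
  rw [Function.comp_apply]
  refine Fin.cases ?_ (fun i => ?_) i
  · rw [Equiv.swap_apply_left, tripleVec_zero, tripleVec_inr, Function.update_self]
  · obtain ⟨s, rfl⟩ := (splitPair k).surjective i
    by_cases hs : s = Sum.inr m
    · subst hs
      rw [Equiv.swap_apply_right, tripleVec_zero, tripleVec_inr, Function.update_self]
    · rw [Equiv.swap_apply_of_ne_of_ne (Fin.succ_ne_zero _)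
        (fun h => hs ((splitPair k).injective (Fin.succ_injective _ h)))]
      rcases s with s | s
      · rw [tripleVec_inl, tripleVec_inl]
      · have : s ≠ m := fun h => hs (congrArg _ h)
        rw [tripleVec_inr, tripleVec_inr, Function.update_of_ne this, Function.update_of_ne this]

/-! ### The derivative of the regularized helicity -/

/-- The images of the basis vectors `e_{I j}` under a linear map. -/
def frame (A : Eucl k →L[ℝ] Eucl k) (I : Fin k → Fin (2 * k + 1)) : Fin k → Eucl k :=
  fun j => A (stdVec (I j))

theorem norm_frame_le {A : Eucl k →L[ℝ] Eucl k} {b : ℝ} (hA : ‖A‖ ≤ b)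
    (I : Fin k → Fin (2 * k + 1)) (j : Fin k) : ‖frame A I j‖ ≤ b :=
  (A.le_opNorm _).trans (by rw [norm_stdVec, mul_one]; exact hA)

section

variable {Ω : Set (Eucl k)} {α : Form k (k + 1)} {G φ w : Eucl k → Eucl k} {b : ℝ}

/-- Integration by parts where the map `φ` stands in the slot `m`, and `G` in all other slots. -/
theorem integral_sum_starCoord_update_eq_zero (hΩ : IsCompactDomain Ω)
    (hα : IsClosedDirichlet Ω α) (hG : ContDiffOn ℝ 2 G (interior Ω))
    (hφ : ContDiffOn ℝ 2 φ (interior Ω)) (hDG : ∀ x ∈ interior Ω, ‖fderiv ℝ G x‖ ≤ b)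
    (hφb : ∀ x ∈ interior Ω, ‖φ x‖ ≤ b) (hDφ : ∀ x ∈ interior Ω, ‖fderiv ℝ φ x‖ ≤ b) (m : Fin k)
    (Ψ : ContinuousMultilinearMap ℝ (fun _ : Fin k => Eucl k) ℝ) :
    IntegrableOn (fun x => ∑ I : Fin k → Fin (2 * k + 1), starCoord (α x).toAlternatingMap I *
      Ψ (Function.update (frame (fderiv ℝ G x) I) m (fderiv ℝ φ x (stdVec (I m)))))
      (interior Ω) ∧
    ∫ x in interior Ω, ∑ I : Fin k → Fin (2 * k + 1), starCoord (α x).toAlternatingMap I *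
      Ψ (Function.update (frame (fderiv ℝ G x) I) m (fderiv ℝ φ x (stdVec (I m)))) = 0 := by
  have h := integral_sum_starCoord_mul_fderiv_eq_zero (w := Function.update (fun _ => G) m φ) m Ψ
    hΩ hα (fun j => by by_cases hj : j = m <;> simp [hj, hφ, hG])
    (b := b) (by simpa using hφb)
    (fun j => by by_cases hj : j = m <;> simp [hj] <;> assumption)
  have h2 : ∀ x, ∀ I : Fin k → Fin (2 * k + 1),
      (fun j => fderiv ℝ (Function.update (fun _ => G) m φ j) x (stdVec (I j))) =
      Function.update (frame (fderiv ℝ G x) I) m (fderiv ℝ φ x (stdVec (I m))) := by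
    intro x I
    ext1 j
    by_cases hj : j = m
    · subst hj; simp
    · simp [hj, frame]
  simpa only [h2] using h

/-- Integration by parts for a product of a vector valued function `φ` and a vector field `w`,
which enter into a multilinear expression. -/
theorem integral_sum_starCoord_update_add_eq_zero (hΩ : IsCompactDomain Ω)
    (hα : IsClosedDirichlet Ω α) (hG : ContDiffOn ℝ 2 G (interior Ω))
    (hφ : ContDiffOn ℝ 2 φ (interior Ω)) (hw : ContDiffOn ℝ 2 w (interior Ω))
    (hDG : ∀ x ∈ interior Ω, ‖fderiv ℝ G x‖ ≤ b)
    (hφb : ∀ x ∈ interior Ω, ‖φ x‖ ≤ b) (hDφ : ∀ x ∈ interior Ω, ‖fderiv ℝ φ x‖ ≤ b)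
    (hwb : ∀ x ∈ interior Ω, ‖w x‖ ≤ b) (hDw : ∀ x ∈ interior Ω, ‖fderiv ℝ w x‖ ≤ b) (m : Fin k)
    (Θ : Eucl k →L[ℝ] ContinuousMultilinearMap ℝ (fun _ : Fin k => Eucl k) ℝ) :
    ∫ x in interior Ω, ∑ I : Fin k → Fin (2 * k + 1), starCoord (α x).toAlternatingMap I *
      (Θ (φ x) (Function.update (frame (fderiv ℝ G x) I) m (fderiv ℝ w x (stdVec (I m)))) +
        Θ (fderiv ℝ φ x (stdVec (I m))) (Function.update (frame (fderiv ℝ G x) I) m (w x))) =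
      0 := by
  let p : Fin (2 * k + 1) → Eucl k →L[ℝ] ℝ := fun l => EuclideanSpace.proj l
  have hp : ∀ l v, |p l v| ≤ ‖v‖ := fun l v => PiLp.norm_apply_le v l
  have hD : ∀ l, ∀ x ∈ interior Ω, ∀ e, fderiv ℝ (fun x => p l (φ x) • w x) x e =
      φ x l • fderiv ℝ w x e + (fderiv ℝ φ x e) l • w x := by
    intro l x hx e
    have h1 := ((hφ.contDiffAt (isOpen_interior.mem_nhds hx)).differentiableAt
      (by simp)).hasFDerivAt
    have h2 := ((hw.contDiffAt (isOpen_interior.mem_nhds hx)).differentiableAt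
      (by simp)).hasFDerivAt
    have h3 : HasFDerivAt (fun x => p l (φ x) • w x) _ x :=
      ((p l).hasFDerivAt.comp x h1).smul h2
    rw [h3.fderiv]
    rfl
  have key := fun l => integral_sum_starCoord_update_eq_zero (φ := fun x => p l (φ x) • w x)
    (b := max b (b * b + b * b)) hΩ hα hG
    (((p l).contDiff.comp_contDiffOn hφ).smul hw) (fun x hx => (hDG x hx).trans (le_max_left _ _))
    (fun x hx => by
      have hb0 : 0 ≤ b := (norm_nonneg _).trans (hwb x hx)
      refine le_trans ?_ (le_max_right _ _)
      rw [norm_smul]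
      have := mul_le_mul ((hp l (φ x)).trans (hφb x hx)) (hwb x hx) (norm_nonneg _) hb0
      exact this.trans (by nlinarith))
    (fun x hx => by
      have hb0 : 0 ≤ b := (norm_nonneg _).trans (hwb x hx)
      refine le_trans ?_ (le_max_right _ _)
      refine ContinuousLinearMap.opNorm_le_bound _ (by positivity) fun e => ?_
      rw [hD l x hx e, add_mul]
      refine (norm_add_le _ _).trans (add_le_add ?_ ?_)
      · rw [norm_smul, mul_assoc]
        exact mul_le_mul ((hp l (φ x)).trans (hφb x hx))
          ((ContinuousLinearMap.le_opNorm _ _).trans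
            (mul_le_mul_of_nonneg_right (hDw x hx) (norm_nonneg _))) (norm_nonneg _) hb0
      · rw [norm_smul, mul_assoc, mul_comm b (_ * _), mul_comm b ‖e‖]
        have h1 : ‖(fderiv ℝ φ x e) l‖ ≤ ‖e‖ * b := (hp l _).trans
          ((ContinuousLinearMap.le_opNorm _ _).trans (by
            rw [mul_comm]; exact mul_le_mul_of_nonneg_left (hDφ x hx) (norm_nonneg _)))
        exact mul_le_mul h1 (hwb x hx) (norm_nonneg _) (by positivity))
    m (Θ (stdVec l))
  have hsum : ∑ l, ∫ x in interior Ω, ∑ I : Fin k → Fin (2 * k + 1),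
      starCoord (α x).toAlternatingMap I * Θ (stdVec l) (Function.update (frame (fderiv ℝ G x) I) m
        (fderiv ℝ (fun x => p l (φ x) • w x) x (stdVec (I m)))) = 0 :=
    Finset.sum_eq_zero fun l _ => (key l).2
  rw [← hsum, ← integral_finsetSum _ fun l _ => (key l).1]
  refine setIntegral_congr_fun isOpen_interior.measurableSet fun x hx => ?_
  rw [Finset.sum_comm]
  refine Finset.sum_congr rfl fun I _ => ?_
  rw [← Finset.mul_sum]
  congr 1
  simp only [hD _ x hx, ContinuousMultilinearMap.map_update_add,
    ContinuousMultilinearMap.map_update_smul, Finset.sum_add_distrib]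
  have hexp : ∀ (u : Eucl k) (c : Fin k → Eucl k), Θ u c = ∑ l, u l • Θ (stdVec l) c := by
    intro u c
    conv_lhs => rw [← sum_coord_smul_stdVec u]
    simp [map_sum, sum_apply]
  rw [hexp (φ x), hexp (fderiv ℝ φ x (stdVec (I m)))]

end

/-- Sums over tuples of determinants, weighted by the star coordinates of `α` at two points. -/
def pairing (α : Form k (k + 1))
    (κ : (Fin k → Fin (2 * k + 1)) → (Fin k → Fin (2 * k + 1)) → Eucl k × Eucl k → Eucl k)
    (a b : (Fin k → Fin (2 * k + 1)) → Eucl k × Eucl k → Fin k → Eucl k)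
    (z : Eucl k × Eucl k) : ℝ :=
  ∑ I, ∑ J, starCoord (α z.1).toAlternatingMap I * starCoord (α z.2).toAlternatingMap J *
    triple (κ I J z) (a I z) (b J z)

theorem _root_.ContinuousOn.triple {X : Type*} [TopologicalSpace X] {s : Set X} {κ : X → Eucl k}
    {a b : X → Fin k → Eucl k} (hκ : ContinuousOn κ s) (ha : ContinuousOn a s)
    (hb : ContinuousOn b s) : ContinuousOn (fun z => triple (κ z) (a z) (b z)) s := by
  have h : ContinuousOn (fun z => tripleVec (κ z) (a z) (b z)) s := by
    rw [continuousOn_pi]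
    intro i
    refine Fin.cases ?_ (fun i => ?_) i
    · exact hκ
    · simp only [tripleVec, Fin.cons_succ]
      rcases (splitPair k).symm i with j | j
      · exact (continuousOn_pi.1 ha) j
      · exact (continuousOn_pi.1 hb) j
  exact (volFormC k).cont.comp_continuousOn h

section

variable {Ω : Set (Eucl k)} {α : Form k (k + 1)}
  {κ : (Fin k → Fin (2 * k + 1)) → (Fin k → Fin (2 * k + 1)) → Eucl k × Eucl k → Eucl k}
  {a b : (Fin k → Fin (2 * k + 1)) → Eucl k × Eucl k → Fin k → Eucl k}

theorem continuousOn_pairing (hα : IsClosedDirichlet Ω α)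
    (hκ : ∀ I J, ContinuousOn (κ I J) (interior Ω ×ˢ interior Ω))
    (ha : ∀ I, ContinuousOn (a I) (interior Ω ×ˢ interior Ω))
    (hb : ∀ J, ContinuousOn (b J) (interior Ω ×ˢ interior Ω)) :
    ContinuousOn (pairing α κ a b) (interior Ω ×ˢ interior Ω) := by
  refine continuousOn_finsetSum _ fun I _ => continuousOn_finsetSum _ fun J _ => ?_
  have h1 : MapsTo Prod.fst (interior Ω ×ˢ interior Ω) Ω := fun z hz => interior_subset hz.1
  have h2 : MapsTo Prod.snd (interior Ω ×ˢ interior Ω) Ω := fun z hz => interior_subset hz.2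
  have h3 : ContinuousOn (fun z : Eucl k × Eucl k => starCoord (α z.1).toAlternatingMap I)
      (interior Ω ×ˢ interior Ω) :=
    (contDiffOn_starCoord hα I).continuousOn.comp continuousOn_fst h1
  have h4 : ContinuousOn (fun z : Eucl k × Eucl k => starCoord (α z.2).toAlternatingMap J)
      (interior Ω ×ˢ interior Ω) :=
    (contDiffOn_starCoord hα J).continuousOn.comp continuousOn_snd h2
  have h5 : ContinuousOn (fun z => triple (κ I J z) (a I z) (b J z))
      (interior Ω ×ˢ interior Ω) :=
    (hκ I J).triple (ha I) (hb J)
  exact (h3.mul h4).mul h5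

/-- A bound for `pairing` in terms of a bound for the first vector alone. -/
theorem exists_abs_pairing_le (hΩ : IsCompact Ω) (hα : IsClosedDirichlet Ω α) {s : ℝ}
    (hs : 0 ≤ s) : ∃ C : ℝ, 0 ≤ C ∧ ∀ κ a b, ∀ z ∈ Ω ×ˢ Ω, ∀ r,
      (∀ I J, ‖κ I J z‖ ≤ r) → (∀ I j, ‖a I z j‖ ≤ s) → (∀ J j, ‖b J z j‖ ≤ s) →
      |pairing α κ a b z| ≤ C * r := by
  obtain ⟨A, hA0, hA⟩ := exists_abs_starCoord_le hΩ hα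
  refine ⟨∑ I : Fin k → Fin (2 * k + 1), ∑ J : Fin k → Fin (2 * k + 1),
    A * A * (‖volFormC k‖ * s ^ (2 * k)), Finset.sum_nonneg fun I _ => Finset.sum_nonneg fun J _ =>
      by positivity, fun κ a b z hz r hκ ha hb => ?_⟩
  rw [Finset.sum_mul]
  refine (Finset.abs_sum_le_sum_abs _ _).trans (Finset.sum_le_sum fun I _ => ?_)
  rw [Finset.sum_mul]
  refine (Finset.abs_sum_le_sum_abs _ _).trans (Finset.sum_le_sum fun J _ => ?_)
  rw [abs_mul, abs_mul, mul_assoc (A * A)]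
  have h1 := norm_tripleVec_le (K := κ I J z) hs (ha I) (hb J)
  have h2 : ‖volFormC k‖ * s ^ (2 * k) * ‖κ I J z‖ ≤ ‖volFormC k‖ * s ^ (2 * k) * r :=
    mul_le_mul_of_nonneg_left (hκ I J) (by positivity)
  exact mul_le_mul (mul_le_mul (hA I _ hz.1) (hA J _ hz.2) (abs_nonneg _) hA0) (h1.trans h2)
    (abs_nonneg _) (by positivity)

theorem integrableOn_prod_of_continuousOn_of_abs_le {U : Set (Eucl k)} (hU : IsOpen U)
    (hv : volume U ≠ ⊤) {F : Eucl k × Eucl k → ℝ} (hF : ContinuousOn F (U ×ˢ U)) {C : ℝ}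
    (hC : ∀ z ∈ U ×ˢ U, |F z| ≤ C) : IntegrableOn F (U ×ˢ U) := by
  have hm : MeasurableSet (U ×ˢ U) := (hU.prod hU).measurableSet
  have hfin : volume (U ×ˢ U) ≠ ⊤ := by
    rw [Measure.volume_eq_prod, Measure.prod_prod]
    exact ENNReal.mul_ne_top hv hv
  have : IsFiniteMeasure (volume.restrict (U ×ˢ U)) := ⟨by simpa [lt_top_iff_ne_top] using hfin⟩
  exact Integrable.of_bound (hF.aestronglyMeasurable hm) C
    ((ae_restrict_iff' hm).2 (Eventually.of_forall hC))

theorem integrableOn_pairing (hΩ : IsCompact Ω) (hα : IsClosedDirichlet Ω α) (s : ℝ)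
    (hκ : ∀ I J, ContinuousOn (κ I J) (interior Ω ×ˢ interior Ω))
    (ha : ∀ I, ContinuousOn (a I) (interior Ω ×ˢ interior Ω))
    (hb : ∀ J, ContinuousOn (b J) (interior Ω ×ˢ interior Ω))
    (hκ' : ∀ I J, ∀ z ∈ interior Ω ×ˢ interior Ω, ‖κ I J z‖ ≤ s)
    (ha' : ∀ I, ∀ z ∈ interior Ω ×ˢ interior Ω, ∀ j, ‖a I z j‖ ≤ s)
    (hb' : ∀ J, ∀ z ∈ interior Ω ×ˢ interior Ω, ∀ j, ‖b J z j‖ ≤ s) :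
    IntegrableOn (pairing α κ a b) (interior Ω ×ˢ interior Ω) := by
  obtain ⟨C, hC0, hC⟩ := exists_abs_pairing_le hΩ hα (abs_nonneg s)
  refine integrableOn_prod_of_continuousOn_of_abs_le isOpen_interior (volume_interior_ne_top hΩ)
    (continuousOn_pairing hα hκ ha hb) (C := C * |s|) fun z hz => ?_
  exact hC κ a b z ⟨interior_subset hz.1, interior_subset hz.2⟩ _
    (fun I J => (hκ' I J z hz).trans (le_abs_self s))
    (fun I j => (ha' I z hz j).trans (le_abs_self s))
    (fun J j => (hb' J z hz j).trans (le_abs_self s))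

end

/-! ### The first variation of the helicity density -/

/-- The density of the helicity of the image of `α` under `G`, with respect to the kernel `K`,
pulled back by `G`. -/
def linkDensity (α : Form k (k + 1)) (K G : Eucl k → Eucl k) : Eucl k × Eucl k → ℝ :=
  pairing α (fun _ _ z => K (G z.2 - G z.1)) (fun I z => frame (fderiv ℝ G z.1) I)
    (fun J z => frame (fderiv ℝ G z.2) J)

/-- The derivative of `linkDensity` when `G` moves with the velocity `w`. -/
def linkDeriv (α : Form k (k + 1)) (K G w : Eucl k → Eucl k) (z : Eucl k × Eucl k) : ℝ :=
  pairing α (fun _ _ z => fderiv ℝ K (G z.2 - G z.1) (w z.2 - w z.1))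
      (fun I z => frame (fderiv ℝ G z.1) I) (fun J z => frame (fderiv ℝ G z.2) J) z +
    ∑ m, (pairing α (fun _ _ z => K (G z.2 - G z.1))
        (fun I z => Function.update (frame (fderiv ℝ G z.1) I) m (fderiv ℝ w z.1 (stdVec (I m))))
        (fun J z => frame (fderiv ℝ G z.2) J) z +
      pairing α (fun _ _ z => K (G z.2 - G z.1)) (fun I z => frame (fderiv ℝ G z.1) I)
        (fun J z => Function.update (frame (fderiv ℝ G z.2) J) m (fderiv ℝ w z.2 (stdVec (J m)))) z)

/-- The part of `linkDeriv` that is left after integration by parts: the kernel is replaced by its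
divergence. -/
def linkDelta (α : Form k (k + 1)) (K G w : Eucl k → Eucl k) (z : Eucl k × Eucl k) : ℝ :=
  divergence K (G z.2 - G z.1) * pairing α (fun _ _ z => w z.2 - w z.1)
    (fun I z => frame (fderiv ℝ G z.1) I) (fun J z => frame (fderiv ℝ G z.2) J) z

/-- The algebra of the variation formula. The four pairings in brackets integrate to zero; what
remains is due to the fact that the derivation of the determinant induced by `DK` is
multiplication by the trace. -/
theorem linkDeriv_eq (α : Form k (k + 1)) (K G w : Eucl k → Eucl k) (z : Eucl k × Eucl k) :
    linkDeriv α K G w z = linkDelta α K G w z + ∑ m,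
      ((pairing α (fun _ _ z => K (G z.2 - G z.1)) (fun I z => Function.update
            (frame (fderiv ℝ G z.1) I) m (fderiv ℝ w z.1 (stdVec (I m))))
          (fun J z => frame (fderiv ℝ G z.2) J) z -
        pairing α (fun I _ z => fderiv ℝ K (G z.2 - G z.1) (frame (fderiv ℝ G z.1) I m))
          (fun I z => Function.update (frame (fderiv ℝ G z.1) I) m (w z.1))
          (fun J z => frame (fderiv ℝ G z.2) J) z) +
      (pairing α (fun _ _ z => K (G z.2 - G z.1)) (fun I z => frame (fderiv ℝ G z.1) I)
          (fun J z => Function.update (frame (fderiv ℝ G z.2) J) m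
            (fderiv ℝ w z.2 (stdVec (J m)))) z +
        pairing α (fun _ J z => fderiv ℝ K (G z.2 - G z.1) (frame (fderiv ℝ G z.2) J m))
          (fun I z => frame (fderiv ℝ G z.1) I)
          (fun J z => Function.update (frame (fderiv ℝ G z.2) J) m (w z.2)) z) -
      pairing α (fun _ _ z => w z.2) (fun I z => Function.update (frame (fderiv ℝ G z.1) I) m
          (fderiv ℝ K (G z.2 - G z.1) (frame (fderiv ℝ G z.1) I m)))
          (fun J z => frame (fderiv ℝ G z.2) J) z +
      pairing α (fun _ _ z => w z.1) (fun I z => frame (fderiv ℝ G z.1) I)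
          (fun J z => Function.update (frame (fderiv ℝ G z.2) J) m
          (fderiv ℝ K (G z.2 - G z.1) (frame (fderiv ℝ G z.2) J m))) z) := by
  unfold linkDeriv linkDelta pairing
  simp only [Finset.mul_sum, ← Finset.sum_add_distrib, ← Finset.sum_sub_distrib]
  rw [Finset.sum_comm (s := (Finset.univ : Finset (Fin k))),
    Finset.sum_comm (s := (Finset.univ : Finset (Fin k))),
    ← Finset.sum_add_distrib, ← Finset.sum_add_distrib]
  refine Finset.sum_congr rfl fun I _ => ?_
  rw [Finset.sum_comm (s := (Finset.univ : Finset (Fin k))),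
    Finset.sum_comm (s := (Finset.univ : Finset (Fin k))),
    ← Finset.sum_add_distrib, ← Finset.sum_add_distrib]
  refine Finset.sum_congr rfl fun J _ => ?_
  set P := fderiv ℝ K (G z.2 - G z.1) with hP
  set a := frame (fderiv ℝ G z.1) I with ha
  set b := frame (fderiv ℝ G z.2) J with hb
  set κ := K (G z.2 - G z.1) with hκ
  set s := starCoord (α z.1).toAlternatingMap I * starCoord (α z.2).toAlternatingMap J with hs
  have h1 := triple_trace (P : Eucl k →ₗ[ℝ] Eucl k) (w z.1) a b
  have h2 := triple_trace (P : Eucl k →ₗ[ℝ] Eucl k) (w z.2) a b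
  have h3 : ∀ u v : Eucl k, triple (u - v) a b = triple u a b - triple v a b := by
    intro u v
    simp only [← tripleLeft_apply, map_sub, sub_apply]
  have hdiv : divergence K (G z.2 - G z.1) = ∑ j, P (stdVec j) j := rfl
  have h4 : ∀ m, triple (P (a m)) (Function.update a m (w z.1)) b =
      -triple (w z.1) (Function.update a m (P (a m))) b := fun m =>
    triple_update_left_swap _ _ _ _ _
  have h5 : ∀ m, triple (P (b m)) a (Function.update b m (w z.2)) =
      -triple (w z.2) a (Function.update b m (P (b m))) := fun m =>
    triple_update_right_swap _ _ _ _ _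
  simp only [h4, h5, map_sub, h3, hdiv]
  simp only [ContinuousLinearMap.coe_coe] at h1 h2
  have h6 := congrArg (fun r => s * r) (congrArg₂ (· - ·) h2 h1)
  simp only [mul_neg, sub_neg_eq_add, Finset.sum_add_distrib, Finset.sum_sub_distrib,
    Finset.sum_neg_distrib, ← Finset.mul_sum]
  linear_combination h6

section

variable {Ω : Set (Eucl k)} {α : Form k (k + 1)} {κ : (Fin k → Fin (2 * k + 1)) →
  (Fin k → Fin (2 * k + 1)) → Eucl k × Eucl k → Eucl k}
  {a b : (Fin k → Fin (2 * k + 1)) → Eucl k × Eucl k → Fin k → Eucl k}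

/-- `pairing` for a fixed second point, as a sum over the first tuple. -/
theorem pairing_eq_sum_left (y : Eucl k) (I₀ : (Fin k → Fin (2 * k + 1)) → Eucl k → Eucl k)
    (hκ : ∀ I J x, κ I J (x, y) = I₀ I x) (b₀ : (Fin k → Fin (2 * k + 1)) → Fin k → Eucl k)
    (hb : ∀ J x, b J (x, y) = b₀ J) (x : Eucl k) :
    pairing α κ a b (x, y) = ∑ I, starCoord (α x).toAlternatingMap I *
      (∑ J, starCoord (α y).toAlternatingMap J • tripleLeft (b₀ J)) (I₀ I x) (a I (x, y)) := by
  unfold pairing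
  refine Finset.sum_congr rfl fun I _ => ?_
  simp only [sum_apply, smul_apply, smul_eq_mul, tripleLeft_apply, Finset.mul_sum, hκ, hb]
  refine Finset.sum_congr rfl fun J _ => ?_
  ring

/-- `pairing` for a fixed first point, as a sum over the second tuple. -/
theorem pairing_eq_sum_right (x : Eucl k) (J₀ : (Fin k → Fin (2 * k + 1)) → Eucl k → Eucl k)
    (hκ : ∀ I J y, κ I J (x, y) = J₀ J y) (a₀ : (Fin k → Fin (2 * k + 1)) → Fin k → Eucl k)
    (ha : ∀ I y, a I (x, y) = a₀ I) (y : Eucl k) :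
    pairing α κ a b (x, y) = ∑ J, starCoord (α y).toAlternatingMap J *
      (∑ I, starCoord (α x).toAlternatingMap I • tripleRight (a₀ I)) (J₀ J y) (b J (x, y)) := by
  unfold pairing
  rw [Finset.sum_comm]
  refine Finset.sum_congr rfl fun J _ => ?_
  simp only [sum_apply, smul_apply, smul_eq_mul, tripleRight_apply, Finset.mul_sum, hκ, ha]
  refine Finset.sum_congr rfl fun I _ => ?_
  ring

end

theorem continuousOn_update {X : Type*} [TopologicalSpace X] {s : Set X} {a : X → Fin k → Eucl k}
    {u : X → Eucl k} (ha : ContinuousOn a s) (hu : ContinuousOn u s) (m : Fin k) :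
    ContinuousOn (fun z => Function.update (a z) m (u z)) s := by
  rw [continuousOn_pi] at ha ⊢
  intro j
  by_cases hj : j = m
  · subst hj; simpa using hu
  · simpa [hj] using ha j

theorem norm_update_le {a : Fin k → Eucl k} {m : Fin k} {u : Eucl k} {s : ℝ} (ha : ∀ j, ‖a j‖ ≤ s)
    (hu : ‖u‖ ≤ s) (j : Fin k) : ‖Function.update a m u j‖ ≤ s := by
  by_cases hj : j = m
  · subst hj; simpa using hu
  · simpa [hj] using ha j

theorem setIntegral_prod_eq_zero_left {U : Set (Eucl k)} {F : Eucl k × Eucl k → ℝ}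
    (hF : IntegrableOn F (U ×ˢ U))
    (h : ∀ y ∈ U, ∫ x in U, F (x, y) = 0) : ∫ z in U ×ˢ U, F z = 0 := by
  rw [IntegrableOn, Measure.volume_eq_prod, ← Measure.prod_restrict] at hF
  rw [Measure.volume_eq_prod, ← Measure.prod_restrict, integral_prod_symm _ hF]
  exact setIntegral_eq_zero_of_forall_eq_zero h

theorem setIntegral_prod_eq_zero_right {U : Set (Eucl k)} {F : Eucl k × Eucl k → ℝ}
    (hF : IntegrableOn F (U ×ˢ U))
    (h : ∀ x ∈ U, ∫ y in U, F (x, y) = 0) : ∫ z in U ×ˢ U, F z = 0 := by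
  rw [IntegrableOn, Measure.volume_eq_prod, ← Measure.prod_restrict] at hF
  rw [Measure.volume_eq_prod, ← Measure.prod_restrict, integral_prod _ hF]
  exact setIntegral_eq_zero_of_forall_eq_zero h

/-- The first variation of the helicity with respect to a smooth kernel `K`: up to terms that
integrate to zero, the kernel is replaced by its divergence. -/
theorem integral_linkDeriv {Ω : Set (Eucl k)} {α : Form k (k + 1)} {G w K : Eucl k → Eucl k}
    {b : ℝ} (hΩ : IsCompactDomain Ω) (hα : IsClosedDirichlet Ω α) (hK : ContDiff ℝ ∞ K)
    (hG : ContDiffOn ℝ ∞ G (interior Ω)) (hw : ContDiffOn ℝ ∞ w (interior Ω))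
    (hGb : ∀ x ∈ interior Ω, ‖G x‖ ≤ b) (hDG : ∀ x ∈ interior Ω, ‖fderiv ℝ G x‖ ≤ b)
    (hwb : ∀ x ∈ interior Ω, ‖w x‖ ≤ b) (hDw : ∀ x ∈ interior Ω, ‖fderiv ℝ w x‖ ≤ b) :
    ∫ z in interior Ω ×ˢ interior Ω, linkDeriv α K G w z =
      ∫ z in interior Ω ×ˢ interior Ω, linkDelta α K G w z := by
  set U := interior Ω with hU
  have hUo : IsOpen U := isOpen_interior
  have hm1 : MapsTo Prod.fst (U ×ˢ U) U := fun z hz => hz.1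
  have hm2 : MapsTo Prod.snd (U ×ˢ U) U := fun z hz => hz.2
  obtain ⟨C₁, hC₁⟩ := (isCompact_closedBall (0 : Eucl k) (b + b)).exists_bound_of_continuousOn
    hK.continuous.continuousOn
  obtain ⟨C₂, hC₂⟩ := (isCompact_closedBall (0 : Eucl k) (b + b)).exists_bound_of_continuousOn
    (hK.continuous_fderiv (by simp)).continuousOn
  have hmem : ∀ x ∈ U, ∀ y ∈ U, G y - G x ∈ Metric.closedBall (0 : Eucl k) (b + b) := by
    intro x hx y hy
    rw [mem_closedBall_zero_iff]
    exact (norm_sub_le _ _).trans (add_le_add (hGb y hy) (hGb x hx))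
  set s := max b (max C₁ (C₂ * b)) with hs
  have hbs : b ≤ s := le_max_left _ _
  have hC₁s : C₁ ≤ s := (le_max_left _ _).trans (le_max_right _ _)
  have hC₂s : C₂ * b ≤ s := (le_max_right _ _).trans (le_max_right _ _)
  -- Continuity of the ingredients.
  have cDG := hG.continuousOn_fderiv_of_isOpen hUo (by simp)
  have cDw := hw.continuousOn_fderiv_of_isOpen hUo (by simp)
  have cdiff : ContinuousOn (fun z : Eucl k × Eucl k => G z.2 - G z.1) (U ×ˢ U) :=
    (hG.continuousOn.comp continuousOn_snd hm2).sub (hG.continuousOn.comp continuousOn_fst hm1)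
  have cκ : ContinuousOn (fun z : Eucl k × Eucl k => K (G z.2 - G z.1)) (U ×ˢ U) :=
    hK.continuous.comp_continuousOn cdiff
  have cP : ContinuousOn (fun z : Eucl k × Eucl k => fderiv ℝ K (G z.2 - G z.1)) (U ×ˢ U) :=
    (hK.continuous_fderiv (by simp)).comp_continuousOn cdiff
  have cD1 : ∀ i, ContinuousOn (fun z : Eucl k × Eucl k => fderiv ℝ G z.1 (stdVec i)) (U ×ˢ U) :=
    fun i => (cDG.comp continuousOn_fst hm1).clm_apply continuousOn_const
  have cD2 : ∀ i, ContinuousOn (fun z : Eucl k × Eucl k => fderiv ℝ G z.2 (stdVec i)) (U ×ˢ U) :=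
    fun i => (cDG.comp continuousOn_snd hm2).clm_apply continuousOn_const
  have cW1 : ∀ i, ContinuousOn (fun z : Eucl k × Eucl k => fderiv ℝ w z.1 (stdVec i)) (U ×ˢ U) :=
    fun i => (cDw.comp continuousOn_fst hm1).clm_apply continuousOn_const
  have cW2 : ∀ i, ContinuousOn (fun z : Eucl k × Eucl k => fderiv ℝ w z.2 (stdVec i)) (U ×ˢ U) :=
    fun i => (cDw.comp continuousOn_snd hm2).clm_apply continuousOn_const
  have cw1 : ContinuousOn (fun z : Eucl k × Eucl k => w z.1) (U ×ˢ U) :=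
    hw.continuousOn.comp continuousOn_fst hm1
  have cw2 : ContinuousOn (fun z : Eucl k × Eucl k => w z.2) (U ×ˢ U) :=
    hw.continuousOn.comp continuousOn_snd hm2
  have ca : ∀ I : Fin k → Fin (2 * k + 1),
      ContinuousOn (fun z : Eucl k × Eucl k => frame (fderiv ℝ G z.1) I) (U ×ˢ U) :=
    fun I => continuousOn_pi.2 fun j => cD1 (I j)
  have cb : ∀ I : Fin k → Fin (2 * k + 1),
      ContinuousOn (fun z : Eucl k × Eucl k => frame (fderiv ℝ G z.2) I) (U ×ˢ U) :=
    fun I => continuousOn_pi.2 fun j => cD2 (I j)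
  have cPa : ∀ (I : Fin k → Fin (2 * k + 1)) m, ContinuousOn (fun z : Eucl k × Eucl k =>
      fderiv ℝ K (G z.2 - G z.1) (frame (fderiv ℝ G z.1) I m)) (U ×ˢ U) :=
    fun I m => cP.clm_apply (cD1 (I m))
  have cPb : ∀ (I : Fin k → Fin (2 * k + 1)) m, ContinuousOn (fun z : Eucl k × Eucl k =>
      fderiv ℝ K (G z.2 - G z.1) (frame (fderiv ℝ G z.2) I m)) (U ×ˢ U) :=
    fun I m => cP.clm_apply (cD2 (I m))
  -- Bounds of the ingredients.
  have bκ : ∀ z ∈ U ×ˢ U, ‖K (G z.2 - G z.1)‖ ≤ s := fun z hz =>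
    (hC₁ _ (hmem _ hz.1 _ hz.2)).trans hC₁s
  have ba : ∀ (I : Fin k → Fin (2 * k + 1)), ∀ z ∈ U ×ˢ U, ∀ j,
      ‖frame (fderiv ℝ G z.1) I j‖ ≤ s := fun I z hz j => (norm_frame_le (hDG _ hz.1) I j).trans hbs
  have bb : ∀ (I : Fin k → Fin (2 * k + 1)), ∀ z ∈ U ×ˢ U, ∀ j,
      ‖frame (fderiv ℝ G z.2) I j‖ ≤ s := fun I z hz j => (norm_frame_le (hDG _ hz.2) I j).trans hbs
  have bP : ∀ z ∈ U ×ˢ U, ∀ u, ‖u‖ ≤ b → ‖fderiv ℝ K (G z.2 - G z.1) u‖ ≤ s := by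
    intro z hz u hu
    have h1 := hC₂ _ (hmem _ hz.1 _ hz.2)
    refine ((ContinuousLinearMap.le_opNorm _ _).trans ?_).trans hC₂s
    exact mul_le_mul h1 hu (norm_nonneg _) ((norm_nonneg _).trans h1)
  have bPa : ∀ (I : Fin k → Fin (2 * k + 1)) m, ∀ z ∈ U ×ˢ U,
      ‖fderiv ℝ K (G z.2 - G z.1) (frame (fderiv ℝ G z.1) I m)‖ ≤ s := fun I m z hz =>
    bP z hz _ (norm_frame_le (hDG _ hz.1) I m)
  have bPb : ∀ (I : Fin k → Fin (2 * k + 1)) m, ∀ z ∈ U ×ˢ U,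
      ‖fderiv ℝ K (G z.2 - G z.1) (frame (fderiv ℝ G z.2) I m)‖ ≤ s := fun I m z hz =>
    bP z hz _ (norm_frame_le (hDG _ hz.2) I m)
  have bW : ∀ x ∈ U, ∀ i, ‖fderiv ℝ w x (stdVec i)‖ ≤ s := fun x hx i =>
    ((ContinuousLinearMap.le_opNorm _ _).trans
      (by rw [norm_stdVec, mul_one]; exact hDw x hx)).trans hbs
  -- The kernel as a function of one of the points.
  have hφd : ∀ y, ContDiffOn ℝ ∞ (fun x => K (G y - G x)) U := fun y =>
    hK.comp_contDiffOn (contDiffOn_const.sub hG)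
  have hψd : ∀ x, ContDiffOn ℝ ∞ (fun y => K (G y - G x)) U := fun x =>
    hK.comp_contDiffOn (hG.sub contDiffOn_const)
  have hGat : ∀ x ∈ U, HasFDerivAt G (fderiv ℝ G x) x := fun x hx =>
    ((hG.contDiffAt (hUo.mem_nhds hx)).differentiableAt (by simp)).hasFDerivAt
  have hKat : ∀ u, HasFDerivAt K (fderiv ℝ K u) u := fun u =>
    (hK.differentiable (by simp) u).hasFDerivAt
  have hφ' : ∀ y, ∀ x ∈ U, ∀ e, fderiv ℝ (fun x => K (G y - G x)) x e =
      -fderiv ℝ K (G y - G x) (fderiv ℝ G x e) := by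
    intro y x hx e
    have h : HasFDerivAt (fun x => K (G y - G x)) _ x :=
      (hKat (G y - G x)).comp x ((hGat x hx).const_sub (G y))
    rw [h.fderiv]
    simp
  have hψ' : ∀ x, ∀ y ∈ U, ∀ e, fderiv ℝ (fun y => K (G y - G x)) y e =
      fderiv ℝ K (G y - G x) (fderiv ℝ G y e) := by
    intro x y hy e
    have h : HasFDerivAt (fun y => K (G y - G x)) _ y :=
      (hKat (G y - G x)).comp y ((hGat y hy).sub_const (G x))
    rw [h.fderiv]
    simp
  have hφb : ∀ y ∈ U, ∀ x ∈ U, ‖fderiv ℝ (fun x => K (G y - G x)) x‖ ≤ s := by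
    intro y hy x hx
    have hb0 : 0 ≤ b := (norm_nonneg _).trans (hDG x hx)
    have h1 := hC₂ _ (hmem _ hx _ hy)
    refine (ContinuousLinearMap.opNorm_le_bound _ (mul_nonneg ((norm_nonneg _).trans h1) hb0)
      fun e => ?_).trans hC₂s
    rw [hφ' y x hx, norm_neg, mul_assoc]
    refine (ContinuousLinearMap.le_opNorm _ _).trans ?_
    refine mul_le_mul h1 ?_ (norm_nonneg _) ((norm_nonneg _).trans h1)
    exact (ContinuousLinearMap.le_opNorm _ _).trans
      (mul_le_mul_of_nonneg_right (hDG x hx) (norm_nonneg _))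
  have hψb : ∀ x ∈ U, ∀ y ∈ U, ‖fderiv ℝ (fun y => K (G y - G x)) y‖ ≤ s := by
    intro x hx y hy
    have hb0 : 0 ≤ b := (norm_nonneg _).trans (hDG x hx)
    have h1 := hC₂ _ (hmem _ hx _ hy)
    refine (ContinuousLinearMap.opNorm_le_bound _ (mul_nonneg ((norm_nonneg _).trans h1) hb0)
      fun e => ?_).trans hC₂s
    rw [hψ' x y hy, mul_assoc]
    refine (ContinuousLinearMap.le_opNorm _ _).trans ?_
    refine mul_le_mul h1 ?_ (norm_nonneg _) ((norm_nonneg _).trans h1)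
    exact (ContinuousLinearMap.le_opNorm _ _).trans
      (mul_le_mul_of_nonneg_right (hDG y hy) (norm_nonneg _))
  have hG2 : ContDiffOn ℝ 2 G U := hG.of_le (WithTop.coe_le_coe.2 (le_top : (2 : ℕ∞) ≤ ⊤))
  have hw2 : ContDiffOn ℝ 2 w U := hw.of_le (WithTop.coe_le_coe.2 (le_top : (2 : ℕ∞) ≤ ⊤))
  have hφ2 : ∀ y, ContDiffOn ℝ 2 (fun x => K (G y - G x)) U := fun y =>
    (hφd y).of_le (WithTop.coe_le_coe.2 (le_top : (2 : ℕ∞) ≤ ⊤))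
  have hψ2 : ∀ x, ContDiffOn ℝ 2 (fun y => K (G y - G x)) U := fun x =>
    (hψd x).of_le (WithTop.coe_le_coe.2 (le_top : (2 : ℕ∞) ≤ ⊤))
  have bDG : ∀ x ∈ U, ‖fderiv ℝ G x‖ ≤ s := fun x hx => (hDG x hx).trans hbs
  have bDw : ∀ x ∈ U, ‖fderiv ℝ w x‖ ≤ s := fun x hx => (hDw x hx).trans hbs
  have bw : ∀ x ∈ U, ‖w x‖ ≤ s := fun x hx => (hwb x hx).trans hbs
  -- Integrability of the pairings.
  have i1 : ∀ m, IntegrableOn (pairing α (fun _ _ z => K (G z.2 - G z.1))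
      (fun I z => Function.update (frame (fderiv ℝ G z.1) I) m (fderiv ℝ w z.1 (stdVec (I m))))
      (fun J z => frame (fderiv ℝ G z.2) J)) (U ×ˢ U) := fun m =>
    integrableOn_pairing hΩ.isCompact hα s (fun _ _ => cκ)
      (fun I => continuousOn_update (ca I) (cW1 (I m)) m)
      cb (fun _ _ => bκ) (fun I z hz => norm_update_le (ba I z hz) (bW _ hz.1 _)) bb
  have i2 : ∀ m, IntegrableOn (pairing α
      (fun I _ z => fderiv ℝ K (G z.2 - G z.1) (frame (fderiv ℝ G z.1) I m))
      (fun I z => Function.update (frame (fderiv ℝ G z.1) I) m (w z.1))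
      (fun J z => frame (fderiv ℝ G z.2) J)) (U ×ˢ U) := fun m =>
    integrableOn_pairing hΩ.isCompact hα s (fun I _ => cPa I m)
      (fun I => continuousOn_update (ca I) cw1 m)
      cb (fun I _ => bPa I m) (fun I z hz => norm_update_le (ba I z hz) (bw _ hz.1)) bb
  have i3 : ∀ m, IntegrableOn (pairing α (fun _ _ z => K (G z.2 - G z.1))
      (fun I z => frame (fderiv ℝ G z.1) I)
      (fun J z => Function.update (frame (fderiv ℝ G z.2) J) m
        (fderiv ℝ w z.2 (stdVec (J m))))) (U ×ˢ U) := fun m =>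
    integrableOn_pairing hΩ.isCompact hα s (fun _ _ => cκ) ca
      (fun J => continuousOn_update (cb J) (cW2 (J m)) m)
      (fun _ _ => bκ) ba (fun J z hz => norm_update_le (bb J z hz) (bW _ hz.2 _))
  have i4 : ∀ m, IntegrableOn (pairing α
      (fun _ J z => fderiv ℝ K (G z.2 - G z.1) (frame (fderiv ℝ G z.2) J m))
      (fun I z => frame (fderiv ℝ G z.1) I)
      (fun J z => Function.update (frame (fderiv ℝ G z.2) J) m (w z.2))) (U ×ˢ U) := fun m =>
    integrableOn_pairing hΩ.isCompact hα s (fun _ J => cPb J m) ca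
      (fun J => continuousOn_update (cb J) cw2 m)
      (fun _ J => bPb J m) ba (fun J z hz => norm_update_le (bb J z hz) (bw _ hz.2))
  have i5 : ∀ m, IntegrableOn (pairing α (fun _ _ z => w z.2)
      (fun I z => Function.update (frame (fderiv ℝ G z.1) I) m
        (fderiv ℝ K (G z.2 - G z.1) (frame (fderiv ℝ G z.1) I m)))
      (fun J z => frame (fderiv ℝ G z.2) J)) (U ×ˢ U) := fun m =>
    integrableOn_pairing hΩ.isCompact hα s (fun _ _ => cw2)
      (fun I => continuousOn_update (ca I) (cPa I m) m)
      cb (fun _ _ z hz => bw _ hz.2)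
      (fun I z hz => norm_update_le (ba I z hz) (bPa I m z hz)) bb
  have i6 : ∀ m, IntegrableOn (pairing α (fun _ _ z => w z.1)
      (fun I z => frame (fderiv ℝ G z.1) I)
      (fun J z => Function.update (frame (fderiv ℝ G z.2) J) m
        (fderiv ℝ K (G z.2 - G z.1) (frame (fderiv ℝ G z.2) J m)))) (U ×ˢ U) := fun m =>
    integrableOn_pairing hΩ.isCompact hα s (fun _ _ => cw1) ca
      (fun J => continuousOn_update (cb J) (cPb J m) m)
      (fun _ _ z hz => bw _ hz.1) ba
      (fun J z hz => norm_update_le (bb J z hz) (bPb J m z hz))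
  have i0 : IntegrableOn (linkDelta α K G w) (U ×ˢ U) := by
    have hp : IntegrableOn (pairing α (fun _ _ z => w z.2 - w z.1)
        (fun I z => frame (fderiv ℝ G z.1) I) (fun J z => frame (fderiv ℝ G z.2) J)) (U ×ˢ U) :=
      integrableOn_pairing hΩ.isCompact hα (s + s) (fun _ _ => cw2.sub cw1) ca cb
        (fun _ _ z hz => (norm_sub_le _ _).trans (add_le_add (bw _ hz.2) (bw _ hz.1)))
        (fun I z hz j => (ba I z hz j).trans (by linarith [(norm_nonneg _).trans (bw _ hz.1)]))
        (fun I z hz j => (bb I z hz j).trans (by linarith [(norm_nonneg _).trans (bw _ hz.1)]))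
    have hdc : Continuous (divergence K) := by
      unfold divergence
      exact continuous_finsetSum _ fun i _ =>
        (EuclideanSpace.proj i : Eucl k →L[ℝ] ℝ).continuous.comp
        ((hK.continuous_fderiv (by simp)).clm_apply continuous_const)
    obtain ⟨C₃, hC₃⟩ := (isCompact_closedBall (0 : Eucl k) (b + b)).exists_bound_of_continuousOn
      hdc.continuousOn
    have hm : MeasurableSet (U ×ˢ U) := (hUo.prod hUo).measurableSet
    refine Integrable.bdd_mul (c := C₃) hp
      ((hdc.comp_continuousOn cdiff).aestronglyMeasurable hm) ?_
    exact (ae_restrict_iff' hm).2 (Eventually.of_forall fun z hz => hC₃ _ (hmem _ hz.1 _ hz.2))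
  have z1 : ∀ m, ∫ z in U ×ˢ U, (pairing α (fun _ _ z => K (G z.2 - G z.1)) (fun I z =>
            Function.update (frame (fderiv ℝ G z.1) I) m (fderiv ℝ w z.1 (stdVec (I m))))
          (fun J z => frame (fderiv ℝ G z.2) J) z -
        pairing α (fun I _ z => fderiv ℝ K (G z.2 - G z.1) (frame (fderiv ℝ G z.1) I m))
          (fun I z => Function.update (frame (fderiv ℝ G z.1) I) m (w z.1))
          (fun J z => frame (fderiv ℝ G z.2) J) z) = 0 := by
    intro m
    refine setIntegral_prod_eq_zero_left ((i1 m).sub (i2 m)) fun y hy => ?_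
    rw [← integral_sum_starCoord_update_add_eq_zero hΩ hα hG2 (hφ2 y) hw2 bDG
      (fun x hx => bκ (x, y) ⟨hx, hy⟩) (hφb y hy) bw bDw m
      (∑ J, starCoord (α y).toAlternatingMap J • tripleLeft (frame (fderiv ℝ G y) J))]
    refine setIntegral_congr_fun hUo.measurableSet fun x hx => ?_
    rw [pairing_eq_sum_left y (fun _ x => K (G y - G x)) (fun _ _ _ => rfl)
        (fun J => frame (fderiv ℝ G y) J) (fun _ _ => rfl) x,
      pairing_eq_sum_left y (fun I x => fderiv ℝ K (G y - G x) (frame (fderiv ℝ G x) I m))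
        (fun _ _ _ => rfl) (fun J => frame (fderiv ℝ G y) J) (fun _ _ => rfl) x,
      ← Finset.sum_sub_distrib]
    refine Finset.sum_congr rfl fun I _ => ?_
    rw [hφ' y x hx, map_neg, neg_apply, ← sub_eq_add_neg, mul_sub]
    rfl
  have z2 : ∀ m, ∫ z in U ×ˢ U, (pairing α (fun _ _ z => K (G z.2 - G z.1))
          (fun I z => frame (fderiv ℝ G z.1) I)
          (fun J z => Function.update (frame (fderiv ℝ G z.2) J) m
            (fderiv ℝ w z.2 (stdVec (J m)))) z +
        pairing α (fun _ J z => fderiv ℝ K (G z.2 - G z.1) (frame (fderiv ℝ G z.2) J m))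
          (fun I z => frame (fderiv ℝ G z.1) I)
          (fun J z => Function.update (frame (fderiv ℝ G z.2) J) m (w z.2)) z) = 0 := by
    intro m
    refine setIntegral_prod_eq_zero_right ((i3 m).add (i4 m)) fun x hx => ?_
    rw [← integral_sum_starCoord_update_add_eq_zero hΩ hα hG2 (hψ2 x) hw2 bDG
      (fun y hy => bκ (x, y) ⟨hx, hy⟩) (hψb x hx) bw bDw m
      (∑ I, starCoord (α x).toAlternatingMap I • tripleRight (frame (fderiv ℝ G x) I))]
    refine setIntegral_congr_fun hUo.measurableSet fun y hy => ?_
    rw [pairing_eq_sum_right x (fun _ y => K (G y - G x)) (fun _ _ _ => rfl)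
        (fun I => frame (fderiv ℝ G x) I) (fun _ _ => rfl) y,
      pairing_eq_sum_right x (fun J y => fderiv ℝ K (G y - G x) (frame (fderiv ℝ G y) J m))
        (fun _ _ _ => rfl) (fun I => frame (fderiv ℝ G x) I) (fun _ _ => rfl) y,
      ← Finset.sum_add_distrib]
    refine Finset.sum_congr rfl fun J _ => ?_
    rw [hψ' x y hy, mul_add]
    rfl
  have z3 : ∀ m, ∫ z in U ×ˢ U, pairing α (fun _ _ z => w z.2)
      (fun I z => Function.update (frame (fderiv ℝ G z.1) I) m
        (fderiv ℝ K (G z.2 - G z.1) (frame (fderiv ℝ G z.1) I m)))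
      (fun J z => frame (fderiv ℝ G z.2) J) z = 0 := by
    intro m
    refine setIntegral_prod_eq_zero_left (i5 m) fun y hy => ?_
    have hneg : ∀ x, fderiv ℝ (fun x => -K (G y - G x)) x =
        -fderiv ℝ (fun x => K (G y - G x)) x := fun x => fderiv_fun_neg
    rw [← (integral_sum_starCoord_update_eq_zero hΩ hα hG2 (hφ2 y).neg bDG
      (fun x hx => by rw [norm_neg]; exact bκ (x, y) ⟨hx, hy⟩)
      (fun x hx => by rw [hneg, norm_neg]; exact hφb y hy x hx) m
      ((∑ J, starCoord (α y).toAlternatingMap J • tripleLeft (frame (fderiv ℝ G y) J)) (w y))).2]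
    refine setIntegral_congr_fun hUo.measurableSet fun x hx => ?_
    rw [pairing_eq_sum_left y (fun _ _ => w y) (fun _ _ _ => rfl)
        (fun J => frame (fderiv ℝ G y) J) (fun _ _ => rfl) x]
    refine Finset.sum_congr rfl fun I _ => ?_
    rw [hneg, neg_apply, hφ' y x hx, neg_neg]
    rfl
  have z4 : ∀ m, ∫ z in U ×ˢ U, pairing α (fun _ _ z => w z.1)
      (fun I z => frame (fderiv ℝ G z.1) I)
      (fun J z => Function.update (frame (fderiv ℝ G z.2) J) m
        (fderiv ℝ K (G z.2 - G z.1) (frame (fderiv ℝ G z.2) J m))) z = 0 := by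
    intro m
    refine setIntegral_prod_eq_zero_right (i6 m) fun x hx => ?_
    rw [← (integral_sum_starCoord_update_eq_zero hΩ hα hG2 (hψ2 x) bDG
      (fun y hy => bκ (x, y) ⟨hx, hy⟩) (hψb x hx) m
      ((∑ I, starCoord (α x).toAlternatingMap I • tripleRight (frame (fderiv ℝ G x) I)) (w x))).2]
    refine setIntegral_congr_fun hUo.measurableSet fun y hy => ?_
    rw [pairing_eq_sum_right x (fun _ _ => w x) (fun _ _ _ => rfl)
        (fun I => frame (fderiv ℝ G x) I) (fun _ _ => rfl) y]
    refine Finset.sum_congr rfl fun J _ => ?_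
    rw [hψ' x y hy]
    rfl
  rw [setIntegral_congr_fun (hUo.prod hUo).measurableSet fun z _ => linkDeriv_eq α K G w z]
  let p : Fin k → Eucl k × Eucl k → ℝ := fun m z =>
    (pairing α (fun _ _ z => K (G z.2 - G z.1)) (fun I z => Function.update
            (frame (fderiv ℝ G z.1) I) m (fderiv ℝ w z.1 (stdVec (I m))))
          (fun J z => frame (fderiv ℝ G z.2) J) z -
        pairing α (fun I _ z => fderiv ℝ K (G z.2 - G z.1) (frame (fderiv ℝ G z.1) I m))
          (fun I z => Function.update (frame (fderiv ℝ G z.1) I) m (w z.1))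
          (fun J z => frame (fderiv ℝ G z.2) J) z)
  let q : Fin k → Eucl k × Eucl k → ℝ := fun m z =>
    (pairing α (fun _ _ z => K (G z.2 - G z.1)) (fun I z => frame (fderiv ℝ G z.1) I)
          (fun J z => Function.update (frame (fderiv ℝ G z.2) J) m
            (fderiv ℝ w z.2 (stdVec (J m)))) z +
        pairing α (fun _ J z => fderiv ℝ K (G z.2 - G z.1) (frame (fderiv ℝ G z.2) J m))
          (fun I z => frame (fderiv ℝ G z.1) I)
          (fun J z => Function.update (frame (fderiv ℝ G z.2) J) m (w z.2)) z)
  let r : Fin k → Eucl k × Eucl k → ℝ := fun m z =>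
    pairing α (fun _ _ z => w z.2) (fun I z => Function.update (frame (fderiv ℝ G z.1) I) m
          (fderiv ℝ K (G z.2 - G z.1) (frame (fderiv ℝ G z.1) I m)))
          (fun J z => frame (fderiv ℝ G z.2) J) z
  let t : Fin k → Eucl k × Eucl k → ℝ := fun m z =>
    pairing α (fun _ _ z => w z.1) (fun I z => frame (fderiv ℝ G z.1) I)
          (fun J z => Function.update (frame (fderiv ℝ G z.2) J) m
          (fderiv ℝ K (G z.2 - G z.1) (frame (fderiv ℝ G z.2) J m))) z
  have ip : ∀ m, IntegrableOn (p m) (U ×ˢ U) := fun m => (i1 m).sub (i2 m)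
  have iq : ∀ m, IntegrableOn (q m) (U ×ˢ U) := fun m => (i3 m).add (i4 m)
  have ipq : ∀ m, IntegrableOn (fun z => p m z + q m z) (U ×ˢ U) := fun m => (ip m).add (iq m)
  have ipqr : ∀ m, IntegrableOn (fun z => p m z + q m z - r m z) (U ×ˢ U) := fun m =>
    (ipq m).sub (i5 m)
  have ipqrt : ∀ m, IntegrableOn (fun z => p m z + q m z - r m z + t m z) (U ×ˢ U) := fun m =>
    (ipqr m).add (i6 m)
  have hzero : ∀ m, ∫ z in U ×ˢ U, (p m z + q m z - r m z + t m z) = 0 := by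
    intro m
    rw [integral_add (ipqr m) (i6 m), integral_sub (ipq m) (i5 m), integral_add (ip m) (iq m),
      z1, z2, z3, z4]
    ring
  change ∫ z in U ×ˢ U, (linkDelta α K G w z + ∑ m, (p m z + q m z - r m z + t m z)) = _
  rw [integral_add i0 (integrable_finsetSum _ fun m _ => ipqrt m),
    integral_finsetSum _ fun m _ => ipqrt m, Finset.sum_eq_zero fun m _ => hzero m, add_zero]

/-! ### Integrals that concentrate on the diagonal -/

section

variable {U : Set (Eucl k)} {G w : Eucl k → Eucl k} {b c : ℝ}

/-- Change of variables under an injective map whose Jacobian is bounded below. -/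
theorem lintegral_comp_le (hU : IsOpen U) (hG : ContDiffOn ℝ ∞ G U) (hinj : InjOn G U)
    (hc : 0 < c) (hdet : ∀ x ∈ U, c ≤ (fderiv ℝ G x).det) (f : Eucl k → ENNReal) :
    ∫⁻ y in U, f (G y) ≤ (ENNReal.ofReal c)⁻¹ * ∫⁻ q in G '' U, f q := by
  have hd : ∀ x ∈ U, HasFDerivWithinAt G (fderiv ℝ G x) U x := fun x hx =>
    ((hG.contDiffAt (hU.mem_nhds hx)).differentiableAt (by simp)).hasFDerivAt.hasFDerivWithinAt
  rw [lintegral_image_eq_lintegral_abs_det_fderiv_mul volume hU.measurableSet hd hinj]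
  have hc0 : ENNReal.ofReal c ≠ 0 := by simpa using hc
  calc ∫⁻ y in U, f (G y)
      = (ENNReal.ofReal c)⁻¹ * ∫⁻ y in U, ENNReal.ofReal c * f (G y) := by
        rw [lintegral_const_mul' _ _ ENNReal.ofReal_ne_top, ← mul_assoc,
          ENNReal.inv_mul_cancel hc0 ENNReal.ofReal_ne_top, one_mul]
    _ ≤ _ := by
        refine mul_le_mul_right (setLIntegral_mono' hU.measurableSet fun x hx => ?_) _
        refine mul_le_mul_left (ENNReal.ofReal_le_ofReal ?_) _
        exact (hdet x hx).trans (le_abs_self _)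

/-- The total mass of the approximate delta function, pulled back by a map whose Jacobian is at
least `c`, is bounded by this constant. -/
def deltaMass (k : ℕ) (c : ℝ) : ENNReal :=
  (ENNReal.ofReal c)⁻¹ * ENNReal.ofReal (∫ z : Eucl k, regDelta k 1 z)

theorem deltaMass_ne_top (hc : 0 < c) : deltaMass k c ≠ ⊤ :=
  ENNReal.mul_ne_top (ENNReal.inv_ne_top.2 (by simpa using hc)) ENNReal.ofReal_ne_top

theorem lintegral_regDelta_comp_le (hU : IsOpen U) (hG : ContDiffOn ℝ ∞ G U) (hinj : InjOn G U)
    (hc : 0 < c) (hdet : ∀ x ∈ U, c ≤ (fderiv ℝ G x).det) {ε : ℝ} (hε : 0 < ε) (p : Eucl k) :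
    ∫⁻ y in U, ENNReal.ofReal (regDelta k ε (G y - p)) ≤ deltaMass k c := by
  refine (lintegral_comp_le hU hG hinj hc hdet
    fun q => ENNReal.ofReal (regDelta k ε (q - p))).trans (mul_le_mul_right ?_ _)
  refine (setLIntegral_le_lintegral _ _).trans_eq ?_
  rw [lintegral_sub_right_eq_self (fun q => ENNReal.ofReal (regDelta k ε q)) p,
    lintegral_regDelta hε]

/-- The integral over one of the points of the approximate delta function, weighted with the
increment of `w`, is bounded. -/
theorem lintegral_regDelta_mul_le (hU : IsOpen U) (hG : ContDiffOn ℝ ∞ G U) (hinj : InjOn G U)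
    (hc : 0 < c) (hdet : ∀ x ∈ U, c ≤ (fderiv ℝ G x).det) (hwb : ∀ x ∈ U, ‖w x‖ ≤ b) {ε : ℝ}
    (hε : 0 < ε) {x : Eucl k} (hx : x ∈ U) :
    ∫⁻ y in U, ENNReal.ofReal (regDelta k ε (G y - G x)) * ‖w y - w x‖ₑ ≤
      deltaMass k c * ENNReal.ofReal (b + b) := by
  refine (setLIntegral_mono' hU.measurableSet fun y hy => mul_le_mul_right
    (b := ‖w y - w x‖ₑ) (c := ENNReal.ofReal (b + b)) ?_ _).trans ?_
  · rw [← ofReal_norm]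
    exact ENNReal.ofReal_le_ofReal ((norm_sub_le _ _).trans (add_le_add (hwb y hy) (hwb x hx)))
  · rw [lintegral_mul_const' _ _ ENNReal.ofReal_ne_top]
    exact mul_le_mul_left (lintegral_regDelta_comp_le hU hG hinj hc hdet hε _) _

/-- The weighted integral of the approximate delta function tends to zero, because the increment
of `w` vanishes on the diagonal. -/
theorem tendsto_lintegral_regDelta_mul (hU : IsOpen U) (hUv : volume U ≠ ⊤)
    (hG : ContDiffOn ℝ ∞ G U) (hinj : InjOn G U) (hc : 0 < c)
    (hdet : ∀ x ∈ U, c ≤ (fderiv ℝ G x).det) (hw : ContinuousOn w U)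
    (hwb : ∀ x ∈ U, ‖w x‖ ≤ b) {x : Eucl k} (hx : x ∈ U) :
    Tendsto (fun ε => ∫⁻ y in U, ENNReal.ofReal (regDelta k ε (G y - G x)) * ‖w y - w x‖ₑ)
      (𝓝[>] 0) (𝓝 0) := by
  rw [ENNReal.tendsto_nhds_zero]
  intro e he
  have he2 : e / 2 ≠ 0 := (ENNReal.half_pos he.ne').ne'
  obtain ⟨η, hη, hηe⟩ := ENNReal.exists_nnreal_pos_mul_lt (deltaMass_ne_top (k := k) hc) he2
  -- Points whose images are close to `G x` are close to `x`, since `G` is open and injective.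
  obtain ⟨δ, hδ, hδw⟩ : ∃ δ > 0, ∀ y ∈ U, ‖G y - G x‖ < δ → ‖w y - w x‖ ≤ η := by
    have h1 : {y | ‖w y - w x‖ ≤ η} ∩ U ∈ 𝓝 x := by
      refine inter_mem ?_ (hU.mem_nhds hx)
      have h2 : Tendsto w (𝓝 x) (𝓝 (w x)) := hw.continuousAt (hU.mem_nhds hx)
      filter_upwards [h2 (Metric.closedBall_mem_nhds (w x) (ε := (η : ℝ)) (by exact_mod_cast hη))]
        with y hy
      simpa [dist_eq_norm] using hy
    have h3 := image_mem_nhds_of_det_ne_zero h1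
      ((hG.contDiffAt (hU.mem_nhds hx)).hasStrictFDerivAt (by simp))
      (hc.trans_le (hdet x hx)).ne'
    obtain ⟨δ, hδ, hball⟩ := Metric.mem_nhds_iff.1 h3
    refine ⟨δ, hδ, fun y hy hlt => ?_⟩
    obtain ⟨y', hy', he'⟩ := hball (show G y ∈ Metric.ball (G x) δ by rwa [mem_ball_iff_norm])
    rw [← hinj hy'.2 hy he']
    exact hy'.1
  set D : ℝ → ℝ := fun ε =>
    (2 * k + 1) * ε ^ 2 * (δ ^ 2) ^ (-((2 * k + 1 : ℝ) / 2) - 1) with hD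
  have hlim : Tendsto (fun ε => ENNReal.ofReal (D ε) * ENNReal.ofReal (b + b) * volume U)
      (𝓝[>] 0) (𝓝 0) := by
    have h1 : Tendsto D (𝓝 0) (𝓝 0) := by
      have : Continuous D := by fun_prop
      have h2 := this.tendsto 0
      simpa [hD] using h2
    have h2 : Tendsto (fun ε => ENNReal.ofReal (D ε)) (𝓝[>] 0) (𝓝 0) := by
      have := ENNReal.tendsto_ofReal (h1.mono_left (nhdsWithin_le_nhds (s := Ioi 0)))
      simpa using this
    have h3 := ENNReal.Tendsto.mul_const (ENNReal.Tendsto.mul_const h2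
      (b := ENNReal.ofReal (b + b)) (Or.inr ENNReal.ofReal_ne_top)) (b := volume U) (Or.inr hUv)
    simpa using h3
  filter_upwards [self_mem_nhdsWithin, (ENNReal.tendsto_nhds_zero.1 hlim) (e / 2)
    (pos_iff_ne_zero.2 he2)] with ε hε hεe
  have hε0 : 0 < ε := hε
  have hpt : ∀ y ∈ U, ENNReal.ofReal (regDelta k ε (G y - G x)) * ‖w y - w x‖ₑ ≤
      η * ENNReal.ofReal (regDelta k ε (G y - G x)) +
        ENNReal.ofReal (D ε) * ENNReal.ofReal (b + b) := by
    intro y hy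
    rcases lt_or_ge ‖G y - G x‖ δ with h | h
    · refine le_add_right ?_
      rw [mul_comm]
      refine mul_le_mul_left ?_ _
      rw [← ofReal_norm]
      exact ENNReal.ofReal_le_of_le_toReal (by simpa using hδw y hy h)
    · refine le_add_left (mul_le_mul' (ENNReal.ofReal_le_ofReal (regDelta_le hε0 hδ h)) ?_)
      rw [← ofReal_norm]
      exact ENNReal.ofReal_le_ofReal ((norm_sub_le _ _).trans (add_le_add (hwb y hy) (hwb x hx)))
  calc ∫⁻ y in U, ENNReal.ofReal (regDelta k ε (G y - G x)) * ‖w y - w x‖ₑ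
      ≤ ∫⁻ y in U, (η * ENNReal.ofReal (regDelta k ε (G y - G x)) +
        ENNReal.ofReal (D ε) * ENNReal.ofReal (b + b)) := setLIntegral_mono' hU.measurableSet hpt
    _ = η * (∫⁻ y in U, ENNReal.ofReal (regDelta k ε (G y - G x))) +
        ENNReal.ofReal (D ε) * ENNReal.ofReal (b + b) * volume U := by
        rw [lintegral_add_right _ measurable_const, lintegral_const_mul' _ _ ENNReal.coe_ne_top,
          setLIntegral_const]
    _ ≤ e / 2 + e / 2 := add_le_add ((mul_le_mul_right
        (lintegral_regDelta_comp_le hU hG hinj hc hdet hε0 _) _).trans hηe.le) hεe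
    _ = e := ENNReal.add_halves e

theorem aemeasurable_regDelta_mul (hU : IsOpen U) (hG : ContDiffOn ℝ ∞ G U)
    (hw : ContinuousOn w U) {ε : ℝ} (hε : 0 < ε) :
    AEMeasurable (fun z : Eucl k × Eucl k =>
      ENNReal.ofReal (regDelta k ε (G z.2 - G z.1)) * ‖w z.2 - w z.1‖ₑ)
      (volume.restrict (U ×ˢ U)) := by
  have hm1 : MapsTo Prod.fst (U ×ˢ U) U := fun z hz => hz.1
  have hm2 : MapsTo Prod.snd (U ×ˢ U) U := fun z hz => hz.2
  have h1 : ContinuousOn (fun z : Eucl k × Eucl k => G z.2 - G z.1) (U ×ˢ U) :=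
    (hG.continuousOn.comp continuousOn_snd hm2).sub (hG.continuousOn.comp continuousOn_fst hm1)
  have h2 : ContinuousOn (fun z : Eucl k × Eucl k => w z.2 - w z.1) (U ×ˢ U) :=
    (hw.comp continuousOn_snd hm2).sub (hw.comp continuousOn_fst hm1)
  have hm : MeasurableSet (U ×ˢ U) := (hU.prod hU).measurableSet
  exact (((continuous_regDelta hε).comp_continuousOn h1).aemeasurable hm).ennreal_ofReal.mul
    (h2.aemeasurable hm).enorm

theorem setLIntegral_prod_regDelta_mul (hU : IsOpen U) (hG : ContDiffOn ℝ ∞ G U)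
    (hw : ContinuousOn w U) {ε : ℝ} (hε : 0 < ε) :
    ∫⁻ z in U ×ˢ U, ENNReal.ofReal (regDelta k ε (G z.2 - G z.1)) * ‖w z.2 - w z.1‖ₑ =
      ∫⁻ x in U, ∫⁻ y in U, ENNReal.ofReal (regDelta k ε (G y - G x)) * ‖w y - w x‖ₑ := by
  have h := aemeasurable_regDelta_mul hU hG hw hε
  rw [Measure.volume_eq_prod, ← Measure.prod_restrict] at h ⊢
  exact lintegral_prod _ h

theorem setLIntegral_prod_regDelta_mul_le (hU : IsOpen U) (hG : ContDiffOn ℝ ∞ G U)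
    (hinj : InjOn G U) (hc : 0 < c) (hdet : ∀ x ∈ U, c ≤ (fderiv ℝ G x).det)
    (hw : ContinuousOn w U) (hwb : ∀ x ∈ U, ‖w x‖ ≤ b) {ε : ℝ} (hε : 0 < ε) :
    ∫⁻ z in U ×ˢ U, ENNReal.ofReal (regDelta k ε (G z.2 - G z.1)) * ‖w z.2 - w z.1‖ₑ ≤
      deltaMass k c * ENNReal.ofReal (b + b) * volume U := by
  rw [setLIntegral_prod_regDelta_mul hU hG hw hε, ← setLIntegral_const]
  exact setLIntegral_mono' hU.measurableSet fun x hx =>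
    lintegral_regDelta_mul_le hU hG hinj hc hdet hwb hε hx

theorem tendsto_setLIntegral_prod_regDelta_mul (hU : IsOpen U) (hUv : volume U ≠ ⊤)
    (hG : ContDiffOn ℝ ∞ G U) (hinj : InjOn G U) (hc : 0 < c)
    (hdet : ∀ x ∈ U, c ≤ (fderiv ℝ G x).det) (hw : ContinuousOn w U)
    (hwb : ∀ x ∈ U, ‖w x‖ ≤ b) :
    Tendsto (fun ε => ∫⁻ z in U ×ˢ U,
      ENNReal.ofReal (regDelta k ε (G z.2 - G z.1)) * ‖w z.2 - w z.1‖ₑ) (𝓝[>] 0) (𝓝 0) := by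
  have h : Tendsto (fun ε => ∫⁻ x in U, ∫⁻ y in U,
      ENNReal.ofReal (regDelta k ε (G y - G x)) * ‖w y - w x‖ₑ) (𝓝[>] 0)
      (𝓝 (∫⁻ _ in U, 0)) := by
    refine tendsto_lintegral_filter_of_dominated_convergence'
      (fun _ => deltaMass k c * ENNReal.ofReal (b + b)) ?_ ?_ ?_ ?_
    · filter_upwards [self_mem_nhdsWithin] with ε hε
      have h := aemeasurable_regDelta_mul hU hG hw (show 0 < ε from hε)
      rw [Measure.volume_eq_prod, ← Measure.prod_restrict] at h
      exact h.lintegral_prod_right'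
    · filter_upwards [self_mem_nhdsWithin] with ε hε
      exact (ae_restrict_iff' hU.measurableSet).2 (Eventually.of_forall fun x hx =>
        lintegral_regDelta_mul_le hU hG hinj hc hdet hwb hε hx)
    · rw [setLIntegral_const]
      exact ENNReal.mul_ne_top (ENNReal.mul_ne_top (deltaMass_ne_top hc) ENNReal.ofReal_ne_top) hUv
    · exact (ae_restrict_iff' hU.measurableSet).2 (Eventually.of_forall fun x hx =>
        tendsto_lintegral_regDelta_mul hU hUv hG hinj hc hdet hw hwb hx)
  rw [lintegral_zero] at h
  refine h.congr' ?_
  filter_upwards [self_mem_nhdsWithin] with ε hε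
  exact (setLIntegral_prod_regDelta_mul hU hG hw hε).symm

/-- The singular kernel is integrable along an injective map with Jacobian bounded below. -/
theorem setLIntegral_prod_kernel_ne_top (hU : IsOpen U) (hUv : volume U ≠ ⊤)
    (hG : ContDiffOn ℝ ∞ G U) (hinj : InjOn G U) (hc : 0 < c)
    (hdet : ∀ x ∈ U, c ≤ (fderiv ℝ G x).det) (hGb : ∀ x ∈ U, ‖G x‖ ≤ b) :
    ∫⁻ z in U ×ˢ U, ‖kernel k (G z.2 - G z.1)‖ₑ ≠ ⊤ := by
  obtain ⟨C, hC, hCk⟩ := exists_lintegral_kernel_le k b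
  have hm1 : MapsTo Prod.fst (U ×ˢ U) U := fun z hz => hz.1
  have hm2 : MapsTo Prod.snd (U ×ˢ U) U := fun z hz => hz.2
  have h1 : ContinuousOn (fun z : Eucl k × Eucl k => G z.2 - G z.1) (U ×ˢ U) :=
    (hG.continuousOn.comp continuousOn_snd hm2).sub (hG.continuousOn.comp continuousOn_fst hm1)
  have hm : MeasurableSet (U ×ˢ U) := (hU.prod hU).measurableSet
  have h2 : AEMeasurable (fun z : Eucl k × Eucl k => ‖kernel k (G z.2 - G z.1)‖ₑ)
      (volume.restrict (U ×ˢ U)) := (measurable_kernel.comp_aemeasurable (h1.aemeasurable hm)).enorm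
  rw [Measure.volume_eq_prod, ← Measure.prod_restrict] at h2 ⊢
  rw [lintegral_prod _ h2]
  refine ne_top_of_le_ne_top (b := (ENNReal.ofReal c)⁻¹ * C * volume U) ?_ ?_
  · exact ENNReal.mul_ne_top (ENNReal.mul_ne_top
      (ENNReal.inv_ne_top.2 (by simpa using hc)) hC) hUv
  · rw [← setLIntegral_const]
    refine setLIntegral_mono' hU.measurableSet fun x hx => ?_
    refine (lintegral_comp_le hU hG hinj hc hdet
      fun q => ‖kernel k (q - G x)‖ₑ).trans (mul_le_mul_right ?_ _)
    refine (lintegral_mono_set ?_).trans (hCk (G x) (hGb x hx))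
    rintro _ ⟨y, hy, rfl⟩
    exact mem_closedBall_zero_iff.2 (hGb y hy)

end

/-! ### The regularized helicity along an isotopy -/

theorem hasDerivAt_triple {K : ℝ → Eucl k} {a b : ℝ → Fin k → Eucl k} {K' : Eucl k}
    {a' b' : Fin k → Eucl k} {t : ℝ} (hK : HasDerivAt K K' t)
    (ha : ∀ j, HasDerivAt (fun s => a s j) (a' j) t)
    (hb : ∀ j, HasDerivAt (fun s => b s j) (b' j) t) :
    HasDerivAt (fun s => triple (K s) (a s) (b s))
      (triple K' (a t) (b t) + (∑ m, triple (K t) (Function.update (a t) m (a' m)) (b t) +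
        ∑ m, triple (K t) (a t) (Function.update (b t) m (b' m)))) t := by
  have h : HasDerivAt (fun s => tripleVec (K s) (a s) (b s)) (tripleVec K' a' b') t := by
    rw [hasDerivAt_pi]
    intro i
    refine Fin.cases ?_ (fun i => ?_) i
    · exact hK
    · simp only [tripleVec, Fin.cons_succ]
      rcases (splitPair k).symm i with j | j
      · exact ha j
      · exact hb j
  have h2 := ((volFormC k).hasFDerivAt (tripleVec (K t) (a t) (b t))).comp_hasDerivAt t h
  rw [ContinuousMultilinearMap.linearDeriv_apply] at h2
  rw [← sum_volForm_update_tripleVec]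
  exact h2

theorem continuous_triple_left (a b : Fin k → Eucl k) : Continuous fun K => triple K a b := by
  rw [← continuousOn_univ]
  exact continuousOn_id.triple continuousOn_const continuousOn_const

theorem hasDerivAt_linkDensity {U : Set (Eucl k)} {F v : ℝ → Eucl k → Eucl k} {b c : ℝ}
    (h : IsRegularIsotopy U F v b c) (α : Form k (k + 1)) {K : Eucl k → Eucl k}
    (hK : ContDiff ℝ ∞ K) {t : ℝ} (ht : t ∈ Ioo (0 : ℝ) 1) {z : Eucl k × Eucl k}
    (hz : z ∈ U ×ˢ U) :
    HasDerivAt (fun s => linkDensity α K (F s) z) (linkDeriv α K (F t) (v t) z) t := by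
  have hK' : HasDerivAt (fun s => K (F s z.2 - F s z.1))
      (fderiv ℝ K (F t z.2 - F t z.1) (v t z.2 - v t z.1)) t :=
    ((hK.differentiable (by simp) _).hasFDerivAt).comp_hasDerivAt t
      ((h.hasDerivAt t ht _ hz.2).sub (h.hasDerivAt t ht _ hz.1))
  have hfr : ∀ x ∈ U, ∀ (I : Fin k → Fin (2 * k + 1)) j,
      HasDerivAt (fun s => frame (fderiv ℝ (F s) x) I j) (fderiv ℝ (v t) x (stdVec (I j))) t := by
    intro x hx I j
    have h1 := (h.hasDerivAt_fderiv t ht x hx).clm_apply (hasDerivAt_const t (stdVec (I j)))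
    simp only [map_zero, add_zero] at h1
    exact h1
  have h3 : HasDerivAt (fun s => linkDensity α K (F s) z)
      (∑ I : Fin k → Fin (2 * k + 1), ∑ J : Fin k → Fin (2 * k + 1),
        starCoord (α z.1).toAlternatingMap I * starCoord (α z.2).toAlternatingMap J * _) t :=
    HasDerivAt.fun_sum fun I _ => HasDerivAt.fun_sum fun J _ =>
      (hasDerivAt_triple hK' (hfr z.1 hz.1 I) (hfr z.2 hz.2 J)).const_mul _
  convert h3 using 1
  unfold linkDeriv pairing
  rw [Finset.sum_add_distrib, Finset.sum_comm (s := (Finset.univ : Finset (Fin k))),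
    Finset.sum_comm (s := (Finset.univ : Finset (Fin k))), ← Finset.sum_add_distrib,
    ← Finset.sum_add_distrib]
  refine Finset.sum_congr rfl fun I _ => ?_
  rw [Finset.sum_comm (s := (Finset.univ : Finset (Fin k))),
    Finset.sum_comm (s := (Finset.univ : Finset (Fin k))), ← Finset.sum_add_distrib,
    ← Finset.sum_add_distrib]
  refine Finset.sum_congr rfl fun J _ => ?_
  rw [← Finset.mul_sum, ← Finset.mul_sum, ← mul_add, ← mul_add]

section

variable {Ω : Set (Eucl k)} {α : Form k (k + 1)} {F v : ℝ → Eucl k → Eucl k} {b c : ℝ}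

theorem continuousOn_frame_fst {U : Set (Eucl k)} {G : Eucl k → Eucl k} (hU : IsOpen U)
    (hG : ContDiffOn ℝ ∞ G U) (I : Fin k → Fin (2 * k + 1)) :
    ContinuousOn (fun z : Eucl k × Eucl k => frame (fderiv ℝ G z.1) I) (U ×ˢ U) :=
  continuousOn_pi.2 fun _ => ((hG.continuousOn_fderiv_of_isOpen hU (by simp)).comp
    continuousOn_fst fun _ hz => hz.1).clm_apply continuousOn_const

theorem continuousOn_frame_snd {U : Set (Eucl k)} {G : Eucl k → Eucl k} (hU : IsOpen U)
    (hG : ContDiffOn ℝ ∞ G U) (I : Fin k → Fin (2 * k + 1)) :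
    ContinuousOn (fun z : Eucl k × Eucl k => frame (fderiv ℝ G z.2) I) (U ×ˢ U) :=
  continuousOn_pi.2 fun _ => ((hG.continuousOn_fderiv_of_isOpen hU (by simp)).comp
    continuousOn_snd fun _ hz => hz.2).clm_apply continuousOn_const

theorem continuousOn_increment {U : Set (Eucl k)} {G : Eucl k → Eucl k}
    (hG : ContDiffOn ℝ ∞ G U) :
    ContinuousOn (fun z : Eucl k × Eucl k => G z.2 - G z.1) (U ×ˢ U) :=
  (hG.continuousOn.comp continuousOn_snd fun _ hz => hz.2).sub
    (hG.continuousOn.comp continuousOn_fst fun _ hz => hz.1)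

theorem continuousOn_linkDensity {K G : Eucl k → Eucl k} (hα : IsClosedDirichlet Ω α)
    (hK : ContDiff ℝ ∞ K) (hG : ContDiffOn ℝ ∞ G (interior Ω)) :
    ContinuousOn (linkDensity α K G) (interior Ω ×ˢ interior Ω) :=
  continuousOn_pairing hα (fun _ _ => hK.continuous.comp_continuousOn (continuousOn_increment hG))
    (continuousOn_frame_fst isOpen_interior hG) (continuousOn_frame_snd isOpen_interior hG)

theorem continuousOn_linkDeriv {K G w : Eucl k → Eucl k} (hα : IsClosedDirichlet Ω α)
    (hK : ContDiff ℝ ∞ K) (hG : ContDiffOn ℝ ∞ G (interior Ω))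
    (hw : ContDiffOn ℝ ∞ w (interior Ω)) :
    ContinuousOn (linkDeriv α K G w) (interior Ω ×ˢ interior Ω) := by
  have hU : IsOpen (interior Ω) := isOpen_interior
  have ha := continuousOn_frame_fst hU hG
  have hb := continuousOn_frame_snd hU hG
  have hc := hK.continuous.comp_continuousOn (continuousOn_increment hG)
  have hd := (hK.continuous_fderiv (by simp)).comp_continuousOn (continuousOn_increment hG)
  have cDw := hw.continuousOn_fderiv_of_isOpen hU (by simp)
  refine (continuousOn_pairing hα (fun _ _ => hd.clm_apply (continuousOn_increment hw)) ha hb).add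
    (continuousOn_finsetSum _ fun m _ => ?_)
  refine (continuousOn_pairing hα (fun _ _ => hc) (fun I => continuousOn_update (ha I) ?_ m)
    hb).add (continuousOn_pairing hα (fun _ _ => hc) ha fun J => continuousOn_update (hb J) ?_ m)
  · exact (cDw.comp continuousOn_fst fun _ hz => hz.1).clm_apply continuousOn_const
  · exact (cDw.comp continuousOn_snd fun _ hz => hz.2).clm_apply continuousOn_const

theorem exists_abs_linkDensity_le (hΩ : IsCompact Ω) (hα : IsClosedDirichlet Ω α)
    (h : IsRegularIsotopy (interior Ω) F v b c) : ∃ C, 0 ≤ C ∧ ∀ (K : Eucl k → Eucl k),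
      ∀ t ∈ Icc (0 : ℝ) 1, ∀ z ∈ interior Ω ×ˢ interior Ω,
        |linkDensity α K (F t) z| ≤ C * ‖K (F t z.2 - F t z.1)‖ := by
  obtain ⟨C, hC0, hC⟩ := exists_abs_pairing_le hΩ hα (abs_nonneg b)
  refine ⟨C, hC0, fun K t ht z hz => ?_⟩
  exact hC _ _ _ z ⟨interior_subset hz.1, interior_subset hz.2⟩ _ (fun _ _ => le_rfl)
    (fun I j => (norm_frame_le (h.norm_fderiv_le t ht _ hz.1) I j).trans (le_abs_self b))
    (fun I j => (norm_frame_le (h.norm_fderiv_le t ht _ hz.2) I j).trans (le_abs_self b))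

theorem exists_abs_linkDelta_le (hΩ : IsCompact Ω) (hα : IsClosedDirichlet Ω α)
    (h : IsRegularIsotopy (interior Ω) F v b c) : ∃ C, 0 ≤ C ∧ ∀ (K : Eucl k → Eucl k),
      ∀ t ∈ Icc (0 : ℝ) 1, ∀ z ∈ interior Ω ×ˢ interior Ω,
        |linkDelta α K (F t) (v t) z| ≤
          C * (|divergence K (F t z.2 - F t z.1)| * ‖v t z.2 - v t z.1‖) := by
  obtain ⟨C, hC0, hC⟩ := exists_abs_pairing_le hΩ hα (abs_nonneg b)
  refine ⟨C, hC0, fun K t ht z hz => ?_⟩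
  rw [linkDelta, abs_mul, mul_left_comm]
  refine mul_le_mul_of_nonneg_left ?_ (abs_nonneg _)
  exact hC _ _ _ z ⟨interior_subset hz.1, interior_subset hz.2⟩ _ (fun _ _ => le_rfl)
    (fun I j => (norm_frame_le (h.norm_fderiv_le t ht _ hz.1) I j).trans (le_abs_self b))
    (fun I j => (norm_frame_le (h.norm_fderiv_le t ht _ hz.2) I j).trans (le_abs_self b))

theorem exists_norm_le_of_continuous_comp {X : Type*} [NormedAddCommGroup X] {K : Eucl k → X}
    (hK : Continuous K) {U : Set (Eucl k)} (h : IsRegularIsotopy U F v b c) :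
    ∃ C, ∀ t ∈ Icc (0 : ℝ) 1, ∀ z ∈ U ×ˢ U, ‖K (F t z.2 - F t z.1)‖ ≤ C := by
  obtain ⟨C, hC⟩ := (isCompact_closedBall (0 : Eucl k) (b + b)).exists_bound_of_continuousOn
    hK.continuousOn
  refine ⟨C, fun t ht z hz => hC _ (mem_closedBall_zero_iff.2 ?_)⟩
  exact (norm_sub_le _ _).trans (add_le_add (h.norm_le t ht _ hz.2) (h.norm_le t ht _ hz.1))

theorem exists_abs_linkDeriv_le (hΩ : IsCompact Ω) (hα : IsClosedDirichlet Ω α)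
    (h : IsRegularIsotopy (interior Ω) F v b c) {K : Eucl k → Eucl k} (hK : ContDiff ℝ ∞ K) :
    ∃ C, ∀ t ∈ Ioo (0 : ℝ) 1, ∀ z ∈ interior Ω ×ˢ interior Ω,
      |linkDeriv α K (F t) (v t) z| ≤ C := by
  obtain ⟨C, hC0, hC⟩ := exists_abs_pairing_le hΩ hα (abs_nonneg b)
  obtain ⟨C₁, hC₁⟩ := exists_norm_le_of_continuous_comp hK.continuous h
  obtain ⟨C₂, hC₂⟩ := exists_norm_le_of_continuous_comp (hK.continuous_fderiv (by simp)) h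
  refine ⟨C * (C₂ * (b + b)) + ∑ _m : Fin k, (C * C₁ + C * C₁), fun t ht z hz => ?_⟩
  have ht' := Ioo_subset_Icc_self ht
  have hz' : z ∈ Ω ×ˢ Ω := ⟨interior_subset hz.1, interior_subset hz.2⟩
  have ha : ∀ I j, ‖frame (fderiv ℝ (F t) z.1) I j‖ ≤ |b| := fun I j =>
    (norm_frame_le (h.norm_fderiv_le t ht' _ hz.1) I j).trans (le_abs_self b)
  have hb : ∀ I j, ‖frame (fderiv ℝ (F t) z.2) I j‖ ≤ |b| := fun I j =>
    (norm_frame_le (h.norm_fderiv_le t ht' _ hz.2) I j).trans (le_abs_self b)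
  have hv : ∀ x ∈ interior Ω, ∀ i, ‖fderiv ℝ (v t) x (stdVec i)‖ ≤ |b| := fun x hx i =>
    ((ContinuousLinearMap.le_opNorm _ _).trans
      (by rw [norm_stdVec, mul_one]; exact h.norm_fderiv_velocity_le t ht x hx)).trans
      (le_abs_self b)
  refine (abs_add_le _ _).trans (add_le_add ?_ ((Finset.abs_sum_le_sum_abs _ _).trans
    (Finset.sum_le_sum fun m _ => (abs_add_le _ _).trans (add_le_add ?_ ?_))))
  · refine hC _ _ _ z hz' _ (fun _ _ => ?_) ha hb
    have h1 := hC₂ t ht' z hz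
    refine (ContinuousLinearMap.le_opNorm _ _).trans
      (mul_le_mul h1 ?_ (norm_nonneg _) ((norm_nonneg _).trans h1))
    exact (norm_sub_le _ _).trans
      (add_le_add (h.norm_velocity_le t ht _ hz.2) (h.norm_velocity_le t ht _ hz.1))
  · exact hC _ _ _ z hz' _ (fun _ _ => hC₁ t ht' z hz)
      (fun I => norm_update_le (ha I) (hv _ hz.1 _)) hb
  · exact hC _ _ _ z hz' _ (fun _ _ => hC₁ t ht' z hz) ha
      (fun J => norm_update_le (hb J) (hv _ hz.2 _))

/-- The helicity with respect to the kernel `K` at time `t`, written on the initial domain. -/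
def linkIntegral (Ω : Set (Eucl k)) (α : Form k (k + 1)) (F : ℝ → Eucl k → Eucl k)
    (K : Eucl k → Eucl k) (t : ℝ) : ℝ :=
  ∫ z in interior Ω ×ˢ interior Ω, linkDensity α K (F t) z

theorem isFiniteMeasure_restrict_prod (hΩ : IsCompact Ω) :
    IsFiniteMeasure ((volume : Measure (Eucl k × Eucl k)).restrict
      (interior Ω ×ˢ interior Ω)) := by
  refine ⟨?_⟩
  rw [Measure.restrict_apply_univ, Measure.volume_eq_prod, Measure.prod_prod, lt_top_iff_ne_top]
  exact ENNReal.mul_ne_top (volume_interior_ne_top hΩ) (volume_interior_ne_top hΩ)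

theorem continuousOn_linkIntegral (hΩ : IsCompact Ω) (hα : IsClosedDirichlet Ω α)
    (h : IsRegularIsotopy (interior Ω) F v b c) {K : Eucl k → Eucl k} (hK : ContDiff ℝ ∞ K) :
    ContinuousOn (linkIntegral Ω α F K) (Icc 0 1) := by
  have := isFiniteMeasure_restrict_prod hΩ
  have hm : MeasurableSet (interior Ω ×ˢ interior Ω) := (h.isOpen.prod h.isOpen).measurableSet
  obtain ⟨C, hC0, hC⟩ := exists_abs_linkDensity_le hΩ hα h
  obtain ⟨C₁, hC₁⟩ := exists_norm_le_of_continuous_comp hK.continuous h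
  refine continuousOn_of_dominated (bound := fun _ => C * C₁)
    (fun t ht => (continuousOn_linkDensity hα hK (h.contDiffOn t ht)).aestronglyMeasurable hm)
    (fun t ht => (ae_restrict_iff' hm).2 (Eventually.of_forall fun z hz =>
      (hC K t ht z hz).trans (mul_le_mul_of_nonneg_left (hC₁ t ht z hz) hC0)))
    (integrable_const _)
    ((ae_restrict_iff' hm).2 (Eventually.of_forall fun z hz => ?_))
  refine continuousOn_finsetSum _ fun I _ => continuousOn_finsetSum _ fun J _ =>
    continuousOn_const.mul (ContinuousOn.triple ?_ ?_ ?_)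
  · exact hK.continuous.comp_continuousOn ((h.continuousOn _ hz.2).sub (h.continuousOn _ hz.1))
  · exact continuousOn_pi.2 fun j =>
      (h.continuousOn_fderiv _ hz.1).clm_apply continuousOn_const
  · exact continuousOn_pi.2 fun j =>
      (h.continuousOn_fderiv _ hz.2).clm_apply continuousOn_const

/-- The first variation formula along the isotopy, for a smooth kernel. -/
theorem hasDerivAt_linkIntegral (hΩ : IsCompactDomain Ω) (hα : IsClosedDirichlet Ω α)
    (h : IsRegularIsotopy (interior Ω) F v b c) {K : Eucl k → Eucl k} (hK : ContDiff ℝ ∞ K)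
    {t : ℝ} (ht : t ∈ Ioo (0 : ℝ) 1) :
    HasDerivAt (linkIntegral Ω α F K)
      (∫ z in interior Ω ×ˢ interior Ω, linkDelta α K (F t) (v t) z) t := by
  have := isFiniteMeasure_restrict_prod hΩ.isCompact
  have hm : MeasurableSet (interior Ω ×ˢ interior Ω) := (h.isOpen.prod h.isOpen).measurableSet
  have ht' := Ioo_subset_Icc_self ht
  obtain ⟨C, hC0, hC⟩ := exists_abs_linkDensity_le hΩ.isCompact hα h
  obtain ⟨C₁, hC₁⟩ := exists_norm_le_of_continuous_comp hK.continuous h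
  obtain ⟨C₂, hC₂⟩ := exists_abs_linkDeriv_le hΩ.isCompact hα h hK
  have hmeas : ∀ s ∈ Icc (0 : ℝ) 1, AEStronglyMeasurable (linkDensity α K (F s))
      (volume.restrict (interior Ω ×ˢ interior Ω)) := fun s hs =>
    (continuousOn_linkDensity hα hK (h.contDiffOn s hs)).aestronglyMeasurable hm
  have h1 := (hasDerivAt_integral_of_dominated_loc_of_deriv_le
    (μ := volume.restrict (interior Ω ×ˢ interior Ω))
    (F := fun s z => linkDensity α K (F s) z)
    (F' := fun s z => linkDeriv α K (F s) (v s) z) (bound := fun _ => C₂)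
    (Ioo_mem_nhds ht.1 ht.2)
    (Filter.mem_of_superset (Ioo_mem_nhds ht.1 ht.2)
      fun s hs => hmeas s (Ioo_subset_Icc_self hs))
    (Integrable.of_bound (hmeas t ht') (C * C₁)
      ((ae_restrict_iff' hm).2 (Eventually.of_forall fun z hz =>
        (hC K t ht' z hz).trans (mul_le_mul_of_nonneg_left (hC₁ t ht' z hz) hC0))))
    ((continuousOn_linkDeriv hα hK (h.contDiffOn t ht')
      (h.contDiffOn_velocity t ht)).aestronglyMeasurable hm)
    ((ae_restrict_iff' hm).2 (Eventually.of_forall fun z hz s hs => hC₂ s hs z hz))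
    (integrable_const _)
    ((ae_restrict_iff' hm).2 (Eventually.of_forall fun z hz s hs =>
      hasDerivAt_linkDensity h α hK hs hz))).2
  rwa [integral_linkDeriv hΩ hα hK (h.contDiffOn t ht') (h.contDiffOn_velocity t ht)
    (h.norm_le t ht') (h.norm_fderiv_le t ht') (h.norm_velocity_le t ht)
    (h.norm_fderiv_velocity_le t ht)] at h1

theorem exists_enorm_integral_linkDelta_le (hΩ : IsCompact Ω) (hα : IsClosedDirichlet Ω α)
    (h : IsRegularIsotopy (interior Ω) F v b c) : ∃ C : ENNReal, C ≠ ⊤ ∧ ∀ ε > 0,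
      ∀ t ∈ Ioo (0 : ℝ) 1,
        ‖∫ z in interior Ω ×ˢ interior Ω, linkDelta α (regKernel k ε) (F t) (v t) z‖ₑ ≤
          C * ∫⁻ z in interior Ω ×ˢ interior Ω,
            ENNReal.ofReal (regDelta k ε (F t z.2 - F t z.1)) * ‖v t z.2 - v t z.1‖ₑ := by
  have hm : MeasurableSet (interior Ω ×ˢ interior Ω) := (h.isOpen.prod h.isOpen).measurableSet
  obtain ⟨C, hC0, hC⟩ := exists_abs_linkDelta_le hΩ hα h
  refine ⟨ENNReal.ofReal C, ENNReal.ofReal_ne_top, fun ε hε t ht => ?_⟩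
  refine (enorm_integral_le_lintegral_enorm _).trans ?_
  rw [← lintegral_const_mul' _ _ ENNReal.ofReal_ne_top]
  refine setLIntegral_mono' hm fun z hz => ?_
  have h1 := hC (regKernel k ε) t (Ioo_subset_Icc_self ht) z hz
  have h2 : divergence (regKernel k ε) (F t z.2 - F t z.1) =
      regDelta k ε (F t z.2 - F t z.1) := sum_fderiv_regKernel hε _
  rw [h2, abs_of_nonneg (regDelta_nonneg hε _)] at h1
  rw [← ofReal_norm, ← ofReal_norm, ← ENNReal.ofReal_mul (regDelta_nonneg hε _),
    ← ENNReal.ofReal_mul hC0]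
  exact ENNReal.ofReal_le_ofReal h1

/-- The regularized helicity is preserved up to an error that vanishes with the regularization. -/
theorem tendsto_linkIntegral_sub (hΩ : IsCompactDomain Ω) (hα : IsClosedDirichlet Ω α)
    (h : IsRegularIsotopy (interior Ω) F v b c) :
    Tendsto (fun ε => linkIntegral Ω α F (regKernel k ε) 1 -
      linkIntegral Ω α F (regKernel k ε) 0) (𝓝[>] 0) (𝓝 0) := by
  have hUv := volume_interior_ne_top hΩ.isCompact
  obtain ⟨C, hC, hCb⟩ := exists_enorm_integral_linkDelta_le hΩ.isCompact hα h
  set M : ENNReal := C * (deltaMass k c * ENNReal.ofReal (b + b) * volume (interior Ω)) with hM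
  have hMtop : M ≠ ⊤ := ENNReal.mul_ne_top hC (ENNReal.mul_ne_top
    (ENNReal.mul_ne_top (deltaMass_ne_top h.pos) ENNReal.ofReal_ne_top) hUv)
  have hder : ∀ ε > 0, ∀ t ∈ Ioo (0 : ℝ) 1, deriv (linkIntegral Ω α F (regKernel k ε)) t =
      ∫ z in interior Ω ×ˢ interior Ω, linkDelta α (regKernel k ε) (F t) (v t) z :=
    fun ε hε t ht => (hasDerivAt_linkIntegral hΩ hα h (contDiff_regKernel hε) ht).deriv
  have hbound : ∀ ε > 0, ∀ t ∈ Ioo (0 : ℝ) 1,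
      ‖deriv (linkIntegral Ω α F (regKernel k ε)) t‖ ≤ M.toReal := by
    intro ε hε t ht
    have ht' := Ioo_subset_Icc_self ht
    rw [hder ε hε t ht, ← toReal_enorm]
    refine ENNReal.toReal_mono hMtop ((hCb ε hε t ht).trans (mul_le_mul_right ?_ _))
    exact setLIntegral_prod_regDelta_mul_le h.isOpen (h.contDiffOn t ht') (h.injOn t ht') h.pos
      (h.le_det t ht') (h.contDiffOn_velocity t ht).continuousOn (h.norm_velocity_le t ht) hε
  have hlim : ∀ t ∈ Ioo (0 : ℝ) 1,
      Tendsto (fun ε => deriv (linkIntegral Ω α F (regKernel k ε)) t) (𝓝[>] 0) (𝓝 0) := by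
    intro t ht
    have ht' := Ioo_subset_Icc_self ht
    rw [tendsto_zero_iff_enorm_tendsto_zero]
    have h1 := ENNReal.Tendsto.const_mul (a := C) (tendsto_setLIntegral_prod_regDelta_mul h.isOpen
      hUv (h.contDiffOn t ht') (h.injOn t ht') h.pos (h.le_det t ht')
      (h.contDiffOn_velocity t ht).continuousOn (h.norm_velocity_le t ht)) (Or.inr hC)
    rw [mul_zero] at h1
    refine tendsto_of_tendsto_of_tendsto_of_le_of_le' tendsto_const_nhds h1
      (Eventually.of_forall fun _ => zero_le) ?_
    filter_upwards [self_mem_nhdsWithin] with ε hε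
    rw [hder ε hε t ht]
    exact hCb ε hε t ht
  -- The derivative is known in the open interval only.
  have hae : ∀ᵐ t ∂(volume.restrict (Ioc (0 : ℝ) 1)), t ∈ Ioo (0 : ℝ) 1 := by
    rw [← Measure.restrict_congr_set Ioo_ae_eq_Ioc]
    exact ae_restrict_mem measurableSet_Ioo
  have hmeas : ∀ ε, AEStronglyMeasurable (deriv (linkIntegral Ω α F (regKernel k ε)))
      (volume.restrict (Ioc (0 : ℝ) 1)) := fun ε =>
    (measurable_deriv _).aestronglyMeasurable
  have hFTC : ∀ ε > 0, ∫ t in (0 : ℝ)..1, deriv (linkIntegral Ω α F (regKernel k ε)) t =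
      linkIntegral Ω α F (regKernel k ε) 1 - linkIntegral Ω α F (regKernel k ε) 0 := by
    intro ε hε
    have hK := contDiff_regKernel (k := k) hε
    refine intervalIntegral.integral_eq_sub_of_hasDerivAt_of_le zero_le_one
      (continuousOn_linkIntegral hΩ.isCompact hα h hK)
      (fun t ht => (hasDerivAt_linkIntegral hΩ hα h hK ht).differentiableAt.hasDerivAt) ?_
    rw [intervalIntegrable_iff_integrableOn_Ioc_of_le zero_le_one]
    exact Integrable.of_bound (hmeas ε) M.toReal (hae.mono fun t ht => hbound ε hε t ht)
  have hfin : Tendsto (fun ε => ∫ t in (0 : ℝ)..1, deriv (linkIntegral Ω α F (regKernel k ε)) t)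
      (𝓝[>] 0) (𝓝 0) := by
    have h1 : Tendsto (fun ε => ∫ t in Ioc (0 : ℝ) 1,
        deriv (linkIntegral Ω α F (regKernel k ε)) t) (𝓝[>] 0)
        (𝓝 (∫ _ in Ioc (0 : ℝ) 1, (0 : ℝ))) := by
      refine tendsto_integral_filter_of_dominated_convergence (fun _ => M.toReal)
        (Eventually.of_forall hmeas) ?_ (integrable_const _) (hae.mono hlim)
      filter_upwards [self_mem_nhdsWithin] with ε hε
      exact hae.mono fun t ht => hbound ε hε t ht
    simpa [intervalIntegral.integral_of_le zero_le_one] using h1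
  refine hfin.congr' ?_
  filter_upwards [self_mem_nhdsWithin] with ε hε
  exact hFTC ε hε

theorem tendsto_linkDensity_regKernel (α : Form k (k + 1)) (G : Eucl k → Eucl k)
    (z : Eucl k × Eucl k) :
    Tendsto (fun ε => linkDensity α (regKernel k ε) G z) (𝓝[>] 0)
      (𝓝 (linkDensity α (kernel k) G z)) := by
  refine tendsto_finsetSum _ fun I _ => tendsto_finsetSum _ fun J _ => Tendsto.const_mul _ ?_
  exact ((continuous_triple_left _ _).tendsto _).comp
    ((tendsto_regKernel _).mono_left nhdsWithin_le_nhds)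

/-- The helicity integral converges absolutely at all times, and it is the limit of the
regularized helicity. -/
theorem integrableOn_linkDensity_and_tendsto (hΩ : IsCompact Ω) (hα : IsClosedDirichlet Ω α)
    (h : IsRegularIsotopy (interior Ω) F v b c) {t : ℝ} (ht : t ∈ Icc (0 : ℝ) 1) :
    IntegrableOn (linkDensity α (kernel k) (F t)) (interior Ω ×ˢ interior Ω) ∧
    Tendsto (fun ε => linkIntegral Ω α F (regKernel k ε) t) (𝓝[>] 0)
      (𝓝 (linkIntegral Ω α F (kernel k) t)) := by
  have hm : MeasurableSet (interior Ω ×ˢ interior Ω) := (h.isOpen.prod h.isOpen).measurableSet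
  obtain ⟨C, hC0, hC⟩ := exists_abs_linkDensity_le hΩ hα h
  have hmeas : ∀ᶠ ε in 𝓝[>] (0 : ℝ), AEStronglyMeasurable (linkDensity α (regKernel k ε) (F t))
      (volume.restrict (interior Ω ×ˢ interior Ω)) := by
    filter_upwards [self_mem_nhdsWithin] with ε hε
    exact (continuousOn_linkDensity hα (contDiff_regKernel hε)
      (h.contDiffOn t ht)).aestronglyMeasurable hm
  have hlim : ∀ᵐ z ∂(volume.restrict (interior Ω ×ˢ interior Ω)),
      Tendsto (fun ε => linkDensity α (regKernel k ε) (F t) z) (𝓝[>] 0)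
        (𝓝 (linkDensity α (kernel k) (F t) z)) :=
    Eventually.of_forall fun z => tendsto_linkDensity_regKernel α (F t) z
  have hbound : Integrable (fun z : Eucl k × Eucl k => C * ‖kernel k (F t z.2 - F t z.1)‖)
      (volume.restrict (interior Ω ×ˢ interior Ω)) := by
    refine Integrable.const_mul ?_ C
    refine Integrable.norm ⟨?_, ?_⟩
    · exact (measurable_kernel.comp_aemeasurable
        ((continuousOn_increment (h.contDiffOn t ht)).aemeasurable hm)).aestronglyMeasurable
    · exact lt_top_iff_ne_top.2 (setLIntegral_prod_kernel_ne_top h.isOpen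
        (volume_interior_ne_top hΩ) (h.contDiffOn t ht) (h.injOn t ht) h.pos (h.le_det t ht)
        (h.norm_le t ht))
  constructor
  · have hseq : Tendsto (fun n : ℕ => 1 / ((n : ℝ) + 1)) atTop (𝓝[>] 0) :=
      tendsto_nhdsWithin_iff.2 ⟨tendsto_one_div_add_atTop_nhds_zero_nat,
        Eventually.of_forall fun n => mem_Ioi.2 Nat.one_div_pos_of_nat⟩
    refine hbound.mono' (aestronglyMeasurable_of_tendsto_ae atTop
      (fun n : ℕ => (continuousOn_linkDensity hα (contDiff_regKernel (ε := 1 / ((n : ℝ) + 1))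
        Nat.one_div_pos_of_nat) (h.contDiffOn t ht)).aestronglyMeasurable hm)
      (hlim.mono fun z hz => hz.comp hseq)) ?_
    exact (ae_restrict_iff' hm).2 (Eventually.of_forall fun z hz => hC _ t ht z hz)
  · refine tendsto_integral_filter_of_dominated_convergence _ hmeas ?_ hbound hlim
    refine Eventually.of_forall fun ε => (ae_restrict_iff' hm).2 (Eventually.of_forall
      fun z hz => (hC _ t ht z hz).trans ?_)
    exact mul_le_mul_of_nonneg_left (norm_regKernel_le _ _) hC0

/-- The helicity integral, pulled back to the fixed domain, is the same at both ends of an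
isotopy. -/
theorem linkIntegral_kernel_one_eq (hΩ : IsCompactDomain Ω) (hα : IsClosedDirichlet Ω α)
    (h : IsRegularIsotopy (interior Ω) F v b c) :
    linkIntegral Ω α F (kernel k) 1 = linkIntegral Ω α F (kernel k) 0 := by
  have h1 := (integrableOn_linkDensity_and_tendsto hΩ.isCompact hα h
    (right_mem_Icc.2 zero_le_one)).2
  have h0 := (integrableOn_linkDensity_and_tendsto hΩ.isCompact hα h
    (left_mem_Icc.2 zero_le_one)).2
  exact sub_eq_zero.1 (tendsto_nhds_unique (h1.sub h0) (tendsto_linkIntegral_sub hΩ hα h))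

end

/-! ### The helicity of the image of a form under a diffeomorphism -/

theorem volume_diagonal (k : ℕ) : volume {z : Eucl k × Eucl k | z.1 = z.2} = 0 := by
  rw [Measure.volume_eq_prod,
    Measure.measure_prod_null (isClosed_eq continuous_fst continuous_snd).measurableSet]
  refine Eventually.of_forall fun x => ?_
  have h : Prod.mk x ⁻¹' {z : Eucl k × Eucl k | z.1 = z.2} = {x} := by
    ext y; simp [eq_comm]
  exact (congrArg volume h).trans (measure_singleton x)

/-- The configuration space differs from a product by a null set. -/
theorem configSpace_ae_eq {S V : Set (Eucl k)} (hVS : V ⊆ S) (hnull : volume (S \ V) = 0) :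
    configSpace S =ᵐ[volume] V ×ˢ V := by
  rw [ae_eq_set]
  constructor
  · refine measure_mono_null (t := (S \ V) ×ˢ univ ∪ univ ×ˢ (S \ V)) ?_ ?_
    · rintro z ⟨⟨h1, h2, -⟩, h3⟩
      by_cases hz : z.1 ∈ V
      · exact Or.inr ⟨mem_univ _, h2, fun h => h3 ⟨hz, h⟩⟩
      · exact Or.inl ⟨⟨h1, hz⟩, mem_univ _⟩
    · rw [Measure.volume_eq_prod]
      refine measure_union_null ?_ ?_ <;> rw [Measure.prod_prod, hnull] <;> simp
  · refine measure_mono_null ?_ (volume_diagonal k)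
    rintro z ⟨⟨h1, h2⟩, h3⟩
    by_contra h
    exact h3 ⟨hVS h1, hVS h2, h⟩

theorem ae_restrict_ne {V : Set (Eucl k)} :
    ∀ᵐ z ∂((volume : Measure (Eucl k × Eucl k)).restrict (V ×ˢ V)), z.1 ≠ z.2 :=
  ae_restrict_of_ae (measure_eq_zero_iff_ae_notMem.1 (volume_diagonal k))

section

variable {Ω : Set (Eucl k)} {g : Eucl k → Eucl k}

theorem IsDiffeoOn.volume_image_diff (hΩ : IsCompactDomain Ω) (hg : IsDiffeoOn g Ω) :
    volume (g '' Ω \ g '' interior Ω) = 0 := by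
  refine measure_mono_null (t := g '' frontier Ω) ?_ ?_
  · rintro _ ⟨⟨x, hx, rfl⟩, h⟩
    exact ⟨x, ⟨subset_closure hx, fun hi => h (mem_image_of_mem g hi)⟩, rfl⟩
  · exact addHaar_image_eq_zero_of_differentiableOn_of_addHaar_eq_zero volume
      ((hg.smooth.differentiableOn (by simp)).mono hΩ.isCompact.isClosed.frontier_subset)
      (volume_frontier_eq_zero hΩ)

/-- The star coordinates of the image of `α` under `g` at two points, in terms of those of `α`. -/
theorem IsDiffeoOn.det_mul_det_mul_sum_pushforward (hg : IsDiffeoOn g Ω) (α : Form k (k + 1))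
    {x y : Eucl k} (hx : x ∈ interior Ω) (hy : y ∈ interior Ω) (K : Eucl k) :
    (fderiv ℝ g x).det * (fderiv ℝ g y).det *
      ∑ I : Fin k → Fin (2 * k + 1), ∑ J : Fin k → Fin (2 * k + 1),
        starCoord (pushforward g Ω α (g x)).toAlternatingMap I *
          starCoord (pushforward g Ω α (g y)).toAlternatingMap J *
          triple K (fun j => stdVec (I j)) (fun j => stdVec (J j)) =
      ∑ I : Fin k → Fin (2 * k + 1), ∑ J : Fin k → Fin (2 * k + 1),
        starCoord (α x).toAlternatingMap I * starCoord (α y).toAlternatingMap J *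
          triple K (frame (fderiv ℝ g x) I) (frame (fderiv ℝ g y) J) := by
  have key : ∀ x ∈ interior Ω, ∀ Ψ : ContinuousMultilinearMap ℝ (fun _ : Fin k => Eucl k) ℝ,
      (fderiv ℝ g x).det * ∑ I : Fin k → Fin (2 * k + 1),
        starCoord (pushforward g Ω α (g x)).toAlternatingMap I * Ψ (fun j => stdVec (I j)) =
      ∑ I : Fin k → Fin (2 * k + 1), starCoord (α x).toAlternatingMap I *
        Ψ (frame (fderiv ℝ g x) I) := by
    intro x hx Ψ
    have hBA : ((fderivWithin ℝ (Function.invFunOn g Ω) (g '' Ω) (g x)) : Eucl k →ₗ[ℝ] Eucl k) ∘ₗ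
        (fderiv ℝ g x : Eucl k →ₗ[ℝ] Eucl k) = LinearMap.id :=
      congrArg (fun L : Eucl k →L[ℝ] Eucl k => (L : Eucl k →ₗ[ℝ] Eucl k))
        (hg.fderivWithin_comp_fderiv hx)
    have h := det_mul_sum_starCoord_comp (α x).toAlternatingMap _ _
      ((LinearMap.comp_eq_id_comm ℝ (Eucl k)).1 hBA) Ψ.toMultilinearMap
    have hpush : (pushforward g Ω α (g x)).toAlternatingMap =
        (α x).toAlternatingMap.compLinearMap
          (fderivWithin ℝ (Function.invFunOn g Ω) (g '' Ω) (g x) : Eucl k →ₗ[ℝ] Eucl k) := by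
      rw [pushforward, pullbackOn, hg.invFunOn_apply (interior_subset hx)]
      rfl
    rw [hpush]
    exact h
  calc _ = (fderiv ℝ g y).det * ∑ J : Fin k → Fin (2 * k + 1),
        starCoord (pushforward g Ω α (g y)).toAlternatingMap J *
          ((fderiv ℝ g x).det * ∑ I : Fin k → Fin (2 * k + 1),
            starCoord (pushforward g Ω α (g x)).toAlternatingMap I *
              tripleLeft (fun j => stdVec (J j)) K (fun j => stdVec (I j))) := by
        rw [Finset.sum_comm]
        simp only [Finset.mul_sum, tripleLeft_apply]
        exact Finset.sum_congr rfl fun J _ => Finset.sum_congr rfl fun I _ => by ring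
    _ = ∑ I : Fin k → Fin (2 * k + 1), starCoord (α x).toAlternatingMap I *
          ((fderiv ℝ g y).det * ∑ J : Fin k → Fin (2 * k + 1),
            starCoord (pushforward g Ω α (g y)).toAlternatingMap J *
              tripleRight (frame (fderiv ℝ g x) I) K (fun j => stdVec (J j))) := by
        rw [Finset.sum_congr rfl fun J _ => by rw [key x hx]]
        simp only [Finset.mul_sum, tripleLeft_apply, tripleRight_apply]
        rw [Finset.sum_comm]
        exact Finset.sum_congr rfl fun I _ => Finset.sum_congr rfl fun J _ => by ring
    _ = _ := by
        rw [Finset.sum_congr rfl fun I _ => by rw [key y hy]]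
        simp only [Finset.mul_sum, tripleRight_apply, mul_assoc]

/-- The helicity of the image of `α` under `g`, written on the original domain. -/
theorem IsDiffeoOn.integrableOn_and_helicity_pushforward {C : ℝ}
    (hC : ∀ (α : Form k (k + 1)) (x y : Eucl k), x ≠ y →
      helicityDensity α (x, y) = C * ∑ I : Fin k → Fin (2 * k + 1), ∑ J : Fin k → Fin (2 * k + 1),
        starCoord (α x).toAlternatingMap I * starCoord (α y).toAlternatingMap J *
          triple (kernel k (y - x)) (fun j => stdVec (I j)) (fun j => stdVec (J j)))
    (hΩ : IsCompactDomain Ω) (hg : IsDiffeoOn g Ω)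
    (hdet : ∀ x ∈ interior Ω, 0 ≤ (fderiv ℝ g x).det) {α : Form k (k + 1)}
    (hint : IntegrableOn (linkDensity α (kernel k) g) (interior Ω ×ˢ interior Ω)) :
    IntegrableOn (helicityDensity (pushforward g Ω α)) (configSpace (g '' Ω)) ∧
      helicity (g '' Ω) (pushforward g Ω α) =
        C * ∫ z in interior Ω ×ˢ interior Ω, linkDensity α (kernel k) g z := by
  set U := interior Ω with hU
  have hUo : IsOpen U := isOpen_interior
  have : (volume : Measure (Eucl k × Eucl k)).IsAddHaarMeasure := by
    rw [Measure.volume_eq_prod]; infer_instance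
  have hm : MeasurableSet (U ×ˢ U) := (hUo.prod hUo).measurableSet
  have hcs : configSpace (g '' Ω) =ᵐ[volume] Prod.map g g '' (U ×ˢ U) := by
    rw [prodMap_image_prod]
    exact configSpace_ae_eq (image_mono interior_subset) (hg.volume_image_diff hΩ)
  have hd : ∀ z ∈ U ×ˢ U, HasFDerivWithinAt (Prod.map g g)
      ((fderiv ℝ g z.1).prodMap (fderiv ℝ g z.2)) (U ×ˢ U) z := by
    intro z hz
    have h1 := ((hg.contDiffAt hz.1).differentiableAt (by simp)).hasFDerivAt
    have h2 := ((hg.contDiffAt hz.2).differentiableAt (by simp)).hasFDerivAt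
    exact (h1.prodMap z h2).hasFDerivWithinAt
  have hinj : InjOn (Prod.map g g) (U ×ˢ U) := by
    intro z hz z' hz' h
    have h' := Prod.mk.inj h
    exact Prod.ext (hg.injOn (interior_subset hz.1) (interior_subset hz'.1) h'.1)
      (hg.injOn (interior_subset hz.2) (interior_subset hz'.2) h'.2)
  have hpt : (fun z : Eucl k × Eucl k => |((fderiv ℝ g z.1).prodMap (fderiv ℝ g z.2)).det| •
      helicityDensity (pushforward g Ω α) (Prod.map g g z)) =ᵐ[volume.restrict (U ×ˢ U)]
      fun z => C * linkDensity α (kernel k) g z := by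
    filter_upwards [ae_restrict_mem hm, ae_restrict_ne (V := U)] with z hz hne
    have hne' : g z.1 ≠ g z.2 := fun h =>
      hne (hg.injOn (interior_subset hz.1) (interior_subset hz.2) h)
    have hdp : ((fderiv ℝ g z.1).prodMap (fderiv ℝ g z.2)).det =
        (fderiv ℝ g z.1).det * (fderiv ℝ g z.2).det := LinearMap.det_prodMap _ _
    rw [hdp, abs_of_nonneg (mul_nonneg (hdet _ hz.1) (hdet _ hz.2)), smul_eq_mul, Prod.map,
      hC _ _ _ hne', mul_left_comm, hg.det_mul_det_mul_sum_pushforward α hz.1 hz.2]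
    rfl
  have hint' : IntegrableOn (fun z => C * linkDensity α (kernel k) g z) (U ×ˢ U) :=
    hint.const_mul C
  constructor
  · rw [integrableOn_congr_set_ae hcs,
      integrableOn_image_iff_integrableOn_abs_det_fderiv_smul volume hm hd hinj]
    exact hint'.congr hpt.symm
  · rw [helicity, setIntegral_congr_set hcs,
      integral_image_eq_integral_abs_det_fderiv_smul volume hm hd hinj, integral_congr_ae hpt,
      integral_const_mul]

/-- The helicity of `α`, in terms of a map that is the identity on `Ω`. -/
theorem integrableOn_and_helicity_eq {C : ℝ}
    (hC : ∀ (α : Form k (k + 1)) (x y : Eucl k), x ≠ y →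
      helicityDensity α (x, y) = C * ∑ I : Fin k → Fin (2 * k + 1), ∑ J : Fin k → Fin (2 * k + 1),
        starCoord (α x).toAlternatingMap I * starCoord (α y).toAlternatingMap J *
          triple (kernel k (y - x)) (fun j => stdVec (I j)) (fun j => stdVec (J j)))
    (hΩ : IsCompactDomain Ω) (hg : ∀ x ∈ Ω, g x = x) {α : Form k (k + 1)}
    (hint : IntegrableOn (linkDensity α (kernel k) g) (interior Ω ×ˢ interior Ω)) :
    IntegrableOn (helicityDensity α) (configSpace Ω) ∧
      helicity Ω α = C * ∫ z in interior Ω ×ˢ interior Ω, linkDensity α (kernel k) g z := by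
  have hm : MeasurableSet (interior Ω ×ˢ interior Ω) :=
    (isOpen_interior.prod isOpen_interior).measurableSet
  have hcs : configSpace Ω =ᵐ[volume] interior Ω ×ˢ interior Ω := by
    refine configSpace_ae_eq interior_subset (measure_mono_null ?_ (volume_frontier_eq_zero hΩ))
    exact sdiff_subset_sdiff_left subset_closure
  have hD : ∀ x ∈ interior Ω, fderiv ℝ g x = ContinuousLinearMap.id ℝ (Eucl k) := by
    intro x hx
    refine ((hasFDerivAt_id x).congr_of_eventuallyEq ?_).fderiv
    filter_upwards [mem_interior_iff_mem_nhds.1 hx] with y hy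
    exact hg y hy
  have hpt : (fun z => C * linkDensity α (kernel k) g z)
      =ᵐ[volume.restrict (interior Ω ×ˢ interior Ω)] helicityDensity α := by
    filter_upwards [ae_restrict_mem hm, ae_restrict_ne (V := interior Ω)] with z hz hne
    rw [show helicityDensity α z = helicityDensity α (z.1, z.2) from rfl, hC _ _ _ hne,
      linkDensity, pairing, hD _ hz.1, hD _ hz.2, hg _ (interior_subset hz.1),
      hg _ (interior_subset hz.2)]
    rfl
  constructor
  · rw [integrableOn_congr_set_ae hcs]
    exact Integrable.congr (hint.const_mul C) hpt
  · rw [helicity, setIntegral_congr_set hcs, ← integral_congr_ae hpt, integral_const_mul]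

end

end Helicity

theorem mainTheorem3 (k : ℕ) (Ω : Set (Helicity.Eucl k)) (hΩ : Helicity.IsCompactDomain Ω)
    (α : Helicity.Form k (k + 1)) (hα : Helicity.IsClosedDirichlet Ω α)
    (f : Helicity.Eucl k × ℝ → Helicity.Eucl k)
    (hf : ContDiffOn ℝ ∞ f (Ω ×ˢ Set.Icc (0 : ℝ) 1))
    (hdiffeo : ∀ t ∈ Set.Icc (0 : ℝ) 1, Helicity.IsDiffeoOn (fun p => f (p, t)) Ω)
    (hzero : ∀ p ∈ Ω, f (p, 0) = p) :
    MeasureTheory.IntegrableOn (Helicity.helicityDensity α) (Helicity.configSpace Ω) ∧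
    MeasureTheory.IntegrableOn
      (Helicity.helicityDensity (Helicity.pushforward (fun p => f (p, 1)) Ω α))
      (Helicity.configSpace ((fun p => f (p, 1)) '' Ω)) ∧
    Helicity.helicity ((fun p => f (p, 1)) '' Ω)
        (Helicity.pushforward (fun p => f (p, 1)) Ω α) =
      Helicity.helicity Ω α := by
  obtain ⟨v, b, c, h⟩ := Helicity.exists_isRegularIsotopy hΩ hf hdiffeo hzero
  obtain ⟨C, hC⟩ := Helicity.exists_helicityDensity_eq k
  have m0 : (0 : ℝ) ∈ Icc (0 : ℝ) 1 := left_mem_Icc.2 zero_le_one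
  have m1 : (1 : ℝ) ∈ Icc (0 : ℝ) 1 := right_mem_Icc.2 zero_le_one
  have j0 : IntegrableOn (Helicity.linkDensity α (Helicity.kernel k) fun p => f (p, 0))
      (interior Ω ×ˢ interior Ω) :=
    (Helicity.integrableOn_linkDensity_and_tendsto hΩ.isCompact hα h m0).1
  have j1 : IntegrableOn (Helicity.linkDensity α (Helicity.kernel k) fun p => f (p, 1))
      (interior Ω ×ˢ interior Ω) :=
    (Helicity.integrableOn_linkDensity_and_tendsto hΩ.isCompact hα h m1).1
  have hdet : ∀ x ∈ interior Ω, 0 ≤ (fderiv ℝ (fun p => f (p, 1)) x).det := fun x hx =>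
    h.pos.le.trans (h.le_det 1 m1 x hx)
  have hlink := Helicity.linkIntegral_kernel_one_eq hΩ hα h
  simp only [Helicity.linkIntegral] at hlink
  obtain ⟨i0, e0⟩ := Helicity.integrableOn_and_helicity_eq hC hΩ hzero j0
  obtain ⟨i1, e1⟩ :=
    Helicity.IsDiffeoOn.integrableOn_and_helicity_pushforward hC hΩ (hdiffeo 1 m1) hdet j1
  exact ⟨i0, i1, by rw [e0, e1, hlink]⟩

end
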